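/- Let $m,n\ge 0$ be integers with $m+n>0$, let $\mathbf B=\{\overline m<\cdots<\overline 1<1<\cdots<n\}$, where $|b|=0$ (even) for barred letters and $|b|=1$ (odd) for the others, and let $I=\{\overline{m-1},\dots,\overline 1,0,1,\dots,n-1\}$ index the simple roots $\alpha_{\overline k}=\epsilon_{\overline{k+1}}-\epsilon_{\overline k}$, $\alpha_0=\epsilon_{\overline 1}-\epsilon_1$, $\alpha_l=\epsilon_l-\epsilon_{l+1}$ of $\mathfrak{gl}_{m|n}$ (the index $0$ is present only if $m,n\ge1$). A crystal graph for $\mathfrak{gl}_{m|n}$ is a set $B$ with maps $\mathrm{wt}:B\to\bigoplus_b\mathbb Z\epsilon_b$, $\varepsilon_i,\varphi_i:B\to\mathbb Z_{\ge0}$, $e_i,f_i:B\to B\cup\{0\}$ ($i\in I$) such that: $\varphi_i-\varepsilon_i=\langle h_i,\mathrm{wt}\rangle$ for $i\ne0$; $\langle h_0,\mathrm{wt}\rangle\ge0$, and $\varphi_0+\varepsilon_0$ is $0$ if $\langle h_0,\mathrm{wt}\rangle=0$ and $1$ otherwise; $e_i$ (resp. $f_i$), where non-zero, changes $(\varepsilon_i,\varphi_i,\mathrm{wt})$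 by $(-1,+1,+\alpha_i)$ (resp. $(+1,-1,-\alpha_i)$); and $f_ib=b'\iff b=e_ib'$. Here, for $\mu=\sum_b\mu_b\epsilon_b$, $\langle h_i,\mu\rangle=\mu_b-\mu_{b'}$ for $i\neq 0$ and $\langle h_0,\mu\rangle=\mu_{\overline1}+\mu_1$, where $\alpha_i=\epsilon_b-\epsilon_{b'}$. A subset of a crystal graph is a subcrystal if it is itself a crystal graph with respect to the same maps. Direct sums are disjoint unions, and isomorphisms are bijections preserving the $i$-coloured arrows $b\to f_ib$, $\mathrm{wt}$, $\varepsilon_i$ and $\varphi_i$. Words in $\mathbf B$ form a crystal graph: $w_1\cdots w_r$ is identified with $w_1\otimes\cdots\otimes w_r$, where $\mathbf B$ is the crystal $\overline m\to\cdots\to\overline1\xrightarrow{0}1\to\cdots\to n$ of the natural representation (with $\mathrm{wt}(b)=\epsilon_b$, and $\varepsilon_i(b)$, $\varphi_i(b)$ the numbers of incoming and outgoing $i$-arrows). The tensor product rule is that of Benkart, Kang and Kashiwara. For $b_1\otimes b_2$, the operator acts on $b_1$ exactly in the following cases, and on $b_2$ otherwise: for $i$ barred, $e_i$ if $\varphi_i(b_1)\ge\varepsilon_i(b_2)$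 and $f_i$ if $\varphi_i(b_1)>\varepsilon_i(b_2)$; for $i\geq 1$, $e_i$ if $\varphi_i(b_2)<\varepsilon_i(b_1)$ and $f_i$ if $\varphi_i(b_2)\le\varepsilon_i(b_1)$; for $i=0$, $e_0$ and $f_0$ if $\langle h_0,\mathrm{wt}(b_1)\rangle>0$. On words, $\mathrm{wt}$ is additive and $\varepsilon_i,\varphi_i$ are the largest $k$ with $e_i^kw\ne0$, $f_i^kw\neq 0$; the empty word is the trivial crystal. Let $\mathcal P_{m|n}$ be the set of partitions $\lambda$ with $\lambda_{m+1}\le n$. For $\lambda\in\mathcal P_{m|n}$, let $\mathbf B_{m|n}(\lambda)$ be the set of tableaux of shape $\lambda$ with entries in $\mathbf B$, weakly increasing along rows and columns, in which the even entries strictly increase down columns and the odd entries strictly increase along rows; it is viewed as a subcrystal of the crystal of words by reading the columns from right to left, each from top to bottom. Let $\mathbf M$ be the set of matrices $A=(a_{bb'})_{b,b'\in\mathbf B}$ of non-negative integers with $a_{bb'}\le1$ whenever $|b|\ne|b'|$. Order $\mathbf B\times\mathbf B$ by $(i,j)<(k,l)$ iff $j<l$, or $j=l$ is even and $i>k$,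 or $j=l$ is odd and $i<k$. List each pair $(b,b')$ exactly $a_{bb'}$ times, in weakly increasing order; this gives a biword $(\mathbf i,\mathbf j)$, which determines $A$. Define $e_iA$, $f_iA$ as the matrices of $(e_i\mathbf i,\mathbf j)$, $(f_i\mathbf i,\mathbf j)$ (and $0$ if $e_i\mathbf i=0$, resp. $f_i\mathbf i=0$), and set $e_i^*A=(e_i(A^t))^t$, $f_i^*A=(f_i(A^t))^t$. Let $\mathfrak M=\{A\in\mathbf M\mid A=A^t\}$ with the diagonal action $\mathbf e_iA=e_ie_i^*A$, $\mathbf f_iA=f_if_i^*A$, with $\mathrm{wt}(A)=\mathrm{wt}(\mathbf i)$, $\varepsilon_i(A)=\max\{k\mid\mathbf e_i^kA\ne0\}$ and $\varphi_i(A)=\max\{k\mid\mathbf f_i^kA\ne0\}$. For $A\in\mathfrak M$ put $$\mathfrak o(A)=\bigl|\{b\ \text{even}\mid a_{bb}\equiv1\pmod 2\}\bigr|+\sum_{b\ \text{odd}}a_{bb}.$$ **Proposition.** $\mathfrak M$ is a crystal graph for $\mathfrak{gl}_{m|n}$. For every $k\ge0$, the set $\mathfrak M_k=\{A\in\mathfrak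 M\mid\mathfrak o(A)=k\}$ is a subcrystal of $\mathfrak M$, and $$\mathfrak M_k\simeq\bigoplus_{\lambda\in\mathcal P_{m|n},\ o(\lambda)=k}\mathbf B_{m|n}(\lambda)$$ as crystal graphs for $\mathfrak{gl}_{m|n}$, where $o(\lambda)$ is the number of odd parts of $\lambda$. -/

import Mathlib

noncomputable section

namespace SuperCrystal

/-! ## Letters, weights and simple roots of `gl(m|n)`

The ordered alphabet `m̄ < ⋯ < 1̄ < 1 < ⋯ < n` is modelled by `Fin (m + n)`: the position `p < m` is
the even letter with bar number `m - p`, and the position `p ≥ m` is the odd letter `p - m + 1`.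
The simple roots are indexed by `Fin (m + n - 1)`; the root `i` joins the consecutive letters
`i` and `i + 1`.  It is a barred index if `i + 1 < m`, the index `0` if `i + 1 = m`
and a positive index if `m < i + 1`. -/

abbrev Letter (m n : ℕ) := Fin (m + n)

abbrev Index (m n : ℕ) := Fin (m + n - 1)

abbrev Weight (m n : ℕ) := Letter m n → ℤ

/-- `b` is an odd (unbarred) letter, that is `|b| = 1`. -/
def IsOdd {m n : ℕ} (b : Letter m n) : Prop := m ≤ b.val

instance {m n : ℕ} (b : Letter m n) : Decidable (IsOdd b) :=
  inferInstanceAs (Decidable (m ≤ b.val))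

/-- The smaller of the two letters joined by the `i`-th simple root. -/
def lo {m n : ℕ} (i : Index m n) : Letter m n := ⟨i.val, by have := i.isLt; omega⟩

/-- The larger of the two letters joined by the `i`-th simple root. -/
def hi {m n : ℕ} (i : Index m n) : Letter m n := ⟨i.val + 1, by have := i.isLt; omega⟩

/-- `i` is one of the indices with a bar. -/
def IsBarred {m n : ℕ} (i : Index m n) : Prop := i.val + 1 < m

/-- `i` is the index `0`, whose root joins the last even letter and the first odd letter. -/
def IsZero {m n : ℕ} (i : Index m n) : Prop := i.val + 1 = m

instance {m n : ℕ} (i : Index m n) : Decidable (IsBarred i) :=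
  inferInstanceAs (Decidable (i.val + 1 < m))

instance {m n : ℕ} (i : Index m n) : Decidable (IsZero i) :=
  inferInstanceAs (Decidable (i.val + 1 = m))

/-- The basis element `ε_b` of the weight lattice. -/
def basisWeight {m n : ℕ} (b : Letter m n) : Weight m n := Pi.single b 1

/-- The bilinear form with `(ε_b, ε_b') = (-1)^{|b|} δ_{bb'}`. -/
def form {m n : ℕ} (μ ν : Weight m n) : ℤ :=
  ∑ b, (if IsOdd b then (-1 : ℤ) else 1) * μ b * ν b

/-- The simple root `α_i`. -/
def root {m n : ℕ} (i : Index m n) : Weight m n := basisWeight (lo i) - basisWeight (hi i)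

/-- The pairing `⟨h_i, μ⟩` with the simple coroot. -/
def coroot {m n : ℕ} (i : Index m n) (μ : Weight m n) : ℤ :=
  if IsBarred i ∨ IsZero i then form (root i) μ else - form (root i) μ

/-! ## Crystal graphs -/

/-- The maps of a crystal graph for `gl(m|n)`; `none` plays the role of the formal symbol `0`. -/
structure CrystalData (m n : ℕ) (B : Type*) where
  wt : B → Weight m n
  eps : Index m n → B → ℕ
  phi : Index m n → B → ℕ
  e : Index m n → B → Option B
  f : Index m n → B → Option B

/-- The axioms of a crystal graph for `gl(m|n)`. -/
structure IsCrystal {m n : ℕ} {B : Type*} (C : CrystalData m n B) : Prop where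
  phi_sub_eps : ∀ i b, ¬ IsZero i → (C.phi i b : ℤ) - C.eps i b = coroot i (C.wt b)
  coroot_nonneg : ∀ i b, IsZero i → 0 ≤ coroot i (C.wt b)
  phi_add_eps : ∀ i b, IsZero i →
    ((coroot i (C.wt b) = 0 → C.phi i b + C.eps i b = 0) ∧
      (0 < coroot i (C.wt b) → C.phi i b + C.eps i b = 1))
  of_e : ∀ i b b', C.e i b = some b' →
    (C.eps i b' : ℤ) = C.eps i b - 1 ∧ (C.phi i b' : ℤ) = C.phi i b + 1 ∧
      C.wt b' = C.wt b + root i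
  of_f : ∀ i b b', C.f i b = some b' →
    (C.eps i b' : ℤ) = C.eps i b + 1 ∧ (C.phi i b' : ℤ) = C.phi i b - 1 ∧
      C.wt b' = C.wt b - root i
  f_iff_e : ∀ i b b', C.f i b = some b' ↔ C.e i b' = some b

/-- `S ∪ {0}` is stable under all the operators `e_i`, `f_i`. -/
def IsStable {m n : ℕ} {B : Type*} (C : CrystalData m n B) (S : Set B) : Prop :=
  ∀ i, ∀ b ∈ S, ∀ b', (C.e i b = some b' ∨ C.f i b = some b') → b' ∈ S

open Classical in
/-- An element of `B ∪ {0}`, seen in `S ∪ {0}`. -/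
def restrictOption {B : Type*} (S : Set B) (x : Option B) : Option S :=
  x.bind fun b => if h : b ∈ S then some ⟨b, h⟩ else none

/-- The maps of `C` on a subset `S` (meant for `S ∪ {0}` stable under the operators). -/
def CrystalData.restrict {m n : ℕ} {B : Type*} (C : CrystalData m n B) (S : Set B) :
    CrystalData m n S where
  wt b := C.wt b
  eps i b := C.eps i b
  phi i b := C.phi i b
  e i b := restrictOption S (C.e i b)
  f i b := restrictOption S (C.f i b)

/-- The subset `S` is itself a crystal graph with respect to the maps of `C`. -/
def IsSubcrystal {m n : ℕ} {B : Type*} (C : CrystalData m n B) (S : Set B) : Prop :=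
  IsStable C S ∧ IsCrystal (C.restrict S)

/-- The direct sum: the disjoint union. -/
def directSum {m n : ℕ} {J : Type*} {B : J → Type*} (C : ∀ j, CrystalData m n (B j)) :
    CrystalData m n (Σ j, B j) where
  wt x := (C x.1).wt x.2
  eps i x := (C x.1).eps i x.2
  phi i x := (C x.1).phi i x.2
  e i x := ((C x.1).e i x.2).map (Sigma.mk x.1)
  f i x := ((C x.1).f i x.2).map (Sigma.mk x.1)

/-- Isomorphisms: bijections preserving the coloured arrows, `wt`, `ε_i` and `φ_i`. -/
structure CrystalIso {m n : ℕ} {B B' : Type*} (C : CrystalData m n B) (D : CrystalData m n B')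
    extends B ≃ B' where
  wt_eq : ∀ b, D.wt (toFun b) = C.wt b
  eps_eq : ∀ i b, D.eps i (toFun b) = C.eps i b
  phi_eq : ∀ i b, D.phi i (toFun b) = C.phi i b
  e_eq : ∀ i b, D.e i (toFun b) = (C.e i b).map toFun
  f_eq : ∀ i b, D.f i (toFun b) = (C.f i b).map toFun

/-! ## The crystal of words

A single letter has at most one incoming and one outgoing `i`-arrow, and `lo i → hi i` is the only
`i`-arrow.  The word `b :: w` is identified with `b ⊗ w`, and the functions below are the tensor
product rule in the three cases: `i` barred, `i = 0`, and `i` positive.  The empty word is the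
trivial crystal. -/

def letterEps {m n : ℕ} (i : Index m n) (b : Letter m n) : ℕ := if b = hi i then 1 else 0

def letterPhi {m n : ℕ} (i : Index m n) (b : Letter m n) : ℕ := if b = lo i then 1 else 0

def letterE {m n : ℕ} (i : Index m n) (b : Letter m n) : Option (Letter m n) :=
  if b = hi i then some (lo i) else none

def letterF {m n : ℕ} (i : Index m n) (b : Letter m n) : Option (Letter m n) :=
  if b = lo i then some (hi i) else none

def wordWt {m n : ℕ} : List (Letter m n) → Weight m n
  | [] => 0
  | b :: w => basisWeight b + wordWt w

def wordEps {m n : ℕ} (i : Index m n) : List (Letter m n) → ℕ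
  | [] => 0
  | b :: w =>
    if IsBarred i then
      (max (letterEps i b : ℤ) ((wordEps i w : ℤ) - coroot i (basisWeight b))).toNat
    else if IsZero i then
      if 0 < coroot i (basisWeight b) then letterEps i b else wordEps i w
    else
      (max ((letterEps i b : ℤ) - coroot i (wordWt w)) (wordEps i w : ℤ)).toNat

def wordPhi {m n : ℕ} (i : Index m n) : List (Letter m n) → ℕ
  | [] => 0
  | b :: w =>
    if IsBarred i then
      (max ((letterPhi i b : ℤ) + coroot i (wordWt w)) (wordPhi i w : ℤ)).toNat
    else if IsZero i then
      if 0 < coroot i (basisWeight b) then letterPhi i b else wordPhi i w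
    else
      (max (letterPhi i b : ℤ) ((wordPhi i w : ℤ) + coroot i (basisWeight b))).toNat

def wordE {m n : ℕ} (i : Index m n) : List (Letter m n) → Option (List (Letter m n))
  | [] => none
  | b :: w =>
    let left := (letterE i b).map fun b' => b' :: w
    let right := (wordE i w).map fun w' => b :: w'
    if IsBarred i then
      if wordEps i w ≤ letterPhi i b then left else right
    else if IsZero i then
      if 0 < coroot i (basisWeight b) then left else right
    else
      if wordPhi i w < letterEps i b then left else right

def wordF {m n : ℕ} (i : Index m n) : List (Letter m n) → Option (List (Letter m n))
  | [] => none
  | b :: w =>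
    let left := (letterF i b).map fun b' => b' :: w
    let right := (wordF i w).map fun w' => b :: w'
    if IsBarred i then
      if wordEps i w < letterPhi i b then left else right
    else if IsZero i then
      if 0 < coroot i (basisWeight b) then left else right
    else
      if wordPhi i w ≤ letterEps i b then left else right

/-- The crystal graph of all finite words. -/
def wordCrystal (m n : ℕ) : CrystalData m n (List (Letter m n)) where
  wt := wordWt
  eps := wordEps
  phi := wordPhi
  e := wordE
  f := wordF

/-! ## Hook semistandard tableaux

Partitions are Young diagrams; `μ.rowLen k` is the part number `k + 1`. -/

/-- `(m,n)`-hook partitions. -/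
def IsHook (m n : ℕ) (μ : YoungDiagram) : Prop := μ.rowLen m ≤ n

/-- The number of odd parts. -/
def oddParts (μ : YoungDiagram) : ℕ := μ.rowLens.countP fun r => r % 2 = 1

/-- `(m,n)`-hook semistandard tableaux of shape `μ`; cells are written (row, column). -/
structure HookTableau (m n : ℕ) (μ : YoungDiagram) where
  entry : (r c : ℕ) → (r, c) ∈ μ → Letter m n
  row_weak : ∀ r c c' (h : (r, c) ∈ μ) (h' : (r, c') ∈ μ), c < c' →
    entry r c h ≤ entry r c' h'
  col_weak : ∀ r r' c (h : (r, c) ∈ μ) (h' : (r', c) ∈ μ), r < r' →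
    entry r c h ≤ entry r' c h'
  row_strict : ∀ r c c' (h : (r, c) ∈ μ) (h' : (r, c') ∈ μ), c < c' →
    IsOdd (entry r c h) → IsOdd (entry r c' h') → entry r c h < entry r c' h'
  col_strict : ∀ r r' c (h : (r, c) ∈ μ) (h' : (r', c) ∈ μ), r < r' →
    ¬ IsOdd (entry r c h) → ¬ IsOdd (entry r' c h') → entry r c h < entry r' c h'

/-- The column reading: columns from right to left, each column from top to bottom. -/
def HookTableau.word {m n : ℕ} {μ : YoungDiagram} (T : HookTableau m n μ) : List (Letter m n) :=
  (List.finRange (μ.rowLen 0)).reverse.flatMap fun c =>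
    List.ofFn fun r : Fin (μ.colLen c) => T.entry r c (YoungDiagram.mem_iff_lt_colLen.2 r.isLt)

/-- The set of hook semistandard tableaux of shape `μ`, viewed as a set of words. -/
def tableauWords (m n : ℕ) (μ : YoungDiagram) : Set (List (Letter m n)) :=
  Set.range fun T : HookTableau m n μ => T.word

/-- The crystal `B_{m|n}(μ)`, as a subset of the crystal of words. -/
def tableauCrystal (m n : ℕ) (μ : YoungDiagram) : CrystalData m n (tableauWords m n μ) :=
  (wordCrystal m n).restrict (tableauWords m n μ)

/-! ## Matrices, biwords and the two actions -/

abbrev Mat (m n : ℕ) := Matrix (Letter m n) (Letter m n) ℕ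

/-- The set `M` (for `u = m`, `v = n`): entries of mixed parity are at most `1`. -/
def superMatrices (m n : ℕ) : Set (Mat m n) :=
  {A | ∀ b b', ¬ (IsOdd b ↔ IsOdd b') → A b b' ≤ 1}

/-- The set of symmetric matrices in `M`. -/
def symMatrices (m n : ℕ) : Set (Mat m n) := {A | A ∈ superMatrices m n ∧ A = A.transpose}

/-- The biword of `A`: each pair `(b, b')` occurs `A b b'` times, and the pairs increase in the super
lexicographic order, in which `(i, j) < (k, l)` means that `j < l`, or `j = l` is even and `i > k`,
or `j = l` is odd and `i < k`. -/
def biword {m n : ℕ} (A : Mat m n) : List (Letter m n × Letter m n) :=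
  (List.finRange (m + n)).flatMap fun b' =>
    (if IsOdd b' then List.finRange (m + n) else (List.finRange (m + n)).reverse).flatMap fun b =>
      List.replicate (A b b') (b, b')

/-- The matrix whose entry at `(b, b')` is the number of occurrences of `(b, b')`. -/
def matrixOf {m n : ℕ} (p : List (Letter m n × Letter m n)) : Mat m n :=
  Matrix.of fun b b' => p.count (b, b')

/-- The row-index word of the biword of `A`. -/
def rowWord {m n : ℕ} (A : Mat m n) : List (Letter m n) := (biword A).map Prod.fst

/-- For a word operator `x` (one of `e_i`, `f_i`), its first action on matrices:
`x (i, j) = (x i, j)` where `(i, j)` is the biword of `A`. -/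
def rowAct {m n : ℕ} (x : List (Letter m n) → Option (List (Letter m n))) (A : Mat m n) :
    Option (Mat m n) :=
  (x (rowWord A)).map fun w => matrixOf (w.zip ((biword A).map Prod.snd))

/-- The second action `x* (k, l) = (k, x l)`, where `A` is the matrix of `(k, l)` and `(l, k)` is
increasing in the super lexicographic order, that is, `(l, k)` is the biword of the transpose. -/
def colAct {m n : ℕ} (x : List (Letter m n) → Option (List (Letter m n))) (A : Mat m n) :
    Option (Mat m n) :=
  (x (rowWord A.transpose)).map fun w =>
    matrixOf (((biword A.transpose).map Prod.snd).zip w)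

/-- The diagonal action `x x*` of a word operator `x` on matrices. -/
def diagAct {m n : ℕ} (x : List (Letter m n) → Option (List (Letter m n))) (A : Mat m n) :
    Option (Mat m n) :=
  (colAct x A).bind (rowAct x)

/-- `max {k | x^k A ≠ 0}`. -/
def stringLength {X : Type*} (x : X → Option X) (A : X) : ℕ :=
  sSup {k : ℕ | (fun y : Option X => y.bind x)^[k] (some A) ≠ none}

/-- The maps of the diagonal action; they are meant on symmetric matrices in `M`. -/
def diagData (m n : ℕ) : CrystalData m n (Mat m n) where
  wt A := wordWt (rowWord A)
  eps i A := stringLength (diagAct (wordE i)) A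
  phi i A := stringLength (diagAct (wordF i)) A
  e i A := diagAct (wordE i) A
  f i A := diagAct (wordF i) A

/-- The symmetric matrices in `M` with the maps of the diagonal action. -/
def symCrystal (m n : ℕ) : CrystalData m n (symMatrices m n) :=
  (diagData m n).restrict (symMatrices m n)

/-- The number of odd diagonal entries in the even block plus the sum of the diagonal entries in the
odd block. -/
def diagOdd {m n : ℕ} (A : Mat m n) : ℕ :=
  (Finset.univ.filter fun b : Letter m n => ¬ IsOdd b ∧ A b b % 2 = 1).card +
    ∑ b ∈ Finset.univ.filter (fun b : Letter m n => IsOdd b), A b b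

/-- The symmetric matrices `A` in `M` with `diagOdd A = k`. -/
def symLevel (m n k : ℕ) : Set (symMatrices m n) := {A | diagOdd A.val = k}

end SuperCrystal

end

/-! The proof is the Robinson-Schensted-Knuth correspondence for an alphabet with even and odd
letters, restricted to symmetric matrices. `Below a b` says that `b` is admissible under `a` in a
column; `¬ Below b a` says that `b` is admissible to the right of `a` in a row. Both `Below` and its
negation are transitive, and these two facts make the classical arguments for column insertion work
for both parities at once.

Write P(A) for the column insertion tableau of the first row of the biword of A (`matTab`). Three
facts carry the theorem.

(1) Insertion is a morphism of crystals. Appending a letter to the reading word of a sequence of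
columns and inserting the letter give words with the same ε and φ, and f_i commutes with the
insertion and preserves shapes. This is `ins_morphism`, an induction over the columns whose heart is
the case of one column (`phi_bump`, `wordF_bump`). Consequently e_i and f_i act on the insertion
tableau of a word and keep the shape of the tableau of every prefix, so they do not change the
recording tableau. `IsPlactic` collects these properties.

(2) The correspondence is symmetric. If a largest letter stands at the end of column k, and a letter
is inserted into the rest with the insertion ending in column t, then the two added cells lie in
columns t and k when t ≠ k, and in columns k and k + 1 when t = k (`ins_addAt`). The rule is
symmetric in t and k, so A and its transpose have tableaux of the same shape (`colLens_biTab_swap`),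
and P(Aᵗ) is the recording tableau of A (`biTab_swap_concat`). Reverse insertion shows that A ↦
(P(A), P(Aᵗ)) is a bijection from M to the pairs of tableaux of equal shape (`biTab_injective`,
`exists_biTab_eq`); symmetric matrices therefore correspond to single tableaux. The row action
changes P(A) and fixes P(Aᵗ). The diagonal action on a symmetric matrix thus applies the operator to
both equal tableaux, and yields again a symmetric matrix (`diagAct_eq_some`).

(3) The number of odd parts of a partition is the alternating sum of its column lengths
(`altSum_colLen`). For a symmetric matrix, take the last pair of the biword off together with its
mirror image. If it is its own mirror image, one cell of column 0 disappears. If not, the symmetry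
forces t = k in the local rule, so that cells in adjacent columns disappear and cancel in the
alternating sum. The statistic 𝔬 changes in the same way (`altSum_colLens_biTab`), hence 𝔬(A) is the
number of odd parts of the shape of P(A).

The crystal axioms are pulled back from the crystal of words along A ↦ reading word of P(A), and the
levels of 𝔬 are stable because the operators preserve shapes. -/

namespace SuperCrystal

/-! ## The order relations on letters -/

/-- `b` may stand directly below `a` in a column. -/
def Below {m n : ℕ} (a b : Letter m n) : Prop := a < b ∨ (a = b ∧ IsOdd a)

instance {m n : ℕ} (a b : Letter m n) : Decidable (Below a b) :=
  inferInstanceAs (Decidable (a < b ∨ (a = b ∧ IsOdd a)))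

section Order
variable {m n : ℕ} {a b c : Letter m n}

theorem Below.trans (h : Below a b) (h' : Below b c) : Below a c := by
  rcases h with h | ⟨rfl, h⟩
  · rcases h' with h' | ⟨rfl, _⟩
    · exact Or.inl (h.trans h')
    · exact Or.inl h
  · exact h'

theorem not_below_iff : ¬ Below a b ↔ b < a ∨ (a = b ∧ ¬ IsOdd a) := by
  unfold Below
  constructor
  · intro h
    push Not at h
    rcases h.1.lt_or_eq with h' | h'
    · exact Or.inl h'
    · exact Or.inr ⟨h'.symm, h.2 h'.symm⟩
  · rintro (h | ⟨rfl, h⟩)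
    · rintro (h' | ⟨rfl, _⟩)
      · exact lt_asymm h h'
      · exact lt_irrefl _ h
    · rintro (h' | ⟨_, h'⟩)
      · exact lt_irrefl _ h'
      · exact h h'

/-- The row relation is transitive as well as the column relation, since `¬ Below` is the reverse
order with equality allowed for even letters only. Almost all later arguments on bumping rest on
this pair of transitivities. -/
theorem not_below_trans (h : ¬ Below a b) (h' : ¬ Below b c) : ¬ Below a c := by
  rw [not_below_iff] at *
  rcases h with h | ⟨rfl, h⟩
  · rcases h' with h' | ⟨rfl, _⟩
    · exact Or.inl (h'.trans h)
    · exact Or.inl h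
  · exact h'

theorem Below.le (h : Below a b) : a ≤ b := by
  rcases h with h | ⟨rfl, _⟩
  · exact h.le
  · exact le_rfl

theorem le_of_not_below (h : ¬ Below a b) : b ≤ a := by
  rcases not_below_iff.1 h with h | ⟨rfl, _⟩
  · exact h.le
  · exact le_rfl

theorem below_self : Below a a ↔ IsOdd a := by simp [Below]

theorem below_of_lt (h : a < b) : Below a b := Or.inl h

end Order

/-! ## Column insertion into one column -/

/-- Insertion of a letter into a column: the first entry which cannot stay above it is bumped. -/
def colIns {m n : ℕ} (x : Letter m n) : List (Letter m n) → List (Letter m n) × Option (Letter m n)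
  | [] => ([x], none)
  | a :: c => if Below a x then (a :: (colIns x c).1, (colIns x c).2) else (x :: c, some a)

section Column
variable {m n : ℕ}

theorem colIns_append {x : Letter m n} {c : List (Letter m n)} (h : ∀ a ∈ c, Below a x) :
    colIns x c = (c ++ [x], none) := by
  induction c with
  | nil => rfl
  | cons a c ih =>
    have h1 := h a (by simp)
    have h2 := ih fun b hb => h b (by simp [hb])
    simp [colIns, h1, h2]

theorem colIns_bump {x y : Letter m n} {l r : List (Letter m n)} (h : ∀ a ∈ l, Below a x)
    (hy : ¬ Below y x) : colIns x (l ++ y :: r) = (l ++ x :: r, some y) := by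
  induction l with
  | nil => simp [colIns, hy]
  | cons a l ih =>
    have h1 := h a (by simp)
    have h2 := ih fun b hb => h b (by simp [hb])
    simp [colIns, h1, h2]

theorem column_cases (x : Letter m n) (c : List (Letter m n)) :
    (∀ a ∈ c, Below a x) ∨
      ∃ l y r, c = l ++ y :: r ∧ (∀ a ∈ l, Below a x) ∧ ¬ Below y x := by
  induction c with
  | nil => simp
  | cons a c ih =>
    by_cases ha : Below a x
    · rcases ih with h | ⟨l, y, r, rfl, h, hy⟩
      · left; simpa [ha] using h
      · exact Or.inr ⟨a :: l, y, r, rfl, by simpa [ha] using h, hy⟩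
    · exact Or.inr ⟨[], a, c, rfl, by simp, ha⟩

theorem colIns_eq_none {x : Letter m n} {c : List (Letter m n)} (h : (colIns x c).2 = none) :
    ∀ a ∈ c, Below a x := by
  rcases column_cases x c with h' | ⟨l, y, r, rfl, h1, h2⟩
  · exact h'
  · simp [colIns_bump h1 h2] at h

theorem colIns_eq_some {x y : Letter m n} {c : List (Letter m n)} (h : (colIns x c).2 = some y) :
    ∃ l r, c = l ++ y :: r ∧ (∀ a ∈ l, Below a x) ∧ ¬ Below y x ∧ (colIns x c).1 = l ++ x :: r := by
  rcases column_cases x c with h' | ⟨l, y', r, rfl, h1, h2⟩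
  · simp [colIns_append h'] at h
  · rw [colIns_bump h1 h2] at h ⊢
    obtain rfl : y' = y := by simpa using h
    exact ⟨l, r, rfl, h1, h2, rfl⟩

/-- A column: each entry may stand above all later ones. -/
abbrev IsColumn (c : List (Letter m n)) : Prop := c.Pairwise Below

/-- An entry under `y` which could not stand under `x` could not stand under `y` either, by
transitivity of `¬ Below`. -/
theorem isColumn_bump {x y : Letter m n} {l r : List (Letter m n)} (hc : IsColumn (l ++ y :: r))
    (h : ∀ a ∈ l, Below a x) (hy : ¬ Below y x) : IsColumn (l ++ x :: r) := by
  simp only [IsColumn, List.pairwise_append, List.pairwise_cons, List.mem_cons] at hc ⊢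
  obtain ⟨h1, ⟨h2, h3⟩, h4⟩ := hc
  refine ⟨h1, ⟨fun b hb => ?_, h3⟩, ?_⟩
  · by_contra hb'
    exact not_below_trans hy hb' (h2 b hb)
  · rintro a ha b (rfl | hb)
    · exact h a ha
    · exact h4 a ha b (Or.inr hb)

theorem isColumn_concat {x : Letter m n} {c : List (Letter m n)} (hc : IsColumn c)
    (h : ∀ a ∈ c, Below a x) : IsColumn (c ++ [x]) := by
  simp only [IsColumn, List.pairwise_append, List.mem_singleton]
  exact ⟨hc, List.pairwise_singleton _ _, fun a ha b hb => hb ▸ h a ha⟩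

theorem mem_colIns {x a : Letter m n} {c : List (Letter m n)} (h : a ∈ (colIns x c).1) :
    a = x ∨ a ∈ c := by
  rcases column_cases x c with h' | ⟨l, y, r, rfl, h1, h2⟩
  · rw [colIns_append h'] at h; simp at h; tauto
  · rw [colIns_bump h1 h2] at h; simp at h ⊢; tauto

end Column

/-! ## Insertion into a tableau -/

/-- A filling with columns `T 0, T 1, …`. -/
abbrev Filling (m n : ℕ) := ℕ → List (Letter m n)

/-- The filling without its first column. -/
def tailF {m n : ℕ} (T : Filling m n) : Filling m n := fun k => T (k + 1)

/-- The filling with first column `c` followed by `T`. -/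
def consF {m n : ℕ} (c : List (Letter m n)) (T : Filling m n) : Filling m n
  | 0 => c
  | k + 1 => T k

/-- The column `k` after inserting `x` into `T`. -/
def insAux {m n : ℕ} : ℕ → Letter m n → Filling m n → List (Letter m n)
  | 0, x, T => (colIns x (T 0)).1
  | k + 1, x, T => match (colIns x (T 0)).2 with
    | none => T (k + 1)
    | some y => insAux k y (tailF T)

/-- Column insertion of `x` into `T`; a bumped letter is inserted into the next column. -/
def ins {m n : ℕ} (x : Letter m n) (T : Filling m n) : Filling m n := fun k => insAux k x T

/-- The insertion of `x` into `T` terminates in column `k`. -/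
def EndsAt {m n : ℕ} : ℕ → Letter m n → Filling m n → Prop
  | 0, x, T => (colIns x (T 0)).2 = none
  | k + 1, x, T => ∃ y, (colIns x (T 0)).2 = some y ∧ EndsAt k y (tailF T)

/-- The column lengths. -/
def colLens {m n : ℕ} (T : Filling m n) : ℕ → ℕ := fun k => (T k).length

/-- The filling with `N` put at the end of column `k`. -/
def addAt {m n : ℕ} (k : ℕ) (N : Letter m n) (T : Filling m n) : Filling m n :=
  Function.update T k (T k ++ [N])

section Insertion
variable {m n : ℕ}

@[simp] theorem tailF_consF (c : List (Letter m n)) (T : Filling m n) : tailF (consF c T) = T := rfl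
@[simp] theorem consF_zero (c : List (Letter m n)) (T : Filling m n) : consF c T 0 = c := rfl
@[simp] theorem consF_succ (c : List (Letter m n)) (T : Filling m n) (k : ℕ) :
    consF c T (k + 1) = T k := rfl
@[simp] theorem consF_tailF (T : Filling m n) : consF (T 0) (tailF T) = T := by
  funext k; cases k <;> rfl
theorem consF_inj {c c' : List (Letter m n)} {T T' : Filling m n} (h : consF c T = consF c' T') :
    c = c' ∧ T = T' :=
  ⟨congrFun h 0, funext fun k => congrFun h (k + 1)⟩

theorem ins_append {x : Letter m n} {c : List (Letter m n)} {T : Filling m n}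
    (h : ∀ a ∈ c, Below a x) : ins x (consF c T) = consF (c ++ [x]) T := by
  funext k; cases k <;> simp [ins, insAux, colIns_append h]

theorem ins_bump {x y : Letter m n} {l r : List (Letter m n)} {T : Filling m n}
    (h : ∀ a ∈ l, Below a x) (hy : ¬ Below y x) :
    ins x (consF (l ++ y :: r) T) = consF (l ++ x :: r) (ins y T) := by
  funext k; cases k <;> simp [ins, insAux, colIns_bump h hy]

theorem endsAt_zero_iff {x : Letter m n} {c : List (Letter m n)} {T : Filling m n} :
    EndsAt 0 x (consF c T) ↔ ∀ a ∈ c, Below a x :=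
  ⟨fun h => colIns_eq_none h, fun h => by simp [EndsAt, colIns_append h]⟩

theorem endsAt_succ_iff {x : Letter m n} {c : List (Letter m n)} {T : Filling m n} {k : ℕ} :
    EndsAt (k + 1) x (consF c T) ↔
      ∃ l y r, c = l ++ y :: r ∧ (∀ a ∈ l, Below a x) ∧ ¬ Below y x ∧ EndsAt k y T := by
  constructor
  · rintro ⟨y, h, h'⟩
    obtain ⟨l, r, h1, h2, h3, -⟩ := colIns_eq_some h
    exact ⟨l, y, r, h1, h2, h3, h'⟩
  · rintro ⟨l, y, r, rfl, h1, h2, h3⟩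
    exact ⟨y, by simp [colIns_bump h1 h2], h3⟩

theorem exists_endsAt (N : ℕ) : ∀ (x : Letter m n) (T : Filling m n), (∀ k, N ≤ k → T k = []) →
    ∃ k ≤ N, EndsAt k x T := by
  induction N with
  | zero => intro x T h; exact ⟨0, le_rfl, by simp [EndsAt, h 0 le_rfl, colIns]⟩
  | succ N ih =>
    intro x T h
    rcases column_cases x (T 0) with h' | ⟨l, y, r, h1, h2, h3⟩
    · exact ⟨0, by omega, by simp [EndsAt, colIns_append h']⟩
    · obtain ⟨k, hk, hk'⟩ := ih y (tailF T) fun k hk => h (k + 1) (by omega)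
      exact ⟨k + 1, by omega, y, by simp [h1, colIns_bump h2 h3], hk'⟩

theorem colLens_consF (c : List (Letter m n)) (T : Filling m n) (k : ℕ) :
    colLens (consF c T) (k + 1) = colLens T k := rfl

/-- Each bump preserves the length of its column, so only the terminal column grows. Conversely the
terminal column can be read off the two shapes, which is how shapes are compared below. -/
theorem colLens_ins {k : ℕ} : ∀ {x : Letter m n} {T : Filling m n}, EndsAt k x T →
    colLens (ins x T) = colLens T + Pi.single k 1 := by
  induction k with
  | zero =>
    intro x T h
    rw [← consF_tailF T] at h ⊢
    rw [ins_append (endsAt_zero_iff.1 h)]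
    funext j
    cases j <;> simp [colLens, tailF]
  | succ k ih =>
    intro x T h
    rw [← consF_tailF T] at h ⊢
    obtain ⟨l, y, r, hc, h1, h2, h3⟩ := endsAt_succ_iff.1 h
    rw [hc, ins_bump h1 h2]
    funext j
    cases j with
    | zero => simp [colLens]
    | succ j =>
      have := congrFun (ih h3) j
      simp only [Pi.add_apply, colLens_consF] at this ⊢
      rw [this]
      simp [Pi.single_apply]

theorem single_one_inj {j k : ℕ} (h : (Pi.single j 1 : ℕ → ℕ) = Pi.single k 1) : j = k := by
  have := congrFun h j
  by_contra hne
  simp [hne] at this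

theorem endsAt_unique {j k : ℕ} {x : Letter m n} {T : Filling m n} (h : EndsAt j x T)
    (h' : EndsAt k x T) : j = k := by
  have := (colLens_ins h).symm.trans (colLens_ins h')
  exact single_one_inj (add_left_cancel this)

theorem mem_ins {a : Letter m n} : ∀ (k : ℕ) {x : Letter m n} {T : Filling m n}, a ∈ ins x T k →
    a = x ∨ ∃ j ≤ k, a ∈ T j := by
  intro k
  induction k with
  | zero =>
    intro x T h
    rcases mem_colIns (show a ∈ (colIns x (T 0)).1 from h) with h | h
    · exact Or.inl h
    · exact Or.inr ⟨0, le_rfl, h⟩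
  | succ k ih =>
    intro x T h
    rw [← consF_tailF T] at h
    rcases column_cases x (T 0) with h' | ⟨l, y, r, hc, h1, h2⟩
    · rw [ins_append h'] at h
      exact Or.inr ⟨k + 1, le_rfl, h⟩
    · rw [hc, ins_bump h1 h2] at h
      rcases ih h with rfl | ⟨j, hj, hj'⟩
      · exact Or.inr ⟨0, by omega, by simp [hc]⟩
      · exact Or.inr ⟨j + 1, by omega, hj'⟩

/-- The insertion ends weakly to the left when the second letter may stand below the first. -/
theorem endsAt_le {k₀ : ℕ} : ∀ {k : ℕ} {x₀ x : Letter m n} {T : Filling m n},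
    (∀ j, IsColumn (T j)) → EndsAt k₀ x₀ T → EndsAt k x (ins x₀ T) → Below x₀ x → k ≤ k₀ := by
  induction k₀ with
  | zero =>
    intro k x₀ x T hT h0 h hx
    rw [← consF_tailF T] at h0 h
    have h0' := endsAt_zero_iff.1 h0
    rw [ins_append h0'] at h
    have : EndsAt 0 x (consF (T 0 ++ [x₀]) (tailF T)) := by
      rw [endsAt_zero_iff]
      intro a ha
      rcases List.mem_append.1 ha with ha | ha
      · exact (h0' a ha).trans hx
      · rw [List.mem_singleton.1 ha]; exact hx
    exact (endsAt_unique h this).le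
  | succ k₀ ih =>
    intro k x₀ x T hT h0 h hx
    rw [← consF_tailF T] at h0 h
    obtain ⟨l, y₀, r, hc, h1, h2, h3⟩ := endsAt_succ_iff.1 h0
    rw [hc, ins_bump h1 h2] at h
    cases k with
    | zero => omega
    | succ k =>
      obtain ⟨l', y, r', hc', h1', h2', h3'⟩ := endsAt_succ_iff.1 h
      -- The letter `x` is admissible under `x₀` and under everything above it, so it bumps some `y`
      -- strictly below the cell where `y₀` stood. The bumped letters are then in the same relation,
      -- and the induction continues in the next column.
      have hy : Below y₀ y := by
        have hr : y ∈ r := by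
          have hmem : y ∈ l ++ x₀ :: r := by rw [hc']; simp
          rcases List.mem_append.1 hmem with hm | hm
          · exact absurd ((h1 y hm).trans hx) h2'
          · rcases List.mem_cons.1 hm with rfl | hm
            · exact absurd hx h2'
            · exact hm
        have hcol := hT 0
        rw [hc] at hcol
        simp only [IsColumn, List.pairwise_append, List.pairwise_cons] at hcol
        exact hcol.2.1.1 y hr
      have := ih (fun j => hT (j + 1)) h3 h3' hy
      omega

/-- The insertion ends strictly to the right when the second letter may not stand below the
first. -/
theorem endsAt_lt {k₀ : ℕ} : ∀ {k : ℕ} {x₀ x : Letter m n} {T : Filling m n},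
    (∀ j, IsColumn (T j)) → EndsAt k₀ x₀ T → EndsAt k x (ins x₀ T) → ¬ Below x₀ x → k₀ < k := by
  induction k₀ with
  | zero =>
    intro k x₀ x T hT h0 h hx
    rw [← consF_tailF T] at h0 h
    rw [ins_append (endsAt_zero_iff.1 h0)] at h
    rcases Nat.eq_zero_or_pos k with rfl | hk
    · exact absurd (endsAt_zero_iff.1 h x₀ (by simp)) hx
    · exact hk
  | succ k₀ ih =>
    intro k x₀ x T hT h0 h hx
    rw [← consF_tailF T] at h0 h
    obtain ⟨l, y₀, r, hc, h1, h2, h3⟩ := endsAt_succ_iff.1 h0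
    rw [hc, ins_bump h1 h2] at h
    cases k with
    | zero => exact absurd (endsAt_zero_iff.1 h x₀ (by simp)) hx
    | succ k =>
      obtain ⟨l', y, r', hc', h1', h2', h3'⟩ := endsAt_succ_iff.1 h
      -- Here `x` bumps at or above the cell of `x₀`. Thus `y` is `x₀` itself or an entry above it;
      -- in both cases `Below y₀ y` would give `Below y₀ x₀`.
      have hy : ¬ Below y₀ y := by
        intro hy
        rcases List.append_eq_append_iff.1 hc' with ⟨s, hs, hs'⟩ | ⟨s, hs, hs'⟩
        · cases s with
          | nil => 
            simp at hs'
            exact h2 (hs'.1 ▸ hy)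
          | cons z s =>
            simp at hs'
            obtain ⟨rfl, -⟩ := hs'
            exact hx (h1' x₀ (by simp [hs]))
        · cases s with
          | nil => 
            simp at hs'
            exact h2 (hs'.1 ▸ hy)
          | cons z s =>
            simp at hs'
            obtain ⟨rfl, -⟩ := hs'
            exact h2 (hy.trans (h1 y (by simp [hs])))
      have := ih (fun j => hT (j + 1)) h3 h3' hy
      omega

/-- The relation between two consecutive letters is visible in the shapes alone. This ties the order
condition on biwords to the recording tableau. -/
theorem below_iff_endsAt_le {k₀ k : ℕ} {x₀ x : Letter m n} {T : Filling m n}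
    (hT : ∀ j, IsColumn (T j)) (h0 : EndsAt k₀ x₀ T) (h : EndsAt k x (ins x₀ T)) :
    Below x₀ x ↔ k ≤ k₀ := by
  refine ⟨endsAt_le hT h0 h, fun hk => ?_⟩
  by_contra hx
  exact absurd (endsAt_lt hT h0 h hx) (by omega)

/-- In the column after the bump, the cell of `x` is the last one whose entry may not stand under
`y`; hence `y` and the new column determine the bump. -/
theorem bump_injective {l r l' r' : List (Letter m n)} {x x' y : Letter m n}
    (hc : IsColumn (l ++ y :: r)) (hc' : IsColumn (l' ++ y :: r')) (hy : ¬ Below y x) (hy' : ¬ Below y x')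
    (heq : l ++ x :: r = l' ++ x' :: r') : l = l' ∧ x = x' ∧ r = r' := by
  simp only [IsColumn, List.pairwise_append, List.pairwise_cons] at hc hc'
  rcases List.append_eq_append_iff.1 heq with ⟨s, hs, hs'⟩ | ⟨s, hs, hs'⟩
  · cases s with
    | nil => simp at hs hs'; exact ⟨hs.symm, hs'⟩
    | cons z s =>
      simp at hs'
      exact absurd (hc.2.1.1 x' (by simp [hs'.2])) hy'
  · cases s with
    | nil => simp at hs hs'; exact ⟨hs, hs'.1.symm, hs'.2.symm⟩
    | cons z s =>
      simp at hs'
      exact absurd (hc'.2.1.1 x (by simp [hs'.2])) hy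

/-- The terminal column `k` is prescribed for both insertions: starting from the last cell of column
`k`, the bumps can be undone uniquely from right to left. -/
theorem ins_injective {k : ℕ} : ∀ {x x' : Letter m n} {T T' : Filling m n},
    (∀ j, IsColumn (T j)) → (∀ j, IsColumn (T' j)) → EndsAt k x T → EndsAt k x' T' →
    ins x T = ins x' T' → x = x' ∧ T = T' := by
  induction k with
  | zero =>
    intro x x' T T' hT hT' h h' heq
    rw [← consF_tailF T] at h heq ⊢
    rw [← consF_tailF T'] at h' heq ⊢
    rw [ins_append (endsAt_zero_iff.1 h), ins_append (endsAt_zero_iff.1 h')] at heq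
    obtain ⟨h1, h2⟩ := consF_inj heq
    obtain ⟨h3, h4⟩ := List.append_inj' h1 rfl
    simp at h4
    exact ⟨h4, by rw [h3, h2]⟩
  | succ k ih =>
    intro x x' T T' hT hT' h h' heq
    have hT0 := hT 0
    have hT0' := hT' 0
    rw [← consF_tailF T] at h heq ⊢
    rw [← consF_tailF T'] at h' heq ⊢
    obtain ⟨l, y, r, hc, h1, h2, h3⟩ := endsAt_succ_iff.1 h
    obtain ⟨l', y', r', hc', h1', h2', h3'⟩ := endsAt_succ_iff.1 h'
    rw [hc, ins_bump h1 h2, hc', ins_bump h1' h2'] at heq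
    obtain ⟨e1, e2⟩ := consF_inj heq
    obtain ⟨rfl, e3⟩ := ih (fun j => hT (j + 1)) (fun j => hT' (j + 1)) h3 h3' e2
    rw [hc] at hT0
    rw [hc'] at hT0'
    obtain ⟨rfl, rfl, rfl⟩ := bump_injective hT0 hT0' h2 h2' e1
    exact ⟨rfl, by rw [hc, hc', show tailF T = tailF T' from e3]⟩

/-! ### Insertion and the largest entry -/

/-- `N` may be put at the end of column `k` as the largest entry. -/
structure IsLargest (N : Letter m n) (k : ℕ) (T : Filling m n) : Prop where
  le : ∀ j, ∀ a ∈ T j, a ≤ N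
  odd : IsOdd N → ∀ j < k, N ∉ T j
  even : ¬ IsOdd N → ∀ j, k ≤ j → N ∉ T j

theorem addAt_zero (N : Letter m n) (c : List (Letter m n)) (T : Filling m n) :
    addAt 0 N (consF c T) = consF (c ++ [N]) T := by
  funext j; cases j <;> simp [addAt]

theorem addAt_succ (N : Letter m n) (k : ℕ) (c : List (Letter m n)) (T : Filling m n) :
    addAt (k + 1) N (consF c T) = consF c (addAt k N T) := by
  funext j
  cases j with
  | zero => simp [addAt]
  | succ j => simp [addAt, Function.update_apply]

theorem colLens_addAt (N : Letter m n) (k : ℕ) (T : Filling m n) :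
    colLens (addAt k N T) = colLens T + Pi.single k 1 := by
  funext j
  by_cases h : j = k
  · subst h; simp [addAt, colLens]
  · simp [addAt, colLens, h]

theorem ins_largest {N : Letter m n} {T : Filling m n} (h : IsLargest N 0 T) :
    EndsAt 0 N T ∧ ins N T = addAt 0 N T := by
  have h0 : ∀ a ∈ T 0, Below a N := by
    intro a ha
    rcases (h.le 0 a ha).lt_or_eq with h' | rfl
    · exact Or.inl h'
    · by_cases ho : IsOdd a
      · exact below_self.2 ho
      · exact absurd ha (h.even ho 0 le_rfl)
  rw [← consF_tailF T, endsAt_zero_iff, addAt_zero]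
  exact ⟨h0, ins_append h0⟩

theorem IsLargest.tail {N : Letter m n} {k : ℕ} {T : Filling m n} (h : IsLargest N (k + 1) T) :
    IsLargest N k (tailF T) :=
  ⟨fun j => h.le (j + 1), fun ho j hj => h.odd ho (j + 1) (by omega),
    fun he j hj => h.even he (j + 1) (by omega)⟩

theorem isLargest_cons {N : Letter m n} {k : ℕ} {c : List (Letter m n)} {T : Filling m n}
    (h : IsLargest N k T) (hle : ∀ a ∈ c, a ≤ N) (hodd : IsOdd N → N ∉ c) :
    IsLargest N (k + 1) (consF c T) := by
  refine ⟨?_, ?_, ?_⟩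
  · rintro (_ | j)
    · exact hle
    · exact h.le j
  · rintro ho (_ | j) hj
    · exact hodd ho
    · exact h.odd ho j (by omega)
  · rintro he (_ | j) hj
    · omega
    · exact h.even he j (by omega)

/-- The local rule: how insertion interacts with the largest entry. -/
theorem ins_addAt {k : ℕ} : ∀ {t : ℕ} {N x : Letter m n} {T : Filling m n}, IsLargest N k T →
    x ≤ N → (IsOdd N → x ≠ N) → EndsAt t x T →
    ins x (addAt k N T) = addAt (if t = k then k + 1 else k) N (ins x T) ∧
      IsLargest N (if t = k then k + 1 else k) (ins x T) := by
  induction k with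
  | zero =>
    intro t N x T hL hxN hodd ht
    have hNx : ¬ Below N x := by
      rintro (h | ⟨rfl, h⟩)
      · exact absurd hxN (not_le.2 h)
      · exact hodd h rfl
    have hle := hL.le
    have heven := hL.even
    rw [← consF_tailF T] at ht ⊢
    rw [addAt_zero]
    cases t with
    | zero =>
      have h0 := endsAt_zero_iff.1 ht
      rw [ins_append h0, ins_bump h0 hNx, if_pos rfl, addAt_succ]
      have h1 : IsLargest N 0 (tailF T) :=
        ⟨fun j => hle (j + 1), by simp, fun he j _ => heven he (j + 1) (by omega)⟩
      -- The letter `x` took the place of `N` at the end of its column, and `N` was bumped. Being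
      -- largest, it goes to the bottom of the next column, hence the value `k + 1`.
      rw [(ins_largest h1).2]
      refine ⟨rfl, isLargest_cons h1 ?_ ?_⟩
      · intro a ha
        rcases List.mem_append.1 ha with ha | ha
        · exact hle 0 a ha
        · rw [List.mem_singleton.1 ha]; exact hxN
      · intro ho ha
        rcases List.mem_append.1 ha with ha | ha
        · exact hNx (h0 N ha)
        · exact hodd ho (List.mem_singleton.1 ha).symm
    | succ t =>
      obtain ⟨l, y, r, hc, h1, h2, h3⟩ := endsAt_succ_iff.1 ht
      rw [if_neg (by omega)]
      rw [hc, ins_bump h1 h2, List.append_assoc, List.cons_append, ins_bump h1 h2, addAt_zero]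
      refine ⟨by simp, ⟨?_, by simp, ?_⟩⟩
      · intro j a ha
        rw [← ins_bump h1 h2] at ha
        rcases mem_ins j ha with rfl | ⟨j', -, hj'⟩
        · exact hxN
        · rw [← hc, consF_tailF] at hj'; exact hle j' a hj'
      · intro he j hj ha
        have hy : y ∈ T 0 := by simp [hc]
        rcases j with _ | j
        · simp only [consF_zero, List.mem_append, List.mem_cons] at ha
          have : N ∉ T 0 := heven he 0 le_rfl
          rw [hc] at this
          simp only [List.mem_append, List.mem_cons, not_or] at this
          rcases ha with ha | rfl | ha
          · exact this.1 ha
          · have := le_antisymm (hle 0 y hy) (le_of_not_below h2)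
            exact heven he 0 le_rfl (this ▸ hy)
          · exact this.2.2 ha
        · rcases mem_ins j (show N ∈ ins y (tailF T) j from ha) with rfl | ⟨j', -, hj'⟩
          · exact heven he 0 le_rfl hy
          · exact heven he (j' + 1) (by omega) hj'
  | succ k ih =>
    intro t N x T hL hxN hodd ht
    have hle := hL.le
    have hodd' := hL.odd
    have htail := hL.tail
    have hev := hL.even
    rw [← consF_tailF T] at ht ⊢
    rw [addAt_succ]
    cases t with
    | zero =>
      have h0 := endsAt_zero_iff.1 ht
      rw [ins_append h0, ins_append h0, if_neg (by omega), addAt_succ]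
      refine ⟨rfl, isLargest_cons htail ?_ ?_⟩
      · intro a ha
        rcases List.mem_append.1 ha with ha | ha
        · exact hle 0 a ha
        · rw [List.mem_singleton.1 ha]; exact hxN
      · intro ho ha
        rcases List.mem_append.1 ha with ha | ha
        · exact hodd' ho 0 (by omega) ha
        · exact hodd ho (List.mem_singleton.1 ha).symm
    | succ t =>
      obtain ⟨l, y, r, hc, h1, h2, h3⟩ := endsAt_succ_iff.1 ht
      have hy : y ∈ T 0 := by simp [hc]
      obtain ⟨e1, e2⟩ := ih htail (hle 0 y hy)
        (fun ho e => hodd' ho 0 (by omega) (e ▸ hy)) h3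
      -- Both columns are counted from the first one, so dropping the first column shifts `t` and
      -- `k` together.
      have hif : (if t + 1 = k + 1 then k + 1 + 1 else k + 1) = (if t = k then k + 1 else k) + 1 := by
        split_ifs <;> omega
      rw [hif, hc, ins_bump h1 h2, ins_bump h1 h2, addAt_succ, e1]
      refine ⟨rfl, isLargest_cons e2 ?_ ?_⟩
      · intro a ha
        simp only [List.mem_append, List.mem_cons] at ha
        rcases ha with ha | rfl | ha
        · exact hle 0 a (by simp [hc, ha])
        · exact hxN
        · exact hle 0 a (by simp [hc, ha])
      · intro ho ha
        simp only [List.mem_append, List.mem_cons] at ha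
        rcases ha with ha | rfl | ha
        · exact hodd' ho 0 (by omega) (by simp [hc, ha])
        · exact hodd ho rfl
        · exact hodd' ho 0 (by omega) (by simp [hc, ha])

end Insertion

/-! ## Tableaux -/

/-- The column `d` may stand to the right of the column `c`. -/
def Adjacent {m n : ℕ} (c d : List (Letter m n)) : Prop :=
  ∀ (s : ℕ) (b : Letter m n), d[s]? = some b → ∃ a, (c)[s]? = some a ∧ ¬ Below b a

/-- A filling that is a semistandard tableau. -/
structure IsTab {m n : ℕ} (T : Filling m n) : Prop where
  col : ∀ k, IsColumn (T k)
  adj : ∀ k, Adjacent (T k) (T (k + 1))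

section Tableaux
variable {m n : ℕ}

theorem Adjacent.length_le {c d : List (Letter m n)} (h : Adjacent c d) : d.length ≤ c.length := by
  by_contra hlt
  obtain ⟨a, ha, -⟩ := h c.length _ (List.getElem?_eq_getElem (by omega))
  simp at ha

theorem adjacent_nil (c : List (Letter m n)) : Adjacent c [] := by
  intro s b h; simp at h

theorem Adjacent.append {c d : List (Letter m n)} (h : Adjacent c d) (e : List (Letter m n)) :
    Adjacent (c ++ e) d := by
  intro s b hb
  obtain ⟨a, ha, hba⟩ := h s b hb
  refine ⟨a, ?_, hba⟩
  rw [List.getElem?_append_left (List.getElem?_eq_some_iff.1 ha).1, ha]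

theorem getElem?_bump {l r : List (Letter m n)} {y x : Letter m n} (s : ℕ) :
    (l ++ x :: r)[s]? = if s = l.length then some x else (l ++ y :: r)[s]? := by
  rcases lt_trichotomy s l.length with h | h | h
  · rw [if_neg h.ne, List.getElem?_append_left h, List.getElem?_append_left h]
  · subst h; simp
  · rw [if_neg h.ne', List.getElem?_append_right h.le, List.getElem?_append_right h.le]
    obtain ⟨k, hk⟩ : ∃ k, s - l.length = k + 1 := ⟨s - l.length - 1, by omega⟩
    simp [hk]

theorem below_getElem? {l r : List (Letter m n)} {x y a : Letter m n} {s : ℕ}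
    (hl : ∀ a ∈ l, Below a x) (hs : s < l.length) (h : (l ++ y :: r)[s]? = some a) : Below a x := by
  rw [List.getElem?_append_left hs] at h
  exact hl a (List.mem_of_getElem? h)

theorem IsColumn.below_getElem? {c : List (Letter m n)} (hc : IsColumn c) {s t : ℕ}
    {a b : Letter m n} (hs : (c)[s]? = some a) (ht : (c)[t]? = some b) (hst : s < t) : Below a b := by
  obtain ⟨h1, rfl⟩ := List.getElem?_eq_some_iff.1 hs
  obtain ⟨h2, rfl⟩ := List.getElem?_eq_some_iff.1 ht
  exact List.pairwise_iff_getElem.1 hc s t h1 h2 hst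

/-- Bumping `y` from a column and inserting it into the next one keeps the two columns adjacent. -/
theorem adjacent_bump {l r d : List (Letter m n)} {x y : Letter m n}
    (h : Adjacent (l ++ y :: r) d) (hl : ∀ a ∈ l, Below a x) (hy : ¬ Below y x) :
    Adjacent (l ++ x :: r) (colIns y d).1 := by
  have hyat : (l ++ y :: r)[l.length]? = some y := by simp
  -- The old entries of `d` remain admissible: `y` has been replaced by `x`, and whatever may stand
  -- to the right of `y` may stand to the right of `x`.
  have key : ∀ (s : ℕ) (b : Letter m n), d[s]? = some b → ∃ a, (l ++ x :: r)[s]? = some a ∧ ¬ Below b a := by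
    intro s b hb
    obtain ⟨a, ha, hba⟩ := h s b hb
    rw [getElem?_bump (y := y)]
    split_ifs with hs
    · subst hs
      rw [hyat] at ha
      obtain rfl : y = a := by simpa using ha
      exact ⟨x, rfl, not_below_trans hba hy⟩
    · exact ⟨a, ha, hba⟩
  -- The letter `y` may stand to the right of any entry of the new column in the rows up to the one
  -- it left. It remains to see that it lands in such a row: the entry of `d` in the old row of `y`,
  -- if any, could not stay above `y`, so `y` never moves down.
  have new : ∀ s, s ≤ l.length → ∃ a, (l ++ x :: r)[s]? = some a ∧ ¬ Below y a := by
    intro s hs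
    rcases hs.lt_or_eq with hs | rfl
    · refine ⟨l[s], by rw [List.getElem?_append_left hs]; simp, fun hya => ?_⟩
      exact hy (hya.trans (hl _ (List.getElem_mem hs)))
    · exact ⟨x, by simp, hy⟩
  rcases column_cases y d with h' | ⟨l', z, r', rfl, h1, h2⟩
  · rw [colIns_append h']
    intro s b hb
    rcases lt_or_ge s d.length with hs | hs
    · rw [List.getElem?_append_left hs] at hb
      exact key s b hb
    · have hle : d.length ≤ l.length := by
        by_contra hlt
        obtain ⟨a, ha, hba⟩ := h l.length _ (List.getElem?_eq_getElem (by omega))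
        rw [hyat] at ha
        obtain rfl : y = a := by simpa using ha
        exact hba (h' _ (List.getElem_mem _))
      rw [List.getElem?_append_right hs] at hb
      have hs' : s = d.length := by
        by_contra hne
        obtain ⟨k, hk⟩ : ∃ k, s - d.length = k + 1 := ⟨s - d.length - 1, by omega⟩
        simp [hk] at hb
      subst hs'
      obtain rfl : y = b := by simpa using hb
      exact new _ hle
  · rw [colIns_bump h1 h2]
    intro s b hb
    rw [getElem?_bump (y := z)] at hb
    split_ifs at hb with hs
    · obtain rfl : y = b := by simpa using hb
      refine new s ?_
      by_contra hlt
      have hlt : l.length < l'.length := by omega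
      obtain ⟨a, ha, hba⟩ := h l.length l'[l.length]
        (by rw [List.getElem?_append_left hlt]; simp)
      rw [hyat] at ha
      obtain rfl : y = a := by simpa using ha
      exact hba (h1 _ (List.getElem_mem _))
    · exact key s b hb

theorem IsTab.tail {T : Filling m n} (h : IsTab T) : IsTab (tailF T) :=
  ⟨fun k => h.col (k + 1), fun k => h.adj (k + 1)⟩

theorem isTab_consF {c : List (Letter m n)} {T : Filling m n} (hc : IsColumn c)
    (ha : Adjacent c (T 0)) (h : IsTab T) : IsTab (consF c T) := by
  refine ⟨?_, ?_⟩
  · rintro (_ | k)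
    · exact hc
    · exact h.col k
  · rintro (_ | k)
    · exact ha
    · exact h.adj k

theorem ins_zero (x : Letter m n) (T : Filling m n) : ins x T 0 = (colIns x (T 0)).1 := rfl

theorem IsTab.ins_endsAt {k : ℕ} : ∀ {x : Letter m n} {T : Filling m n}, IsTab T → EndsAt k x T →
    IsTab (ins x T) := by
  induction k with
  | zero =>
    intro x T hT h
    have hc := hT.col 0
    have ha := hT.adj 0
    have ht := hT.tail
    rw [← consF_tailF T] at h ⊢
    have h0 := endsAt_zero_iff.1 h
    rw [ins_append h0]
    exact isTab_consF (isColumn_concat hc h0) (ha.append _) ht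
  | succ k ih =>
    intro x T hT h
    have hc := hT.col 0
    have ha := hT.adj 0
    have ht := hT.tail
    rw [← consF_tailF T] at h ⊢
    obtain ⟨l, y, r, e, h1, h2, h3⟩ := endsAt_succ_iff.1 h
    rw [e] at hc ha
    rw [e, ins_bump h1 h2]
    refine isTab_consF (isColumn_bump hc h1 h2) ?_ (ih ht h3)
    rw [ins_zero]
    exact adjacent_bump ha h1 h2

/-! ### Reverse insertion -/

theorem exists_last_not_below {c : List (Letter m n)} {y : Letter m n}
    (h : ∃ a ∈ c, ¬ Below y a) :
    ∃ l x r, c = l ++ x :: r ∧ ¬ Below y x ∧ ∀ b ∈ r, Below y b := by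
  induction c with
  | nil => simp at h
  | cons a c ih =>
    by_cases hc : ∃ a ∈ c, ¬ Below y a
    · obtain ⟨l, x, r, rfl, h1, h2⟩ := ih hc
      exact ⟨a :: l, x, r, rfl, h1, h2⟩
    · push Not at hc
      obtain ⟨b, hb, hb'⟩ := h
      rcases List.mem_cons.1 hb with rfl | hb
      · exact ⟨[], b, c, rfl, hb', hc⟩
      · exact absurd (hc b hb) hb'

/-- Reverse bumping: `y`, bumped into the next column to give `(colIns y d).1`, comes from the
column `c`. -/
theorem reverse_bump {c d : List (Letter m n)} {y : Letter m n} (hc : IsColumn c)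
    (hd : IsColumn d) (h : Adjacent c (colIns y d).1) :
    ∃ l x r, c = l ++ x :: r ∧ (∀ a ∈ l, Below a x) ∧ ¬ Below y x ∧ IsColumn (l ++ y :: r) ∧
      Adjacent (l ++ y :: r) d := by
  -- Here `p` is the row of `y` in the next column, whether `y` was appended or has bumped a letter
  -- `z`. No entry of `d` in row `p` or further down may stand above `y`.
  have hpos : ∃ p : ℕ, (colIns y d).1[p]? = some y ∧ (∀ (s : ℕ) (b : Letter m n), d[s]? = some b → s ≠ p →
      (colIns y d).1[s]? = some b) ∧ (∀ z, d[p]? = some z → ¬ Below z y) ∧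
      (∀ (s : ℕ) (b : Letter m n), d[s]? = some b → s ≤ d.length ∧ (p < s → ¬ Below b y)) := by
    rcases column_cases y d with h' | ⟨l', z, r', rfl, h1, h2⟩
    · refine ⟨d.length, ?_, ?_, ?_, ?_⟩
      · simp [colIns_append h']
      · intro s b hb _
        rw [colIns_append h', List.getElem?_append_left (List.getElem?_eq_some_iff.1 hb).1, hb]
      · intro z hz; simp at hz
      · intro s b hb
        have := (List.getElem?_eq_some_iff.1 hb).1
        exact ⟨this.le, fun hs => by omega⟩
    · refine ⟨l'.length, ?_, ?_, ?_, ?_⟩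
      · simp [colIns_bump h1 h2]
      · intro s b hb hs
        rw [colIns_bump h1 h2, getElem?_bump (y := z), if_neg hs, hb]
      · intro z' hz
        obtain rfl : z = z' := by simpa using hz
        exact h2
      · intro s b hb
        refine ⟨(List.getElem?_eq_some_iff.1 hb).1.le, fun hs hby => h2 ?_⟩
        exact (hd.below_getElem? (by simp) hb hs).trans hby
  obtain ⟨p, hp, hne, hz, hgt⟩ := hpos
  obtain ⟨a, ha, hya⟩ := h p y hp
  obtain ⟨l, x, r, rfl, hx, hr⟩ := exists_last_not_below ⟨a, List.mem_of_getElem? ha, hya⟩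
  have hcol := hc
  simp only [IsColumn, List.pairwise_append, List.pairwise_cons, List.mem_cons] at hc
  obtain ⟨c1, ⟨c2, c3⟩, c4⟩ := hc
  have hl : ∀ b ∈ l, Below b x := fun b hb => c4 b hb x (Or.inl rfl)
  have hly : ∀ b ∈ l, Below b y := by
    intro b hb
    by_contra hby
    exact not_below_trans hby hx (hl b hb)
  refine ⟨l, x, r, rfl, hl, hx, ?_, ?_⟩
  · simp only [IsColumn, List.pairwise_append, List.pairwise_cons, List.mem_cons]
    refine ⟨c1, ⟨hr, c3⟩, ?_⟩
    rintro b hb b' (rfl | hb')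
    · exact hly b hb
    · exact c4 b hb b' (Or.inr hb')
  · have hpl : p ≤ l.length := by
      by_contra hlt
      have : a ∈ r := by
        rw [List.getElem?_append_right (by omega)] at ha
        obtain ⟨k, hk⟩ : ∃ k, p - l.length = k + 1 := ⟨p - l.length - 1, by omega⟩
        rw [hk] at ha
        exact List.mem_of_getElem? (by simpa using ha)
      exact hya (hr a this)
    intro s b hb
    rw [getElem?_bump (y := x)]
    split_ifs with hs
    · refine ⟨y, rfl, ?_⟩
      rcases hpl.lt_or_eq with hlt | heq
      · exact (hgt s b hb).2 (by omega)
      · exact hz b (by rw [heq, ← hs]; exact hb)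
    · by_cases hsp : s = p
      · subst hsp
        exact ⟨a, ha, not_below_trans (hz b hb) hya⟩
      · exact h s b (hne s b hb hsp)

/-- Reverse insertion. -/
theorem exists_ins_eq {k : ℕ} : ∀ {T : Filling m n}, IsTab T →
    (T (k + 1)).length < (T k).length →
    ∃ T' x, IsTab T' ∧ EndsAt k x T' ∧ ins x T' = T := by
  induction k with
  | zero =>
    intro T hT hlt
    rcases List.eq_nil_or_concat (T 0) with h | ⟨c, x, h⟩
    · simp [h] at hlt
    have hc := hT.col 0
    have ha := hT.adj 0
    rw [h] at hc ha hlt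
    simp only [IsColumn, List.concat_eq_append, List.pairwise_append] at hc
    have hcx : ∀ a ∈ c, Below a x := fun a ha => hc.2.2 a ha x (by simp)
    refine ⟨consF c (tailF T), x, isTab_consF hc.1 ?_ hT.tail, endsAt_zero_iff.2 hcx, ?_⟩
    · intro s b hb
      obtain ⟨a, ha', hba⟩ := ha s b hb
      refine ⟨a, ?_, hba⟩
      have hs : s < c.length := by
        have := (List.getElem?_eq_some_iff.1 hb).1
        simp [tailF] at this hlt
        omega
      rw [List.concat_eq_append, List.getElem?_append_left hs] at ha'
      exact ha'
    · rw [ins_append hcx]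
      conv_rhs => rw [← consF_tailF T, h, List.concat_eq_append]
  | succ k ih =>
    intro T hT hlt
    obtain ⟨T', y, h1, h2, h3⟩ := ih hT.tail hlt
    have ha : Adjacent (T 0) (colIns y (T' 0)).1 := by
      have := hT.adj 0
      rwa [show T (0 + 1) = tailF T 0 from rfl, ← h3, ins_zero] at this
    obtain ⟨l, x, r, e, hl, hy, hc', ha'⟩ := reverse_bump (hT.col 0) (h1.col 0) ha
    refine ⟨consF (l ++ y :: r) T', x, isTab_consF hc' ha' h1,
      endsAt_succ_iff.2 ⟨l, y, r, rfl, hl, hy, h2⟩, ?_⟩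
    rw [ins_bump hl hy, h3, ← e, consF_tailF]

/-! ### The insertion tableau of a word -/

/-- The insertion tableau of a word. -/
def insTab (w : List (Letter m n)) : Filling m n := w.foldl (fun T x => ins x T) fun _ => []

@[simp] theorem insTab_nil : insTab ([] : List (Letter m n)) = fun _ => [] := rfl

@[simp] theorem insTab_concat (w : List (Letter m n)) (x : Letter m n) :
    insTab (w ++ [x]) = ins x (insTab w) := by
  simp [insTab]

theorem insTab_supp (w : List (Letter m n)) : ∀ k, w.length ≤ k → insTab w k = [] := by
  induction w using List.reverseRecOn with
  | nil => simp
  | append_singleton w x ih =>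
    intro k hk
    obtain ⟨t, ht, hend⟩ := exists_endsAt _ x _ ih
    have := congrFun (colLens_ins hend) k
    simp only [List.length_append, List.length_singleton] at hk
    rw [insTab_concat]
    simp only [colLens, Pi.add_apply, ih k (by omega), Pi.single_apply] at this
    rw [if_neg (by omega)] at this
    simpa using this

theorem insTab_endsAt (w : List (Letter m n)) (x : Letter m n) :
    ∃ k ≤ w.length, EndsAt k x (insTab w) :=
  exists_endsAt _ x _ (insTab_supp w)

theorem isTab_insTab (w : List (Letter m n)) : IsTab (insTab w) := by
  induction w using List.reverseRecOn with
  | nil => exact ⟨fun _ => by simp [IsColumn], fun _ => adjacent_nil _⟩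
  | append_singleton w x ih =>
    obtain ⟨t, ht, hend⟩ := insTab_endsAt w x
    rw [insTab_concat]
    exact ih.ins_endsAt hend

theorem mem_insTab {w : List (Letter m n)} : ∀ {k : ℕ} {a : Letter m n}, a ∈ insTab w k →
    a ∈ w := by
  induction w using List.reverseRecOn with
  | nil => simp
  | append_singleton w x ih =>
    intro k a ha
    rw [insTab_concat] at ha
    rcases mem_ins k ha with rfl | ⟨j, -, hj⟩
    · simp
    · simp [ih hj]

/-- Removing the largest letter of a word removes the largest entry of its insertion tableau. -/
theorem insTab_largest {N : Letter m n} {u : List (Letter m n)} (hu : ∀ a ∈ u, a ≤ N)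
    (hu' : ¬ IsOdd N → N ∉ u) (v : List (Letter m n)) (hv : ∀ a ∈ v, a ≤ N)
    (hv' : IsOdd N → N ∉ v) :
    ∃ k, IsLargest N k (insTab (u ++ v)) ∧ insTab (u ++ N :: v) = addAt k N (insTab (u ++ v)) := by
  induction v using List.reverseRecOn with
  | nil =>
    have h : IsLargest N 0 (insTab u) :=
      ⟨fun j a ha => hu a (mem_insTab ha), by simp, fun he j _ hj => hu' he (mem_insTab hj)⟩
    refine ⟨0, by simpa using h, ?_⟩
    rw [insTab_concat, List.append_nil]
    exact (ins_largest h).2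
  | append_singleton v x ih =>
    obtain ⟨k, h1, h2⟩ := ih (fun a ha => hv a (by simp [ha]))
      (fun ho h => hv' ho (by simp [h]))
    obtain ⟨t, -, ht⟩ := insTab_endsAt (u ++ v) x
    have := ins_addAt h1 (hv x (by simp)) (fun ho h => hv' ho (by simp [h])) ht
    refine ⟨if t = k then k + 1 else k, ?_, ?_⟩
    · rw [← List.append_assoc, insTab_concat]; exact this.2
    · rw [← List.append_assoc, ← List.cons_append, ← List.append_assoc, insTab_concat,
        insTab_concat, h2]
      exact this.1

end Tableaux

/-! ## The crystal of words -/

section Words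
variable {m n : ℕ} {i : Index m n}

theorem lo_lt_hi (i : Index m n) : lo i < hi i := by simp [lo, hi]

theorem lo_ne_hi (i : Index m n) : lo i ≠ hi i := (lo_lt_hi i).ne

theorem hi_le_of_lo_lt {b : Letter m n} (h : lo i < b) : hi i ≤ b := by
  simp only [lo, hi, Fin.lt_def, Fin.le_def] at *; omega

theorem isOdd_lo : IsOdd (lo i) ↔ m ≤ i.val := Iff.rfl

theorem isOdd_hi : IsOdd (hi i) ↔ m ≤ i.val + 1 := Iff.rfl

theorem form_basisWeight (μ : Weight m n) (b : Letter m n) :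
    form μ (basisWeight b) = (if IsOdd b then (-1 : ℤ) else 1) * μ b := by
  unfold form basisWeight
  rw [Finset.sum_eq_single b]
  · simp
  · intro c _ hc; simp [hc]
  · simp

theorem root_apply (i : Index m n) (b : Letter m n) :
    root i b = (if b = lo i then 1 else 0) - (if b = hi i then 1 else 0) := by
  simp [root, basisWeight, Pi.single_apply]

theorem coroot_add (i : Index m n) (μ ν : Weight m n) :
    coroot i (μ + ν) = coroot i μ + coroot i ν := by
  unfold coroot form
  split_ifs
  · rw [← Finset.sum_add_distrib]; congr 1; funext b; simp only [Pi.add_apply]; ring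
  · rw [← neg_add, ← Finset.sum_add_distrib]; congr 2; funext b; simp only [Pi.add_apply]; ring

theorem coroot_zero (i : Index m n) : coroot i (0 : Weight m n) = 0 := by
  simp [coroot, form]

theorem coroot_basis (hz : ¬ IsZero i) (b : Letter m n) :
    coroot i (basisWeight b) = (letterPhi i b : ℤ) - letterEps i b := by
  unfold coroot
  rw [form_basisWeight, root_apply]
  have h1 := lo_ne_hi i
  unfold letterPhi letterEps
  by_cases hb : IsBarred i
  · have e1 : ¬ IsOdd (lo i) := by rw [isOdd_lo]; unfold IsBarred at hb; omega
    have e2 : ¬ IsOdd (hi i) := by rw [isOdd_hi]; unfold IsBarred at hb; omega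
    by_cases hl : b = lo i
    · subst hl; simp [h1, hb, e1]
    · by_cases hh : b = hi i
      · subst hh; simp [h1.symm, hb, e2]
      · simp [hl, hh]
  · have e1 : IsOdd (lo i) := by rw [isOdd_lo]; unfold IsBarred at hb; unfold IsZero at hz; omega
    have e2 : IsOdd (hi i) := by rw [isOdd_hi]; unfold IsBarred at hb; omega
    by_cases hl : b = lo i
    · subst hl; simp [h1, hb, hz, e1]
    · by_cases hh : b = hi i
      · subst hh; simp [h1.symm, hb, hz, e2]
      · simp [hl, hh]

/-- The sign of the form on the odd letter `hi i` cancels the sign in the root, which gives a sum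
where the other indices have a difference. -/
theorem coroot_basis_zero (hz : IsZero i) (b : Letter m n) :
    coroot i (basisWeight b) = (letterPhi i b : ℤ) + letterEps i b := by
  unfold coroot
  rw [form_basisWeight, root_apply]
  have h1 := lo_ne_hi i
  unfold letterPhi letterEps
  have e1 : ¬ IsOdd (lo i) := by rw [isOdd_lo]; unfold IsZero at hz; omega
  have e2 : IsOdd (hi i) := by rw [isOdd_hi]; unfold IsZero at hz; omega
  by_cases hl : b = lo i
  · subst hl; simp [h1, hz, e1]
  · by_cases hh : b = hi i
    · subst hh; simp [h1.symm, hz, e2]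
    · simp [hl, hh]

theorem letter_cases (i : Index m n) (b : Letter m n) :
    (b = lo i ∧ letterPhi i b = 1 ∧ letterEps i b = 0) ∨
      (b = hi i ∧ letterPhi i b = 0 ∧ letterEps i b = 1) ∨
      (b ≠ lo i ∧ b ≠ hi i ∧ letterPhi i b = 0 ∧ letterEps i b = 0) := by
  have h1 := lo_ne_hi i
  unfold letterPhi letterEps
  by_cases hl : b = lo i
  · subst hl; simp [h1]
  · by_cases hh : b = hi i
    · subst hh; simp [h1.symm]
    · simp [hl, hh]

theorem IsZero.not_isBarred (hz : IsZero i) : ¬ IsBarred i := by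
  unfold IsZero at hz; unfold IsBarred; omega

theorem wordPhi_sub_wordEps (hz : ¬ IsZero i) (w : List (Letter m n)) :
    (wordPhi i w : ℤ) - wordEps i w = coroot i (wordWt w) := by
  induction w with
  | nil => simp [wordPhi, wordEps, wordWt, coroot_zero]
  | cons b w ih =>
    rw [wordWt, coroot_add, wordPhi, wordEps, coroot_basis hz]
    have := letter_cases i b
    by_cases hb : IsBarred i
    · rw [if_pos hb, if_pos hb]; omega
    · rw [if_neg hb, if_neg hz, if_neg hb, if_neg hz]; omega

/-! ### The recursions over the natural numbers -/

/-- The maximum with `toNat` becomes a truncated subtraction. In this form the signature rule is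
linear arithmetic over `ℕ`, here and for the other indices. -/
theorem eps_cons_barred (hb : IsBarred i) (b : Letter m n) (w : List (Letter m n)) :
    wordEps i (b :: w) = letterEps i b + (wordEps i w - letterPhi i b) := by
  have hz : ¬ IsZero i := fun h => h.not_isBarred hb
  rw [wordEps, if_pos hb, coroot_basis hz]
  have := letter_cases i b
  omega

theorem phi_cons_barred (hb : IsBarred i) (b : Letter m n) (w : List (Letter m n)) :
    wordPhi i (b :: w) = wordPhi i w + (letterPhi i b - wordEps i w) := by
  have hz : ¬ IsZero i := fun h => h.not_isBarred hb
  rw [wordPhi, if_pos hb, ← wordPhi_sub_wordEps hz]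
  have := letter_cases i b
  omega

theorem eps_cons_pos (hb : ¬ IsBarred i) (hz : ¬ IsZero i) (b : Letter m n)
    (w : List (Letter m n)) :
    wordEps i (b :: w) = wordEps i w + (letterEps i b - wordPhi i w) := by
  rw [wordEps, if_neg hb, if_neg hz, ← wordPhi_sub_wordEps hz]
  have := letter_cases i b
  omega

theorem phi_cons_pos (hb : ¬ IsBarred i) (hz : ¬ IsZero i) (b : Letter m n)
    (w : List (Letter m n)) :
    wordPhi i (b :: w) = letterPhi i b + (wordPhi i w - letterEps i b) := by
  rw [wordPhi, if_neg hb, if_neg hz, coroot_basis hz]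
  have := letter_cases i b
  omega

theorem eps_cons_zero (hz : IsZero i) (b : Letter m n) (w : List (Letter m n)) :
    wordEps i (b :: w) = if letterPhi i b + letterEps i b = 0 then wordEps i w
      else letterEps i b := by
  rw [wordEps, if_neg hz.not_isBarred, if_pos hz, coroot_basis_zero hz]
  have := letter_cases i b
  split_ifs <;> omega

theorem phi_cons_zero (hz : IsZero i) (b : Letter m n) (w : List (Letter m n)) :
    wordPhi i (b :: w) = if letterPhi i b + letterEps i b = 0 then wordPhi i w
      else letterPhi i b := by
  rw [wordPhi, if_neg hz.not_isBarred, if_pos hz, coroot_basis_zero hz]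
  have := letter_cases i b
  split_ifs <;> omega

theorem eps_nil : wordEps i ([] : List (Letter m n)) = 0 := rfl

theorem phi_nil : wordPhi i ([] : List (Letter m n)) = 0 := rfl

/-- This is the bracket rule: each uncancelled `lo i` of `u` cancels one uncancelled `hi i` of `v`.
For a positive index the roles are exchanged: `hi i` on the left cancels `lo i` on the right. For
the index `0` the first factor containing `lo i` or `hi i` decides. -/
theorem eps_append_barred (hb : IsBarred i) (u v : List (Letter m n)) :
    wordEps i (u ++ v) = wordEps i u + (wordEps i v - wordPhi i u) ∧
      wordPhi i (u ++ v) = wordPhi i v + (wordPhi i u - wordEps i v) := by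
  induction u with
  | nil => simp [eps_nil, phi_nil]
  | cons b u ih =>
    have := letter_cases i b
    simp only [List.cons_append, eps_cons_barred hb, phi_cons_barred hb]
    omega

theorem eps_append_pos (hb : ¬ IsBarred i) (hz : ¬ IsZero i) (u v : List (Letter m n)) :
    wordEps i (u ++ v) = wordEps i v + (wordEps i u - wordPhi i v) ∧
      wordPhi i (u ++ v) = wordPhi i u + (wordPhi i v - wordEps i u) := by
  induction u with
  | nil => simp [eps_nil, phi_nil]
  | cons b u ih =>
    have := letter_cases i b
    simp only [List.cons_append, eps_cons_pos hb hz, phi_cons_pos hb hz]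
    omega

theorem eps_append_zero (hz : IsZero i) (u v : List (Letter m n)) :
    (wordEps i (u ++ v) = if wordPhi i u + wordEps i u = 0 then wordEps i v else wordEps i u) ∧
      wordPhi i (u ++ v) = if wordPhi i u + wordEps i u = 0 then wordPhi i v
        else wordPhi i u := by
  induction u with
  | nil => simp [eps_nil, phi_nil]
  | cons b u ih =>
    have := letter_cases i b
    simp only [List.cons_append, eps_cons_zero hz, phi_cons_zero hz]
    split_ifs at * <;> omega

/-! ### The positions where the operators act -/

/-- The signature condition for `f_i` to change the letter between `l` and `r`. -/
def Acts (i : Index m n) (l r : List (Letter m n)) : Prop :=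
  if IsBarred i then wordPhi i l = 0 ∧ wordEps i r = 0
  else if IsZero i then wordPhi i l = 0 ∧ wordEps i l = 0
  else wordEps i l = 0 ∧ wordPhi i r = 0

theorem letterF_eq (i : Index m n) (b : Letter m n) :
    letterF i b = if letterPhi i b = 1 then some (hi i) else none := by
  unfold letterF letterPhi; split_ifs <;> simp_all

theorem letterE_eq (i : Index m n) (b : Letter m n) :
    letterE i b = if letterEps i b = 1 then some (lo i) else none := by
  unfold letterE letterEps; split_ifs <;> simp_all

@[simp] theorem letterPhi_lo : letterPhi i (lo i) = 1 := by simp [letterPhi]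
@[simp] theorem letterPhi_hi : letterPhi i (hi i) = 0 := by simp [letterPhi, (lo_ne_hi i).symm]
@[simp] theorem letterEps_hi : letterEps i (hi i) = 1 := by simp [letterEps]
@[simp] theorem letterEps_lo : letterEps i (lo i) = 0 := by simp [letterEps, lo_ne_hi i]
@[simp] theorem letterF_lo : letterF i (lo i) = some (hi i) := by simp [letterF]
@[simp] theorem letterE_hi : letterE i (hi i) = some (lo i) := by simp [letterE]

theorem wordF_cons_barred (hb : IsBarred i) (b : Letter m n) (w : List (Letter m n)) :
    wordF i (b :: w) = if wordEps i w < letterPhi i b then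
      (letterF i b).map (fun b' => b' :: w) else (wordF i w).map (fun w' => b :: w') := by
  simp [wordF, hb]

theorem wordF_cons_zero (hz : IsZero i) (b : Letter m n) (w : List (Letter m n)) :
    wordF i (b :: w) = if letterPhi i b + letterEps i b ≠ 0 then
      (letterF i b).map (fun b' => b' :: w) else (wordF i w).map (fun w' => b :: w') := by
  simp only [wordF, hz.not_isBarred, hz, if_true, if_false, coroot_basis_zero hz]
  congr 1
  apply propext; omega

theorem wordF_cons_pos (hb : ¬ IsBarred i) (hz : ¬ IsZero i) (b : Letter m n)
    (w : List (Letter m n)) :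
    wordF i (b :: w) = if wordPhi i w ≤ letterEps i b then
      (letterF i b).map (fun b' => b' :: w) else (wordF i w).map (fun w' => b :: w') := by
  simp [wordF, hb, hz]

theorem wordE_cons_barred (hb : IsBarred i) (b : Letter m n) (w : List (Letter m n)) :
    wordE i (b :: w) = if wordEps i w ≤ letterPhi i b then
      (letterE i b).map (fun b' => b' :: w) else (wordE i w).map (fun w' => b :: w') := by
  simp [wordE, hb]

theorem wordE_cons_zero (hz : IsZero i) (b : Letter m n) (w : List (Letter m n)) :
    wordE i (b :: w) = if letterPhi i b + letterEps i b ≠ 0 then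
      (letterE i b).map (fun b' => b' :: w) else (wordE i w).map (fun w' => b :: w') := by
  simp only [wordE, hz.not_isBarred, hz, if_true, if_false, coroot_basis_zero hz]
  congr 1
  apply propext; omega

theorem wordE_cons_pos (hb : ¬ IsBarred i) (hz : ¬ IsZero i) (b : Letter m n)
    (w : List (Letter m n)) :
    wordE i (b :: w) = if wordPhi i w < letterEps i b then
      (letterE i b).map (fun b' => b' :: w) else (wordE i w).map (fun w' => b :: w') := by
  simp [wordE, hb, hz]

/-- The condition `Acts i l r` does not mention the letter in the middle. The same condition
therefore describes `f_i` at `lo i` and `e_i` at `hi i`, and this is why the two operators are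
mutually inverse. -/
theorem wordF_of_acts {l r : List (Letter m n)} (h : Acts i l r) :
    wordF i (l ++ lo i :: r) = some (l ++ hi i :: r) ∧
      wordE i (l ++ hi i :: r) = some (l ++ lo i :: r) := by
  unfold Acts at h
  by_cases hb : IsBarred i
  · rw [if_pos hb] at h
    obtain ⟨hl, hr⟩ := h
    induction l with
    | nil => simp [wordF_cons_barred hb, wordE_cons_barred hb, hr]
    | cons b l ih =>
      have hc := letter_cases i b
      rw [phi_cons_barred hb] at hl
      obtain ⟨i1, i2⟩ := ih (by omega)
      have e1 := (eps_append_barred hb l (lo i :: r)).1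
      have e2 := (eps_append_barred hb l (hi i :: r)).1
      rw [eps_cons_barred hb] at e1 e2
      simp only [letterPhi_lo, letterPhi_hi, letterEps_hi, letterEps_lo] at e1 e2
      rw [List.cons_append, List.cons_append, wordF_cons_barred hb, wordE_cons_barred hb,
        if_neg (by omega), if_neg (by omega), i1, i2]
      simp
  · rw [if_neg hb] at h
    by_cases hz : IsZero i
    · rw [if_pos hz] at h
      obtain ⟨hl, hr⟩ := h
      induction l with
      | nil => simp [wordF_cons_zero hz, wordE_cons_zero hz]
      | cons b l ih =>
        have hc := letter_cases i b
        rw [phi_cons_zero hz] at hl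
        rw [eps_cons_zero hz] at hr
        split_ifs at hl hr with hs
        · obtain ⟨i1, i2⟩ := ih hl hr
          rw [List.cons_append, List.cons_append, wordF_cons_zero hz, wordE_cons_zero hz,
            if_neg (by omega), if_neg (by omega), i1, i2]
          simp
        · omega
    · rw [if_neg hz] at h
      obtain ⟨hl, hr⟩ := h
      induction l with
      | nil => simp [wordF_cons_pos hb hz, wordE_cons_pos hb hz, hr]
      | cons b l ih =>
        have hc := letter_cases i b
        rw [eps_cons_pos hb hz] at hl
        obtain ⟨i1, i2⟩ := ih (by omega)
        have e1 := (eps_append_pos hb hz l (lo i :: r)).2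
        have e2 := (eps_append_pos hb hz l (hi i :: r)).2
        rw [phi_cons_pos hb hz] at e1 e2
        simp only [letterPhi_lo, letterPhi_hi, letterEps_hi, letterEps_lo] at e1 e2
        rw [List.cons_append, List.cons_append, wordF_cons_pos hb hz, wordE_cons_pos hb hz,
          if_neg (by omega), if_neg (by omega), i1, i2]
        simp

theorem acts_of_wordF {w : List (Letter m n)} : ∀ {w' : List (Letter m n)}, wordF i w = some w' →
    ∃ l r, Acts i l r ∧ w = l ++ lo i :: r ∧ w' = l ++ hi i :: r := by
  induction w with
  | nil => intro w' h; simp [wordF] at h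
  | cons b w ih =>
    intro w' h
    have hc := letter_cases i b
    by_cases hb : IsBarred i
    · rw [wordF_cons_barred hb] at h
      split_ifs at h with hs
      · obtain ⟨rfl, h1, -⟩ | ⟨rfl, h1, -⟩ | ⟨-, -, h1, -⟩ := hc
        · simp at h
          exact ⟨[], w, by simp [Acts, hb, phi_nil]; omega, rfl, h.symm⟩
        · omega
        · omega
      · obtain ⟨w1, h1, rfl⟩ := Option.map_eq_some_iff.1 h
        obtain ⟨l, r, ha, rfl, rfl⟩ := ih h1
        refine ⟨b :: l, r, ?_, rfl, rfl⟩
        simp only [Acts, hb, if_true] at ha ⊢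
        have e1 := (eps_append_barred hb l (lo i :: r)).1
        rw [eps_cons_barred hb] at e1
        simp only [letterPhi_lo, letterEps_lo] at e1
        rw [phi_cons_barred hb]
        omega
    · by_cases hz : IsZero i
      · rw [wordF_cons_zero hz] at h
        split_ifs at h with hs
        · obtain ⟨rfl, h1, -⟩ | ⟨rfl, h1, -⟩ | ⟨-, -, h1, h2⟩ := hc
          · simp at h
            exact ⟨[], w, by simp [Acts, hb, hz, phi_nil, eps_nil], rfl, h.symm⟩
          · simp [letterF_eq] at h
          · omega
        · obtain ⟨w1, h1, rfl⟩ := Option.map_eq_some_iff.1 h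
          obtain ⟨l, r, ha, rfl, rfl⟩ := ih h1
          refine ⟨b :: l, r, ?_, rfl, rfl⟩
          simp only [Acts, hb, hz, if_true, if_false] at ha ⊢
          rw [phi_cons_zero hz, eps_cons_zero hz]
          rw [if_pos (by omega), if_pos (by omega)]
          exact ha
      · rw [wordF_cons_pos hb hz] at h
        split_ifs at h with hs
        · obtain ⟨rfl, h1, -⟩ | ⟨rfl, h1, -⟩ | ⟨-, -, h1, -⟩ := hc
          · simp at h
            refine ⟨[], w, ?_, rfl, h.symm⟩
            simp only [letterEps_lo] at hs
            simp [Acts, hb, hz, eps_nil]; omega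
          · simp [letterF_eq] at h
          · simp [letterF_eq, h1] at h
        · obtain ⟨w1, h1, rfl⟩ := Option.map_eq_some_iff.1 h
          obtain ⟨l, r, ha, rfl, rfl⟩ := ih h1
          refine ⟨b :: l, r, ?_, rfl, rfl⟩
          simp only [Acts, hb, hz, if_false] at ha ⊢
          have e1 := (eps_append_pos hb hz l (lo i :: r)).2
          rw [phi_cons_pos hb hz] at e1
          simp only [letterPhi_lo, letterEps_lo] at e1
          rw [eps_cons_pos hb hz]
          omega

theorem acts_of_wordE {w : List (Letter m n)} : ∀ {w' : List (Letter m n)}, wordE i w = some w' →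
    ∃ l r, Acts i l r ∧ w = l ++ hi i :: r ∧ w' = l ++ lo i :: r := by
  induction w with
  | nil => intro w' h; simp [wordE] at h
  | cons b w ih =>
    intro w' h
    have hc := letter_cases i b
    by_cases hb : IsBarred i
    · rw [wordE_cons_barred hb] at h
      split_ifs at h with hs
      · obtain ⟨rfl, h1, h2⟩ | ⟨rfl, h1, -⟩ | ⟨-, -, h1, h2⟩ := hc
        · simp [letterE_eq] at h
        · simp at h
          exact ⟨[], w, by simp [Acts, hb, phi_nil]; omega, rfl, h.symm⟩
        · simp [letterE_eq, h2] at h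
      · obtain ⟨w1, h1, rfl⟩ := Option.map_eq_some_iff.1 h
        obtain ⟨l, r, ha, rfl, rfl⟩ := ih h1
        refine ⟨b :: l, r, ?_, rfl, rfl⟩
        simp only [Acts, hb, if_true] at ha ⊢
        have e1 := (eps_append_barred hb l (hi i :: r)).1
        rw [eps_cons_barred hb] at e1
        simp only [letterPhi_hi, letterEps_hi] at e1
        rw [phi_cons_barred hb]
        omega
    · by_cases hz : IsZero i
      · rw [wordE_cons_zero hz] at h
        split_ifs at h with hs
        · obtain ⟨rfl, h1, -⟩ | ⟨rfl, h1, -⟩ | ⟨-, -, h1, h2⟩ := hc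
          · simp [letterE_eq] at h
          · simp at h
            exact ⟨[], w, by simp [Acts, hb, hz, phi_nil, eps_nil], rfl, h.symm⟩
          · omega
        · obtain ⟨w1, h1, rfl⟩ := Option.map_eq_some_iff.1 h
          obtain ⟨l, r, ha, rfl, rfl⟩ := ih h1
          refine ⟨b :: l, r, ?_, rfl, rfl⟩
          simp only [Acts, hb, hz, if_true, if_false] at ha ⊢
          rw [phi_cons_zero hz, eps_cons_zero hz]
          rw [if_pos (by omega), if_pos (by omega)]
          exact ha
      · rw [wordE_cons_pos hb hz] at h
        split_ifs at h with hs
        · obtain ⟨rfl, h1, h2⟩ | ⟨rfl, h1, -⟩ | ⟨-, -, h1, h2⟩ := hc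
          · omega
          · simp at h
            refine ⟨[], w, ?_, rfl, h.symm⟩
            simp only [letterEps_hi] at hs
            simp [Acts, hb, hz, eps_nil]; omega
          · omega
        · obtain ⟨w1, h1, rfl⟩ := Option.map_eq_some_iff.1 h
          obtain ⟨l, r, ha, rfl, rfl⟩ := ih h1
          refine ⟨b :: l, r, ?_, rfl, rfl⟩
          simp only [Acts, hb, hz, if_false] at ha ⊢
          have e1 := (eps_append_pos hb hz l (hi i :: r)).2
          rw [phi_cons_pos hb hz] at e1
          simp only [letterPhi_hi, letterEps_hi] at e1
          rw [eps_cons_pos hb hz]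
          omega

theorem wordF_eq_some {w w' : List (Letter m n)} :
    wordF i w = some w' ↔ ∃ l r, Acts i l r ∧ w = l ++ lo i :: r ∧ w' = l ++ hi i :: r :=
  ⟨acts_of_wordF, by rintro ⟨l, r, h, rfl, rfl⟩; exact (wordF_of_acts h).1⟩

theorem wordF_iff_wordE {w w' : List (Letter m n)} :
    wordF i w = some w' ↔ wordE i w' = some w := by
  rw [wordF_eq_some]
  constructor
  · rintro ⟨l, r, h, rfl, rfl⟩; exact (wordF_of_acts h).2
  · intro h
    obtain ⟨l, r, ha, rfl, rfl⟩ := acts_of_wordE h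
    exact ⟨l, r, ha, rfl, rfl⟩

/-- The values of `ε` and `φ` at a word where the operators act. -/
theorem acts_eps_phi {l r : List (Letter m n)} (h : Acts i l r) :
    wordEps i (l ++ hi i :: r) = wordEps i (l ++ lo i :: r) + 1 ∧
      wordPhi i (l ++ lo i :: r) = wordPhi i (l ++ hi i :: r) + 1 := by
  unfold Acts at h
  by_cases hb : IsBarred i
  · rw [if_pos hb] at h
    simp only [eps_append_barred hb, eps_cons_barred hb, phi_cons_barred hb, letterPhi_lo,
      letterPhi_hi, letterEps_hi, letterEps_lo]
    omega
  · rw [if_neg hb] at h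
    by_cases hz : IsZero i
    · rw [if_pos hz] at h
      simp [eps_append_zero hz, eps_cons_zero hz, phi_cons_zero hz, h]
    · rw [if_neg hz] at h
      simp only [eps_append_pos hb hz, eps_cons_pos hb hz, phi_cons_pos hb hz, letterPhi_lo,
        letterPhi_hi, letterEps_hi, letterEps_lo]
      omega

theorem wordF_eps_phi {w w' : List (Letter m n)} (h : wordF i w = some w') :
    wordEps i w' = wordEps i w + 1 ∧ wordPhi i w = wordPhi i w' + 1 := by
  obtain ⟨l, r, ha, rfl, rfl⟩ := acts_of_wordF h
  exact acts_eps_phi ha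

/-- The word crystal satisfies more than the axioms of a crystal graph: vanishing of the operator is
detected by `φ_i`. This is needed to identify the string lengths on matrices. -/
theorem wordF_eq_none {w : List (Letter m n)} : wordF i w = none ↔ wordPhi i w = 0 := by
  constructor
  · induction w with
    | nil => intro _; rfl
    | cons b w ih =>
      have hc := letter_cases i b
      by_cases hb : IsBarred i
      · rw [wordF_cons_barred hb, phi_cons_barred hb]
        split_ifs with hs
        · rw [letterF_eq, if_pos (by omega)]; simp
        · intro h
          have := ih (by simpa using h)
          omega
      · by_cases hz : IsZero i
        · rw [wordF_cons_zero hz, phi_cons_zero hz]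
          split_ifs with hs
          · rw [letterF_eq]
            split_ifs with h1
            · simp
            · intro _; omega
          · intro h
            exact ih (by simpa using h)
          · omega
        · rw [wordF_cons_pos hb hz, phi_cons_pos hb hz]
          split_ifs with hs
          · rw [letterF_eq]
            split_ifs with h1
            · simp
            · intro _; omega
          · intro h
            have := ih (by simpa using h)
            omega
  · intro h
    cases hw : wordF i w with
    | none => rfl
    | some w' => have := (wordF_eps_phi hw).2; omega

theorem wordE_eq_none {w : List (Letter m n)} : wordE i w = none ↔ wordEps i w = 0 := by
  constructor
  · induction w with
    | nil => intro _; rfl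
    | cons b w ih =>
      have hc := letter_cases i b
      by_cases hb : IsBarred i
      · rw [wordE_cons_barred hb, eps_cons_barred hb]
        split_ifs with hs
        · rw [letterE_eq]
          split_ifs with h1
          · simp
          · intro _; omega
        · intro h
          have := ih (by simpa using h)
          omega
      · by_cases hz : IsZero i
        · rw [wordE_cons_zero hz, eps_cons_zero hz]
          split_ifs with hs
          · rw [letterE_eq]
            split_ifs with h1
            · simp
            · intro _; omega
          · intro h
            exact ih (by simpa using h)
          · omega
        · rw [wordE_cons_pos hb hz, eps_cons_pos hb hz]
          split_ifs with hs
          · rw [letterE_eq, if_pos (by omega)]; simp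
          · intro h
            have := ih (by simpa using h)
            omega
  · intro h
    cases hw : wordE i w with
    | none => rfl
    | some w' => have := (wordF_eps_phi (wordF_iff_wordE.2 hw)).1; omega

theorem wordWt_append (u v : List (Letter m n)) : wordWt (u ++ v) = wordWt u + wordWt v := by
  induction u with
  | nil => simp [wordWt]
  | cons b u ih => rw [List.cons_append, wordWt, ih, wordWt, add_assoc]

theorem wordWt_perm {u v : List (Letter m n)} (h : u.Perm v) : wordWt u = wordWt v := by
  induction h with
  | nil => rfl
  | cons b _ ih => rw [wordWt, wordWt, ih]
  | swap b c w => simp only [wordWt]; abel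
  | trans _ _ h1 h2 => exact h1.trans h2

theorem wordF_wt {w w' : List (Letter m n)} (h : wordF i w = some w') :
    wordWt w' = wordWt w - root i := by
  obtain ⟨l, r, -, rfl, rfl⟩ := acts_of_wordF h
  simp only [wordWt_append, wordWt, root]
  abel

theorem wordPhi_add_wordEps (hz : IsZero i) (w : List (Letter m n)) :
    0 ≤ coroot i (wordWt w) ∧ (coroot i (wordWt w) = 0 → wordPhi i w + wordEps i w = 0) ∧
      (0 < coroot i (wordWt w) → wordPhi i w + wordEps i w = 1) := by
  induction w with
  | nil => simp [wordPhi, wordEps, wordWt, coroot_zero]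
  | cons b w ih =>
    rw [wordWt, coroot_add, phi_cons_zero hz, eps_cons_zero hz, coroot_basis_zero hz]
    have := letter_cases i b
    split_ifs <;> omega

theorem isCrystal_wordCrystal (m n : ℕ) : IsCrystal (wordCrystal m n) where
  phi_sub_eps _ w hz := wordPhi_sub_wordEps hz w
  coroot_nonneg _ w hz := (wordPhi_add_wordEps hz w).1
  phi_add_eps _ w hz := (wordPhi_add_wordEps hz w).2
  of_e i w w' h := by
    have h := wordF_iff_wordE.2 h
    have h1 := wordF_eps_phi h
    have h2 := wordF_wt h
    simp only [wordCrystal]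
    refine ⟨by omega, by omega, ?_⟩
    rw [h2]; abel
  of_f i w w' h := by
    have h1 := wordF_eps_phi h
    have h2 := wordF_wt h
    simp only [wordCrystal]
    exact ⟨by omega, by omega, h2⟩
  f_iff_e _ _ _ := wordF_iff_wordE

end Words

/-! ## The operators and concatenation -/

section Tensor
variable {m n : ℕ} {i : Index m n}

/-- The extra condition for acting inside the left factor involves `ε_i` and `φ_i` of the two
factors only, as the tensor product rule requires. The companion statement `acts_append_left` does
the same for the right factor. -/
theorem acts_append_right {l s v : List (Letter m n)} :
    Acts i l (s ++ v) ↔ Acts i l s ∧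
      if IsBarred i then wordEps i v < wordPhi i (l ++ lo i :: s)
      else if IsZero i then True else wordPhi i v ≤ wordEps i (l ++ lo i :: s) := by
  unfold Acts
  by_cases hb : IsBarred i
  · simp only [hb, if_true, eps_append_barred hb, phi_cons_barred hb, eps_cons_barred hb,
      letterPhi_lo, letterEps_lo]
    omega
  · by_cases hz : IsZero i
    · simp [hb, hz]
    · simp only [hb, hz, if_false, eps_append_pos hb hz, phi_cons_pos hb hz, eps_cons_pos hb hz,
        letterPhi_lo, letterEps_lo]
      omega

theorem acts_append_left {u s r : List (Letter m n)} :
    Acts i (u ++ s) r ↔ Acts i s r ∧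
      if IsBarred i then wordPhi i u ≤ wordEps i (s ++ lo i :: r)
      else if IsZero i then wordPhi i u = 0 ∧ wordEps i u = 0
      else wordEps i u < wordPhi i (s ++ lo i :: r) := by
  unfold Acts
  by_cases hb : IsBarred i
  · simp only [hb, if_true, eps_append_barred hb, phi_cons_barred hb, eps_cons_barred hb,
      letterPhi_lo, letterEps_lo]
    omega
  · by_cases hz : IsZero i
    · simp only [hb, hz, if_true, if_false, eps_append_zero hz]
      split_ifs <;> omega
    · simp only [hb, hz, if_false, eps_append_pos hb hz, phi_cons_pos hb hz, eps_cons_pos hb hz,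
        letterPhi_lo, letterEps_lo]
      omega

/-- `f_i` acts on one of the two factors of a concatenation; which one depends only on `ε_i` and
`φ_i` of the factors. -/
theorem wordF_append {u v w' : List (Letter m n)} (h : wordF i (u ++ v) = some w') :
    (∃ u', wordF i u = some u' ∧ w' = u' ++ v ∧ ∀ u₂ v₂ u₂', wordPhi i u₂ = wordPhi i u →
      wordEps i u₂ = wordEps i u → wordPhi i v₂ = wordPhi i v → wordEps i v₂ = wordEps i v →
      wordF i u₂ = some u₂' → wordF i (u₂ ++ v₂) = some (u₂' ++ v₂)) ∨
    (∃ v', wordF i v = some v' ∧ w' = u ++ v' ∧ ∀ u₂ v₂ v₂', wordPhi i u₂ = wordPhi i u →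
      wordEps i u₂ = wordEps i u → wordPhi i v₂ = wordPhi i v → wordEps i v₂ = wordEps i v →
      wordF i v₂ = some v₂' → wordF i (u₂ ++ v₂) = some (u₂ ++ v₂')) := by
  obtain ⟨l, r, ha, heq, rfl⟩ := acts_of_wordF h
  have right : ∀ s, l = u ++ s → v = s ++ lo i :: r → (∃ v', wordF i v = some v' ∧
      l ++ hi i :: r = u ++ v' ∧ ∀ u₂ v₂ v₂', wordPhi i u₂ = wordPhi i u →
      wordEps i u₂ = wordEps i u → wordPhi i v₂ = wordPhi i v → wordEps i v₂ = wordEps i v →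
      wordF i v₂ = some v₂' → wordF i (u₂ ++ v₂) = some (u₂ ++ v₂')) := by
    rintro s rfl rfl
    rw [acts_append_left] at ha
    refine ⟨s ++ hi i :: r, (wordF_of_acts ha.1).1, by simp, ?_⟩
    intro u₂ v₂ v₂' h1 h2 h3 h4 h5
    obtain ⟨s₂, r₂, ha₂, rfl, rfl⟩ := acts_of_wordF h5
    rw [← List.append_assoc, ← List.append_assoc]
    refine (wordF_of_acts (acts_append_left.2 ⟨ha₂, ?_⟩)).1
    rw [h1, h2, h3, h4]
    exact ha.2
  rcases List.append_eq_append_iff.1 heq with ⟨s, hs, hs'⟩ | ⟨s, hs, hs'⟩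
  · exact Or.inr (right s hs hs')
  · cases s with
    | nil => exact Or.inr (right [] (by simpa using hs.symm) (by simpa using hs'.symm))
    | cons z s =>
      left
      simp only [List.cons_append, List.cons.injEq] at hs'
      obtain ⟨rfl, rfl⟩ := hs'
      subst hs
      rw [acts_append_right] at ha
      refine ⟨l ++ hi i :: s, (wordF_of_acts ha.1).1, by simp, ?_⟩
      intro u₂ v₂ v₂' h1 h2 h3 h4 h5
      obtain ⟨s₂, r₂, ha₂, rfl, rfl⟩ := acts_of_wordF h5
      rw [List.append_assoc, List.cons_append, List.append_assoc, List.cons_append]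
      refine (wordF_of_acts (acts_append_right.2 ⟨ha₂, ?_⟩)).1
      rw [h1, h2, h3, h4]
      exact ha.2

/-- `ε_i` and `φ_i` of a concatenation depend only on those of the factors. -/
theorem phi_eps_append_congr {u v u₂ v₂ : List (Letter m n)} (h1 : wordPhi i u₂ = wordPhi i u)
    (h2 : wordEps i u₂ = wordEps i u) (h3 : wordPhi i v₂ = wordPhi i v)
    (h4 : wordEps i v₂ = wordEps i v) :
    wordPhi i (u₂ ++ v₂) = wordPhi i (u ++ v) ∧ wordEps i (u₂ ++ v₂) = wordEps i (u ++ v) := by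
  by_cases hb : IsBarred i
  · simp only [eps_append_barred hb, h1, h2, h3, h4, and_self]
  · by_cases hz : IsZero i
    · simp only [eps_append_zero hz, h1, h2, h3, h4, and_self]
    · simp only [eps_append_pos hb hz, h1, h2, h3, h4, and_self]

/-- The weight determines `φ_i - ε_i` for `i ≠ 0`, and `φ_0 + ε_0` for `i = 0`, so `φ_i` determines
`ε_i` among rearrangements. -/
theorem eps_eq_of_perm {u v : List (Letter m n)} (h : u.Perm v) (h1 : wordPhi i u = wordPhi i v) :
    wordEps i u = wordEps i v := by
  have hw := wordWt_perm h
  by_cases hz : IsZero i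
  · have e1 := wordPhi_add_wordEps hz u
    have e2 := wordPhi_add_wordEps hz v
    rw [hw] at e1
    rcases e1.1.eq_or_lt with h0 | h0
    · have := e1.2.1 h0.symm; have := e2.2.1 h0.symm; omega
    · have := e1.2.2 h0; have := e2.2.2 h0; omega
  · have e1 := wordPhi_sub_wordEps hz u
    have e2 := wordPhi_sub_wordEps hz v
    rw [hw] at e1
    omega

theorem wordF_length {w w' : List (Letter m n)} (h : wordF i w = some w') :
    w'.length = w.length := by
  obtain ⟨l, r, -, rfl, rfl⟩ := acts_of_wordF h
  simp

/-! ## The operators and columns -/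

theorem eq_zero_of_neutral {u : List (Letter m n)} (h : ∀ b ∈ u, b ≠ lo i ∧ b ≠ hi i) :
    wordPhi i u = 0 ∧ wordEps i u = 0 := by
  induction u with
  | nil => exact ⟨rfl, rfl⟩
  | cons b u ih =>
    have h1 := ih fun c hc => h c (by simp [hc])
    have h2 := h b (by simp)
    have h3 := letter_cases i b
    have h4 : letterPhi i b = 0 ∧ letterEps i b = 0 := by tauto
    by_cases hb : IsBarred i
    · rw [phi_cons_barred hb, eps_cons_barred hb]; omega
    · by_cases hz : IsZero i
      · rw [phi_cons_zero hz, eps_cons_zero hz, if_pos (by omega), if_pos (by omega)]; exact h1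
      · rw [phi_cons_pos hb hz, eps_cons_pos hb hz]; omega

theorem eq_zero_of_lt {u : List (Letter m n)} (h : ∀ b ∈ u, b < lo i) :
    wordPhi i u = 0 ∧ wordEps i u = 0 :=
  eq_zero_of_neutral fun b hb => ⟨(h b hb).ne, ((h b hb).trans (lo_lt_hi i)).ne⟩

theorem eq_zero_of_gt {u : List (Letter m n)} (h : ∀ b ∈ u, hi i < b) :
    wordPhi i u = 0 ∧ wordEps i u = 0 :=
  eq_zero_of_neutral fun b hb => ⟨((lo_lt_hi i).trans (h b hb)).ne', (h b hb).ne'⟩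

theorem odd_lo_iff : IsOdd (lo i) ↔ ¬ IsBarred i ∧ ¬ IsZero i := by
  rw [isOdd_lo]; unfold IsBarred IsZero; omega

theorem odd_hi_iff : IsOdd (hi i) ↔ ¬ IsBarred i := by
  rw [isOdd_hi]; unfold IsBarred; omega

theorem lo_below_iff (hb : IsBarred i ∨ IsZero i) {b : Letter m n} : Below (lo i) b ↔ lo i < b := by
  unfold Below
  constructor
  · rintro (h | ⟨rfl, h⟩)
    · exact h
    · have := odd_lo_iff.1 h; tauto
  · exact Or.inl

theorem below_hi_iff (hb : IsBarred i) {b : Letter m n} : Below b (hi i) ↔ b < hi i := by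
  unfold Below
  constructor
  · rintro (h | ⟨rfl, h⟩)
    · exact h
    · have := odd_hi_iff.1 h; tauto
  · exact Or.inl

theorem hi_below_iff (hb : IsBarred i) {b : Letter m n} : Below (hi i) b ↔ hi i < b := by
  unfold Below
  constructor
  · rintro (h | ⟨rfl, h⟩)
    · exact h
    · have := odd_hi_iff.1 h; tauto
  · exact Or.inl

/-- `φ_i` and `ε_i` of a column for a positive index. -/
theorem phi_eps_column_pos (hb : ¬ IsBarred i) (hz : ¬ IsZero i) {c : List (Letter m n)}
    (hc : IsColumn c) : wordPhi i c = c.count (lo i) ∧ wordEps i c = c.count (hi i) := by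
  induction c with
  | nil => exact ⟨rfl, rfl⟩
  | cons b c ih =>
    obtain ⟨h1, h2⟩ := List.pairwise_cons.1 hc
    obtain ⟨i1, i2⟩ := ih h2
    rw [phi_cons_pos hb hz, eps_cons_pos hb hz, List.count_cons, List.count_cons]
    have hne := lo_ne_hi i
    rcases letter_cases i b with ⟨rfl, e1, e2⟩ | ⟨rfl, e1, e2⟩ | ⟨hl, hh, e1, e2⟩
    · simp [hne]; omega
    · have : c.count (lo i) = 0 := List.count_eq_zero.2 fun h =>
        absurd (h1 _ h).le (not_le.2 (lo_lt_hi i))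
      simp [hne.symm]; omega
    · simp [hl, hh]; omega

/-- `φ_i` and `ε_i` of a column for a barred index. -/
theorem phi_eps_column_barred (hb : IsBarred i) {c : List (Letter m n)} (hc : IsColumn c) :
    c.count (lo i) ≤ 1 ∧ c.count (hi i) ≤ 1 ∧ wordPhi i c = c.count (lo i) - c.count (hi i) ∧
      wordEps i c = c.count (hi i) - c.count (lo i) := by
  induction c with
  | nil => simp [eps_nil, phi_nil]
  | cons b c ih =>
    obtain ⟨h1, h2⟩ := List.pairwise_cons.1 hc
    have := ih h2
    rw [phi_cons_barred hb, eps_cons_barred hb, List.count_cons, List.count_cons]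
    have hne := lo_ne_hi i
    rcases letter_cases i b with ⟨rfl, e1, e2⟩ | ⟨rfl, e1, e2⟩ | ⟨hl, hh, e1, e2⟩
    · have : c.count (lo i) = 0 := List.count_eq_zero.2 fun h =>
        absurd ((lo_below_iff (Or.inl hb)).1 (h1 _ h)) (lt_irrefl _)
      simp [hne]; omega
    · have : c.count (lo i) = 0 := List.count_eq_zero.2 fun h =>
        absurd (h1 _ h).le (not_le.2 (lo_lt_hi i))
      have : c.count (hi i) = 0 := List.count_eq_zero.2 fun h =>
        absurd ((hi_below_iff hb).1 (h1 _ h)) (lt_irrefl _)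
      simp [hne.symm]; omega
    · simp [hl, hh]; omega

/-- `f_i` preserves columns. -/
theorem isColumn_of_acts {l r : List (Letter m n)} (hc : IsColumn (l ++ lo i :: r))
    (ha : Acts i l r) : IsColumn (l ++ hi i :: r) := by
  simp only [IsColumn, List.pairwise_append, List.pairwise_cons, List.mem_cons] at hc ⊢
  obtain ⟨h1, ⟨h2, h3⟩, h4⟩ := hc
  refine ⟨h1, ⟨fun b hb' => ?_, h3⟩, ?_⟩
  · have hlob := h2 b hb'
    rcases hlob with h | ⟨rfl, ho⟩
    · rcases (hi_le_of_lo_lt h).lt_or_eq with h' | rfl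
      · exact Or.inl h'
      · rw [below_self, odd_hi_iff]
        -- The next entry is already `hi i`, which is forbidden for an even `hi i` only. In that
        -- case `r` has an uncancelled `hi i`, so `ε_i r` is not zero and `f_i` does not act here.
        intro hb
        have e := phi_eps_column_barred hb h3
        have h0 : r.count (lo i) = 0 := List.count_eq_zero.2 fun hm =>
          absurd ((lo_below_iff (Or.inl hb)).1 (h2 _ hm)) (lt_irrefl _)
        have h5 : 0 < r.count (hi i) := List.count_pos_iff.2 hb'
        simp only [Acts, hb, if_true] at ha
        omega
    · obtain ⟨hb, hz⟩ := odd_lo_iff.1 ho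
      have e := phi_eps_column_pos hb hz h3
      have h5 : 0 < r.count (lo i) := List.count_pos_iff.2 hb'
      simp only [Acts, hb, hz, if_false] at ha
      omega
  · rintro a ha' b (rfl | hb)
    · exact Or.inl ((h4 a ha' (lo i) (Or.inl rfl)).le.trans_lt (lo_lt_hi i))
    · exact h4 a ha' b (Or.inr hb)

theorem isColumn_wordF {c c' : List (Letter m n)} (hc : IsColumn c) (h : wordF i c = some c') :
    IsColumn c' := by
  obtain ⟨l, r, ha, rfl, rfl⟩ := acts_of_wordF h
  exact isColumn_of_acts hc ha

end Tensor

/-! ### Bumping in one column and the operators -/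

section Bump
variable {m n : ℕ} {i : Index m n}

theorem eq_lo_or (i : Index m n) (b : Letter m n) : b < lo i ∨ b = lo i ∨ b = hi i ∨ hi i < b := by
  rcases lt_trichotomy b (lo i) with h | h | h
  · exact Or.inl h
  · exact Or.inr (Or.inl h)
  · rcases (hi_le_of_lo_lt h).lt_or_eq with h | h
    · exact Or.inr (Or.inr (Or.inr h))
    · exact Or.inr (Or.inr (Or.inl h.symm))

theorem letter_eq_zero_of_lt {b : Letter m n} (h : b < lo i) :
    letterPhi i b = 0 ∧ letterEps i b = 0 := by
  simp [letterPhi, letterEps, h.ne, (h.trans (lo_lt_hi i)).ne]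

theorem letter_eq_zero_of_gt {b : Letter m n} (h : hi i < b) :
    letterPhi i b = 0 ∧ letterEps i b = 0 := by
  simp [letterPhi, letterEps, h.ne', ((lo_lt_hi i).trans h).ne']

theorem perm_bump (l r : List (Letter m n)) (x y : Letter m n) :
    (l ++ y :: r ++ [x]).Perm (y :: (l ++ x :: r)) := by
  rw [List.perm_iff_count]
  intro a
  simp only [List.count_append, List.count_cons, List.count_nil]
  omega

theorem eq_zero_of_below {l : List (Letter m n)} {x : Letter m n} (hl : ∀ a ∈ l, Below a x)
    (hx : x ≤ lo i) (ho : ¬ IsOdd (lo i) ∨ x < lo i) : wordPhi i l = 0 ∧ wordEps i l = 0 := by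
  apply eq_zero_of_lt
  intro b hb
  rcases hl b hb with h | ⟨rfl, h⟩
  · exact h.trans_le hx
  · rcases ho with ho | ho
    · exact lt_of_le_of_ne hx fun e => ho (e ▸ h)
    · exact ho

theorem eq_zero_of_above {r : List (Letter m n)} {y : Letter m n} (hr : ∀ b ∈ r, Below y b)
    (hy : hi i ≤ y) (ho : ¬ IsOdd (hi i) ∨ hi i < y) : wordPhi i r = 0 ∧ wordEps i r = 0 := by
  apply eq_zero_of_gt
  intro b hb
  rcases hr b hb with h | ⟨rfl, h⟩
  · exact hy.trans_lt h
  · rcases ho with ho | ho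
    · exact lt_of_le_of_ne hy fun e => ho (e ▸ h)
    · exact ho

/-- Bumping a letter does not change `φ_i`. -/
theorem phi_bump {l r : List (Letter m n)} {x y : Letter m n} (hc : IsColumn (l ++ y :: r))
    (hl : ∀ a ∈ l, Below a x) (hy : ¬ Below y x) :
    wordPhi i (y :: (l ++ x :: r)) = wordPhi i (l ++ y :: r ++ [x]) := by
  have hc2 := isColumn_bump hc hl hy
  have hxy := le_of_not_below hy
  have hne := lo_ne_hi i
  have hlt := lo_lt_hi i
  have hcc := hc
  simp only [IsColumn, List.pairwise_append, List.pairwise_cons, List.mem_cons] at hcc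
  obtain ⟨c1, ⟨c2, c3⟩, c4⟩ := hcc
  -- Letters of `l` do not exceed `x`, letters of `r` are at least `y`, and `x ≤ y`. Hence `l` is
  -- neutral for `i` if `x` is at most `lo i`, and `r` if `y` is at least `hi i`, up to repeated odd
  -- letters. The case analysis on the positions of `x` and `y` uses this throughout.
  have l_lt := eq_zero_of_below (i := i) hl
  have r_gt := eq_zero_of_above (i := i) c2
  by_cases hb : IsBarred i
  · have olo : ¬ IsOdd (lo i) := fun h => (odd_lo_iff.1 h).1 hb
    have ohi : ¬ IsOdd (hi i) := fun h => odd_hi_iff.1 h hb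
    have e1 := phi_eps_column_barred hb hc
    have e2 := phi_eps_column_barred hb hc2
    have e3 := phi_eps_column_barred hb c1
    have e4 := phi_eps_column_barred hb c3
    simp only [List.count_append, List.count_cons, beq_iff_eq] at e1 e2
    simp only [eps_append_barred hb, eps_cons_barred hb, phi_cons_barred hb, eps_nil, phi_nil]
    rcases eq_lo_or i x with hx | rfl | rfl | hx
    · have ll := l_lt hx.le (Or.inr hx)
      have lx := letter_eq_zero_of_lt hx
      omega
    · have ll := l_lt le_rfl (Or.inl olo)
      rcases eq_lo_or i y with hy' | rfl | rfl | hy'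
      · exact absurd hxy (not_le.2 hy')
      · simp at e1 e2 ⊢; omega
      · have rr := r_gt le_rfl (Or.inl ohi)
        simp at e1 e2 ⊢; omega
      · have rr := r_gt hy'.le (Or.inr hy')
        have ly := letter_eq_zero_of_gt hy'
        simp at e1 e2 ⊢; omega
    · have rr := r_gt hxy (Or.inl ohi)
      rcases hxy.lt_or_eq with hy' | rfl
      · have ly := letter_eq_zero_of_gt hy'
        simp at e1 e2 ⊢; omega
      · simp at e1 e2 ⊢; omega
    · have hy' := hx.trans_le hxy
      have lx := letter_eq_zero_of_gt hx
      have ly := letter_eq_zero_of_gt hy'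
      omega
  · by_cases hz : IsZero i
    · have olo : ¬ IsOdd (lo i) := fun h => (odd_lo_iff.1 h).2 hz
      have ohi : IsOdd (hi i) := odd_hi_iff.2 hb
      simp only [eps_append_zero hz, eps_cons_zero hz, phi_cons_zero hz, phi_nil]
      rcases eq_lo_or i x with hx | rfl | rfl | hx
      · have ll := l_lt hx.le (Or.inr hx)
        have lx := letter_eq_zero_of_lt hx
        simp [ll, lx]
        split_ifs <;> omega
      · have ll := l_lt le_rfl (Or.inl olo)
        rcases eq_lo_or i y with hy' | rfl | rfl | hy'
        · exact absurd hxy (not_le.2 hy')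
        · simp [ll]
        · simp [ll]
        · have rr := r_gt hy'.le (Or.inr hy')
          have ly := letter_eq_zero_of_gt hy'
          simp [ll, rr, ly]
      · rcases hxy.lt_or_eq with hy' | rfl
        · have rr := r_gt hy'.le (Or.inr hy')
          have ly := letter_eq_zero_of_gt hy'
          simp [rr, ly]
          tauto
        · exact absurd (below_self.2 ohi) hy
      · have hy' := hx.trans_le hxy
        have lx := letter_eq_zero_of_gt hx
        have ly := letter_eq_zero_of_gt hy'
        simp [lx, ly]
        split_ifs <;> omega
    · have e3 := phi_eps_column_pos hb hz c1
      have e4 := phi_eps_column_pos hb hz c3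
      simp only [eps_append_pos hb hz, eps_cons_pos hb hz, phi_cons_pos hb hz, phi_nil]
      have olo : IsOdd (lo i) := odd_lo_iff.2 ⟨hb, hz⟩
      have ohi : IsOdd (hi i) := odd_hi_iff.2 hb
      have l_hi : x ≤ lo i → wordEps i l = 0 := by
        intro hx
        rw [e3.2, List.count_eq_zero]
        intro h
        exact absurd ((hl _ h).le.trans hx) (not_le.2 hlt)
      have r_lo : hi i ≤ y → wordPhi i r = 0 := by
        intro hx
        rw [e4.1, List.count_eq_zero]
        intro h
        exact absurd (hx.trans (c2 _ h).le) (not_le.2 hlt)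
      rcases eq_lo_or i x with hx | rfl | rfl | hx
      · have ll := l_lt hx.le (Or.inr hx)
        have lx := letter_eq_zero_of_lt hx
        simp only [ll, lx, Nat.zero_sub, Nat.sub_zero, zero_add, add_zero]
      · have ll := l_hi le_rfl
        rcases eq_lo_or i y with hy' | rfl | rfl | hy'
        · exact absurd hxy (not_le.2 hy')
        · exact absurd (below_self.2 olo) hy
        · have rr := r_lo le_rfl
          simp only [ll, rr, letterPhi_lo, letterPhi_hi, letterEps_lo, letterEps_hi,
            Nat.zero_sub, Nat.sub_zero, zero_add, add_zero, Nat.sub_self]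
          omega
        · have rr := r_gt hy'.le (Or.inr hy')
          have ly := letter_eq_zero_of_gt hy'
          simp only [rr, ly, letterPhi_lo, letterPhi_hi, letterEps_lo, letterEps_hi,
            Nat.zero_sub, Nat.sub_zero, zero_add, add_zero, Nat.sub_self]
      · rcases hxy.lt_or_eq with hy' | rfl
        · have rr := r_gt hy'.le (Or.inr hy')
          have ly := letter_eq_zero_of_gt hy'
          simp only [rr, ly, letterPhi_lo, letterPhi_hi, letterEps_lo, letterEps_hi,
            Nat.zero_sub, Nat.sub_zero, zero_add, add_zero, Nat.sub_self]
        · exact absurd (below_self.2 ohi) hy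
      · have hy' := hx.trans_le hxy
        have lx := letter_eq_zero_of_gt hx
        have ly := letter_eq_zero_of_gt hy'
        simp only [lx, ly, Nat.zero_sub, Nat.sub_zero, zero_add, add_zero]

theorem eps_bump {l r : List (Letter m n)} {x y : Letter m n} (hc : IsColumn (l ++ y :: r))
    (hl : ∀ a ∈ l, Below a x) (hy : ¬ Below y x) :
    wordEps i (y :: (l ++ x :: r)) = wordEps i (l ++ y :: r ++ [x]) :=
  eps_eq_of_perm (perm_bump l r x y).symm (phi_bump hc hl hy)

/-- The letter changed by `f_i` stands above the bumped cell. The bump stays at its place unless `i`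
is positive, `x = lo i` and `y = hi i`: then the new `hi i` is itself the first entry that `x`
bumps, and the bump moves up by one cell. -/
theorem wordF_bump_left {l r L R : List (Letter m n)} {x y : Letter m n}
    (hc : IsColumn (l ++ y :: r)) (hl : ∀ a ∈ l, Below a x) (hy : ¬ Below y x) (ha : Acts i L R) :
    ∀ s, l = L ++ lo i :: s → R = s ++ y :: r ++ [x] → ∃ l' r' x' y',
      L ++ hi i :: R = l' ++ y' :: r' ++ [x'] ∧ IsColumn (l' ++ y' :: r') ∧
      (∀ a ∈ l', Below a x') ∧ ¬ Below y' x' ∧ (l' ++ y' :: r').length = (l ++ y :: r).length ∧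
      wordF i (y :: (l ++ x :: r)) = some (y' :: (l' ++ x' :: r')) := by
  have hxy := le_of_not_below hy
  have hne := lo_ne_hi i
  have hlt := lo_lt_hi i
  have hcc := hc
  simp only [IsColumn, List.pairwise_append, List.pairwise_cons, List.mem_cons] at hcc
  obtain ⟨c1, ⟨c2, c3⟩, c4⟩ := hcc
  have l_lt := eq_zero_of_below (i := i) hl
  have r_gt := eq_zero_of_above (i := i) c2
  have hcol : ∀ u v, l ++ y :: r = u ++ lo i :: v → R = v ++ [x] → L = u →
      IsColumn (u ++ hi i :: v) := by
    rintro u v e rfl rfl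
    exact isColumn_of_acts (e ▸ hc) (acts_append_right.1 ha).1
  rintro s rfl rfl
  have hcol' := hcol L (s ++ y :: r) (by simp) (by simp) rfl
  have hlx := hl (lo i) (by simp)
  have hss : IsColumn s := (List.pairwise_cons.1 (List.pairwise_append.1 c1).2.1).2
  have hLs : IsColumn (lo i :: s) := (List.pairwise_append.1 c1).2.1
  have standard : (hi i < x ∨ (x = hi i ∧ IsOdd (hi i))) →
      Acts i (y :: L) (s ++ x :: r) → ∃ l' r' x' y',
      L ++ hi i :: (s ++ y :: r ++ [x]) = l' ++ y' :: r' ++ [x'] ∧ IsColumn (l' ++ y' :: r') ∧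
      (∀ a ∈ l', Below a x') ∧ ¬ Below y' x' ∧
      (l' ++ y' :: r').length = (L ++ lo i :: s ++ y :: r).length ∧
      wordF i (y :: (L ++ lo i :: s ++ x :: r)) = some (y' :: (l' ++ x' :: r')) := by
    intro hx hact
    refine ⟨L ++ hi i :: s, r, x, y, by simp, by simpa using hcol', ?_, hy, by simp, ?_⟩
    · intro a ha'
      simp only [List.mem_append, List.mem_cons] at ha'
      rcases ha' with ha' | rfl | ha'
      · exact hl a (by simp [ha'])
      · rcases hx with hx | ⟨rfl, ho⟩
        · exact Or.inl hx
        · exact below_self.2 ho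
      · exact hl a (by simp [ha'])
    · have := (wordF_of_acts hact).1
      simpa using this
  rcases eq_lo_or i x with hx | rfl | rfl | hx
  · exact absurd hlx.le (not_le.2 hx)
  · -- here `x = lo i`, so the index is positive
    obtain ⟨hb, hz⟩ := odd_lo_iff.1 (below_self.1 hlx)
    simp only [Acts, true_and, and_true, hb, hz, if_false, eps_append_pos hb hz, phi_cons_pos hb hz,
      eps_cons_pos hb hz, phi_nil, eps_nil, letterPhi_lo, letterEps_lo] at ha
    have ohi : IsOdd (hi i) := odd_hi_iff.2 hb
    rcases eq_lo_or i y with hy' | rfl | rfl | hy'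
    · exact absurd hxy (not_le.2 hy')
    · exact absurd hlx hy
    · have e4 := phi_eps_column_pos hb hz c3
      have r_lo : wordPhi i r = 0 := by
        rw [e4.1, List.count_eq_zero]
        intro h
        exact absurd (c2 _ h).le (not_le.2 hlt)
      -- A further `lo i` in `s` would give `φ_i R` a positive value, so `f_i` changes the last `lo
      -- i` above the bumped cell.
      have hs : s = [] := by
        rcases s with _ | ⟨a, s⟩
        · rfl
        · exfalso
          have h1 : a = lo i := le_antisymm (hl a (by simp)).le
            ((List.pairwise_cons.1 hLs).1 a (by simp)).le
          have e5 := phi_eps_column_pos hb hz hss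
          subst h1
          simp [hne] at e5
          simp at ha
          omega
      subst hs
      refine ⟨L, hi i :: r, lo i, hi i, by simp, by simpa using hcol', fun a ha' =>
        hl a (by simp [ha']), fun h => absurd h.le (not_le.2 hlt), by simp, ?_⟩
      have hact : Acts i (hi i :: (L ++ [lo i])) r := by
        simp only [Acts, true_and, and_true, hb, hz, if_false, eps_append_pos hb hz, phi_cons_pos hb hz,
          eps_cons_pos hb hz, phi_nil, eps_nil, letterPhi_lo, letterEps_lo, r_lo,
          letterPhi_hi, letterEps_hi]
        omega
      have := (wordF_of_acts hact).1
      simpa using this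
    · have rr := r_gt hy'.le (Or.inr hy')
      have ly := letter_eq_zero_of_gt hy'
      have ss : wordEps i s = 0 := by
        rw [(phi_eps_column_pos hb hz hss).2, List.count_eq_zero]
        intro h'
        exact absurd (hl (hi i) (by simp [h'])).le (not_le.2 hlt)
      omega
  · by_cases hb : IsBarred i
    · -- impossible: `hi i` stands behind
      exfalso
      have ohi : ¬ IsOdd (hi i) := fun h => odd_hi_iff.1 h hb
      have rr := r_gt hxy (Or.inl ohi)
      have ss : wordPhi i s = 0 ∧ wordEps i s = 0 := by
        apply eq_zero_of_neutral
        intro b hbs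
        exact ⟨((lo_below_iff (Or.inl hb)).1 ((List.pairwise_cons.1 hLs).1 b hbs)).ne',
          ((below_hi_iff hb).1 (hl b (by simp [hbs]))).ne⟩
      have hyl : letterPhi i y = 0 := by simp [letterPhi, (hlt.trans_le hxy).ne']
      simp only [Acts, true_and, and_true, hb, if_true, eps_append_barred hb, eps_cons_barred hb, eps_nil,
        phi_cons_barred hb, phi_nil, letterEps_hi, letterPhi_hi] at ha
      omega
    · have ohi : IsOdd (hi i) := odd_hi_iff.2 hb
      refine standard (Or.inr ⟨rfl, ohi⟩) ?_
      rcases hxy.lt_or_eq with hy' | rfl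
      · have rr := r_gt hy'.le (Or.inr hy')
        have ly := letter_eq_zero_of_gt hy'
        by_cases hz : IsZero i
        · simp only [Acts, true_and, and_true, hb, hz, if_false, if_true, phi_cons_zero hz, eps_cons_zero hz, ly]
            at ha ⊢
          simpa using ha
        · simp only [Acts, true_and, and_true, hb, hz, if_false, eps_append_pos hb hz, phi_cons_pos hb hz,
            eps_cons_pos hb hz, phi_nil, eps_nil, letterPhi_hi, letterEps_hi] at ha ⊢
          omega
      · exact absurd (below_self.2 ohi) hy
  · have hy' := hx.trans_le hxy
    have lx := letter_eq_zero_of_gt hx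
    have ly := letter_eq_zero_of_gt hy'
    have rr := r_gt hy'.le (Or.inr hy')
    refine standard (Or.inl hx) ?_
    by_cases hb : IsBarred i
    · simp only [Acts, true_and, and_true, hb, if_true, eps_append_barred hb, eps_cons_barred hb, eps_nil,
        phi_cons_barred hb, phi_nil] at ha ⊢
      omega
    · by_cases hz : IsZero i
      · simp only [Acts, true_and, and_true, hb, hz, if_false, if_true, phi_cons_zero hz, eps_cons_zero hz, ly]
          at ha ⊢
        simpa using ha
      · simp only [Acts, true_and, and_true, hb, hz, if_false, eps_append_pos hb hz, phi_cons_pos hb hz,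
          eps_cons_pos hb hz, phi_nil, eps_nil] at ha ⊢
        omega

/-- The bumped letter itself is changed: the bump keeps its cell and only the bumped letter grows.
-/
theorem wordF_bump_bumped {l r L R : List (Letter m n)} {x y : Letter m n}
    (hc : IsColumn (l ++ y :: r)) (hl : ∀ a ∈ l, Below a x) (hy : ¬ Below y x) (ha : Acts i L R) :
    y = lo i → L = l → R = r ++ [x] → ∃ l' r' x' y',
      L ++ hi i :: R = l' ++ y' :: r' ++ [x'] ∧ IsColumn (l' ++ y' :: r') ∧
      (∀ a ∈ l', Below a x') ∧ ¬ Below y' x' ∧ (l' ++ y' :: r').length = (l ++ y :: r).length ∧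
      wordF i (y :: (l ++ x :: r)) = some (y' :: (l' ++ x' :: r')) := by
  have hxy := le_of_not_below hy
  have hne := lo_ne_hi i
  have hlt := lo_lt_hi i
  have hcc := hc
  simp only [IsColumn, List.pairwise_append, List.pairwise_cons, List.mem_cons] at hcc
  obtain ⟨c1, ⟨c2, c3⟩, c4⟩ := hcc
  have l_lt := eq_zero_of_below (i := i) hl
  have r_gt := eq_zero_of_above (i := i) c2
  have hcol : ∀ u v, l ++ y :: r = u ++ lo i :: v → R = v ++ [x] → L = u →
      IsColumn (u ++ hi i :: v) := by
    rintro u v e rfl rfl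
    exact isColumn_of_acts (e ▸ hc) (acts_append_right.1 ha).1
  rintro rfl rfl rfl
  refine ⟨L, r, x, hi i, by simp, hcol L r rfl rfl rfl, hl,
    fun h' => absurd (h'.le.trans hxy) (not_le.2 hlt), by simp, ?_⟩
  refine (wordF_of_acts (l := []) ?_).1
  have ll := l_lt hxy (by
    rcases hxy.lt_or_eq with h' | rfl
    · exact Or.inr h'
    · exact Or.inl fun ho => hy (below_self.2 ho))
  have lx : letterEps i x = 0 := by simp [letterEps, (hxy.trans_lt hlt).ne]
  by_cases hb : IsBarred i
  · simp only [Acts, true_and, and_true, hb, if_true, eps_append_barred hb, eps_cons_barred hb, eps_nil,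
      phi_cons_barred hb, phi_nil] at ha ⊢
    omega
  · by_cases hz : IsZero i
    · simp [Acts, hb, hz, phi_nil, eps_nil]
    · have lx' : letterPhi i x = 0 := by
        rcases hxy.lt_or_eq with h' | rfl
        · exact (letter_eq_zero_of_lt h').1
        · exact absurd (below_self.2 (odd_lo_iff.2 ⟨hb, hz⟩)) hy
      simp only [Acts, true_and, and_true, hb, hz, if_false, eps_append_pos hb hz, phi_cons_pos hb hz,
        eps_cons_pos hb hz, phi_nil, eps_nil] at ha ⊢
      omega

/-- The changed letter stands under the bumped cell. This forces `x < lo i`, so `l` and `x` are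
neutral and the bump is unaffected. -/
theorem wordF_bump_right {l r L R : List (Letter m n)} {x y : Letter m n}
    (hc : IsColumn (l ++ y :: r)) (hl : ∀ a ∈ l, Below a x) (hy : ¬ Below y x) (ha : Acts i L R) :
    ∀ s t, r = s ++ lo i :: t → L = l ++ y :: s → R = t ++ [x] → ∃ l' r' x' y',
      L ++ hi i :: R = l' ++ y' :: r' ++ [x'] ∧ IsColumn (l' ++ y' :: r') ∧
      (∀ a ∈ l', Below a x') ∧ ¬ Below y' x' ∧ (l' ++ y' :: r').length = (l ++ y :: r).length ∧
      wordF i (y :: (l ++ x :: r)) = some (y' :: (l' ++ x' :: r')) := by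
  have hxy := le_of_not_below hy
  have hne := lo_ne_hi i
  have hlt := lo_lt_hi i
  have hcc := hc
  simp only [IsColumn, List.pairwise_append, List.pairwise_cons, List.mem_cons] at hcc
  obtain ⟨c1, ⟨c2, c3⟩, c4⟩ := hcc
  have l_lt := eq_zero_of_below (i := i) hl
  have r_gt := eq_zero_of_above (i := i) c2
  have hcol : ∀ u v, l ++ y :: r = u ++ lo i :: v → R = v ++ [x] → L = u →
      IsColumn (u ++ hi i :: v) := by
    rintro u v e rfl rfl
    exact isColumn_of_acts (e ▸ hc) (acts_append_right.1 ha).1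
  rintro s t rfl rfl rfl
  have hcol' := hcol (l ++ y :: s) t (by simp) rfl rfl
  refine ⟨l, s ++ hi i :: t, x, y, by simp, by simpa using hcol', hl, hy, by simp, ?_⟩
  have hx : x < lo i := by
    rcases c2 (lo i) (by simp) with h' | ⟨rfl, h'⟩
    · exact hxy.trans_lt h'
    · exact lt_of_le_of_ne hxy fun e => hy (by rw [e]; exact below_self.2 h')
  have ll := l_lt hx.le (Or.inr hx)
  have lx := letter_eq_zero_of_lt hx
  have hact : Acts i (y :: (l ++ x :: s)) t := by
    by_cases hb : IsBarred i
    · simp only [Acts, true_and, and_true, hb, if_true, eps_append_barred hb, eps_cons_barred hb, eps_nil,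
        phi_cons_barred hb, phi_nil] at ha ⊢
      omega
    · by_cases hz : IsZero i
      · simp only [Acts, true_and, and_true, hb, hz, if_false, if_true, phi_cons_zero hz, eps_cons_zero hz,
          eps_append_zero hz, ll, lx] at ha ⊢
        simpa using ha
      · simp only [Acts, true_and, and_true, hb, hz, if_false, eps_append_pos hb hz, phi_cons_pos hb hz,
          eps_cons_pos hb hz, phi_nil, eps_nil] at ha ⊢
        omega
  have := (wordF_of_acts hact).1
  simpa using this

/-- The inserted letter is changed from `lo i` to `hi i`. The bump stays at its place unless `i` is
barred and `y = lo i`. In that case `φ_i` of the column vanishes only if `hi i` follows `y`, and the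
new letter bumps this `hi i`, one cell further down. -/
theorem wordF_bump_inserted {l r L R : List (Letter m n)} {x y : Letter m n}
    (hc : IsColumn (l ++ y :: r)) (hl : ∀ a ∈ l, Below a x) (hy : ¬ Below y x) (ha : Acts i L R) :
    x = lo i → L = l ++ y :: r → R = [] → ∃ l' r' x' y',
      L ++ hi i :: R = l' ++ y' :: r' ++ [x'] ∧ IsColumn (l' ++ y' :: r') ∧
      (∀ a ∈ l', Below a x') ∧ ¬ Below y' x' ∧ (l' ++ y' :: r').length = (l ++ y :: r).length ∧
      wordF i (y :: (l ++ x :: r)) = some (y' :: (l' ++ x' :: r')) := by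
  have hxy := le_of_not_below hy
  have hne := lo_ne_hi i
  have hlt := lo_lt_hi i
  have hcc := hc
  simp only [IsColumn, List.pairwise_append, List.pairwise_cons, List.mem_cons] at hcc
  obtain ⟨c1, ⟨c2, c3⟩, c4⟩ := hcc
  have l_lt := eq_zero_of_below (i := i) hl
  have r_gt := eq_zero_of_above (i := i) c2
  have hcol : ∀ u v, l ++ y :: r = u ++ lo i :: v → R = v ++ [x] → L = u →
      IsColumn (u ++ hi i :: v) := by
    rintro u v e rfl rfl
    exact isColumn_of_acts (e ▸ hc) (acts_append_right.1 ha).1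
  rintro rfl rfl rfl
  have hlhi : ∀ a ∈ l, Below a (hi i) := fun a ha' =>
    Or.inl ((hl a ha').le.trans_lt hlt)
  have standard : ¬ Below y (hi i) → Acts i (y :: l) r → ∃ l' r' x' y',
      l ++ y :: r ++ hi i :: [] = l' ++ y' :: r' ++ [x'] ∧ IsColumn (l' ++ y' :: r') ∧
      (∀ a ∈ l', Below a x') ∧ ¬ Below y' x' ∧ (l' ++ y' :: r').length = (l ++ y :: r).length ∧
      wordF i (y :: (l ++ lo i :: r)) = some (y' :: (l' ++ x' :: r')) := by
    intro h1 h2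
    exact ⟨l, r, hi i, y, by simp, hc, hlhi, h1, rfl, by simpa using (wordF_of_acts h2).1⟩
  rcases eq_lo_or i y with hy' | rfl | rfl | hy'
  · exact absurd hxy (not_le.2 hy')
  · have olo : ¬ IsOdd (lo i) := fun ho => hy (below_self.2 ho)
    have ll := l_lt le_rfl (Or.inl olo)
    by_cases hb : IsBarred i
    · simp only [Acts, true_and, and_true, hb, if_true, eps_append_barred hb, eps_cons_barred hb, eps_nil,
        phi_cons_barred hb, phi_nil, letterPhi_lo, letterEps_lo] at ha
      rcases r with _ | ⟨z, r⟩
      · simp [eps_nil, phi_nil] at ha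
      have hzlo : lo i < z := (lo_below_iff (Or.inl hb)).1 (c2 z (by simp))
      rcases (hi_le_of_lo_lt hzlo).lt_or_eq with hz' | rfl
      · exfalso
        have rr : wordPhi i (z :: r) = 0 ∧ wordEps i (z :: r) = 0 := by
          apply eq_zero_of_gt
          intro b hbm
          rcases List.mem_cons.1 hbm with rfl | hbm
          · exact hz'
          · exact hz'.trans_le ((List.pairwise_cons.1 c3).1 b hbm).le
        omega
      · have rr : wordPhi i r = 0 ∧ wordEps i r = 0 := by
          apply eq_zero_of_gt
          intro b hbm
          exact (hi_below_iff hb).1 ((List.pairwise_cons.1 c3).1 b hbm)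
        refine ⟨l ++ [lo i], r, hi i, hi i, by simp, by simpa using hc, ?_, ?_, by simp, ?_⟩
        · intro a ha'
          rcases List.mem_append.1 ha' with ha' | ha'
          · exact hlhi a ha'
          · rw [List.mem_singleton.1 ha']; exact Or.inl hlt
        · intro h'
          exact odd_hi_iff.1 (below_self.1 h') hb
        · have : Acts i [] (l ++ lo i :: hi i :: r) := by
            simp only [Acts, true_and, and_true, hb, if_true, eps_append_barred hb, eps_cons_barred hb,
              phi_cons_barred hb, phi_nil, letterPhi_lo, letterEps_lo, letterPhi_hi,
              letterEps_hi]
            omega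
          simpa using (wordF_of_acts this).1
    · have hz : IsZero i := by
        by_contra hz
        exact olo (odd_lo_iff.2 ⟨hb, hz⟩)
      exfalso
      simp [Acts, hb, hz, eps_append_zero hz, phi_cons_zero hz, ll] at ha
  · by_cases hb : IsBarred i
    · have ohi : ¬ IsOdd (hi i) := fun ho => odd_hi_iff.1 ho hb
      have olo : ¬ IsOdd (lo i) := fun ho => (odd_lo_iff.1 ho).1 hb
      have rr := r_gt le_rfl (Or.inl ohi)
      have ll := l_lt le_rfl (Or.inl olo)
      refine standard (fun h' => ohi (below_self.1 h')) ?_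
      simp only [Acts, true_and, and_true, hb, if_true, phi_cons_barred hb, letterPhi_hi]
      omega
    · exfalso
      by_cases hz : IsZero i
      · have olo : ¬ IsOdd (lo i) := fun ho => (odd_lo_iff.1 ho).2 hz
        have ll := l_lt le_rfl (Or.inl olo)
        simp [Acts, hb, hz, eps_append_zero hz, phi_cons_zero hz, eps_cons_zero hz, ll] at ha
      · have e5 := phi_eps_column_pos hb hz hc
        simp [List.count_append] at e5
        simp only [Acts, true_and, and_true, hb, hz, if_false] at ha
        omega
  · have rr := r_gt hy'.le (Or.inr hy')
    have ly := letter_eq_zero_of_gt hy'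
    refine standard (fun h' => absurd h'.le (not_le.2 hy')) ?_
    by_cases hb : IsBarred i
    · simp only [Acts, true_and, and_true, hb, if_true, eps_append_barred hb, phi_cons_barred hb,
        eps_cons_barred hb] at ha ⊢
      omega
    · by_cases hz : IsZero i
      · simp only [Acts, true_and, and_true, hb, hz, if_false, if_true, phi_cons_zero hz, eps_cons_zero hz,
          eps_append_zero hz, ly, rr] at ha ⊢
        have h0 : wordPhi i l = 0 ∧ wordEps i l = 0 := by split_ifs at ha <;> omega
        simp [h0]
      · simp only [Acts, true_and, and_true, hb, hz, if_false, eps_append_pos hb hz, phi_cons_pos hb hz,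
          eps_cons_pos hb hz, phi_nil] at ha ⊢
        omega

/-- Bumping a letter commutes with `f_i`. -/
theorem wordF_bump {l r w' : List (Letter m n)} {x y : Letter m n} (hc : IsColumn (l ++ y :: r))
    (hl : ∀ a ∈ l, Below a x) (hy : ¬ Below y x) (h : wordF i (l ++ y :: r ++ [x]) = some w') :
    ∃ l' r' x' y', w' = l' ++ y' :: r' ++ [x'] ∧ IsColumn (l' ++ y' :: r') ∧
      (∀ a ∈ l', Below a x') ∧ ¬ Below y' x' ∧ (l' ++ y' :: r').length = (l ++ y :: r).length ∧
      wordF i (y :: (l ++ x :: r)) = some (y' :: (l' ++ x' :: r')) := by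
  obtain ⟨L, R, ha, heq, rfl⟩ := acts_of_wordF h
  have heq' : l ++ y :: (r ++ [x]) = L ++ lo i :: R := by simpa using heq
  rcases List.append_eq_append_iff.1 heq' with ⟨s, hs, hs'⟩ | ⟨s, hs, hs'⟩
  · cases s with
    | nil =>
      simp only [List.nil_append, List.cons.injEq] at hs'
      exact wordF_bump_bumped hc hl hy ha hs'.1 (by simpa using hs) hs'.2.symm
    | cons z s =>
      simp only [List.cons_append, List.cons.injEq] at hs'
      obtain ⟨rfl, hs'⟩ := hs'
      rcases List.eq_nil_or_concat R with rfl | ⟨t, z, rfl⟩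
      · obtain ⟨rfl, h'⟩ := List.append_inj' hs' rfl
        exact wordF_bump_inserted hc hl hy ha (by simpa using h') hs rfl
      · rw [List.concat_eq_append] at hs' ha ⊢
        have h' : r ++ [x] = (s ++ lo i :: t) ++ [z] := by simpa using hs'
        obtain ⟨h1, h2⟩ := List.append_inj' h' rfl
        obtain rfl : x = z := by simpa using h2
        exact wordF_bump_right hc hl hy ha s t h1 hs (by simp)
  · cases s with
    | nil =>
      simp only [List.nil_append, List.cons.injEq] at hs'
      exact wordF_bump_bumped hc hl hy ha hs'.1.symm (by simpa using hs.symm) hs'.2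
    | cons z s =>
      simp only [List.cons_append, List.cons.injEq] at hs'
      obtain ⟨rfl, rfl⟩ := hs'
      exact wordF_bump_left hc hl hy ha s hs (by simp)

end Bump

/-! ## Insertion is a morphism of crystals -/

/-- The column reading of the first `N` columns, from right to left. -/
def readCols {m n : ℕ} (N : ℕ) (T : Filling m n) : List (Letter m n) :=
  (List.range N).reverse.flatMap T

section Morphism
variable {m n : ℕ} {i : Index m n}

@[simp] theorem readCols_zero (T : Filling m n) : readCols 0 T = [] := rfl

theorem readCols_succ (N : ℕ) (T : Filling m n) :
    readCols (N + 1) T = readCols N (tailF T) ++ T 0 := by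
  unfold readCols
  rw [List.range_succ_eq_map, List.reverse_cons, List.flatMap_append, List.flatMap_singleton,
    ← List.map_reverse, List.flatMap_map]
  rfl

theorem readCols_succ' (N : ℕ) (T : Filling m n) :
    readCols (N + 1) T = T N ++ readCols N T := by
  unfold readCols
  rw [List.range_succ, List.reverse_concat, List.flatMap_cons]

theorem readCols_eq_of_supp {N M : ℕ} (h : N ≤ M) {T : Filling m n} (hT : ∀ k, N ≤ k → T k = []) :
    readCols M T = readCols N T := by
  induction M, h using Nat.le_induction with
  | base => rfl
  | succ M hM ih => rw [readCols_succ', hT M hM, ih, List.nil_append]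

theorem supp_of_colLens {T T' : Filling m n} (h : colLens T' = colLens T) {k : ℕ} (hk : T k = []) :
    T' k = [] := by
  have := congrFun h k
  simpa [colLens, hk] using this

/-- A reading word can be cut into its columns once their lengths are known. -/
theorem readCols_injective {N : ℕ} : ∀ {T T' : Filling m n}, (∀ k, N ≤ k → T k = []) →
    colLens T' = colLens T → readCols N T' = readCols N T → T' = T := by
  induction N with
  | zero =>
    intro T T' hs hc _
    funext k
    rw [hs k (Nat.zero_le _), supp_of_colLens hc (hs k (Nat.zero_le _))]
  | succ N ih =>
    intro T T' hs hc h
    rw [readCols_succ, readCols_succ] at h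
    obtain ⟨h1, h2⟩ := List.append_inj' h (congrFun hc 0)
    have h3 : tailF T' = tailF T :=
      ih (fun k hk => hs (k + 1) (by omega)) (funext fun k => congrFun hc (k + 1)) h1
    rw [← consF_tailF T, ← consF_tailF T', h2, h3]

theorem colLens_consF_congr {c c' : List (Letter m n)} {T T' : Filling m n}
    (h : c'.length = c.length) (hT : colLens T' = colLens T) :
    colLens (consF c' T') = colLens (consF c T) := by
  funext k
  cases k with
  | zero => exact h
  | succ k => exact congrFun hT k

theorem consF_isColumn {c : List (Letter m n)} {T : Filling m n} (hc : IsColumn c)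
    (hT : ∀ k, IsColumn (T k)) (k : ℕ) : IsColumn (consF c T k) := by
  cases k with
  | zero => exact hc
  | succ k => exact hT k

/-- `f_i` acts on the reading word of a sequence of columns. -/
theorem wordF_readCols {N : ℕ} : ∀ {T : Filling m n} {w' : List (Letter m n)},
    (∀ k, IsColumn (T k)) → wordF i (readCols N T) = some w' →
    ∃ T', w' = readCols N T' ∧ (∀ k, IsColumn (T' k)) ∧ colLens T' = colLens T := by
  induction N with
  | zero => intro T w' _ h; simp [wordF] at h
  | succ N ih =>
    intro T w' hT h
    rw [readCols_succ] at h
    rcases wordF_append h with ⟨u', hu, rfl, -⟩ | ⟨v', hv, rfl, -⟩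
    · obtain ⟨T', rfl, h1, h2⟩ := ih (fun k => hT (k + 1)) hu
      refine ⟨consF (T 0) T', by rw [readCols_succ]; rfl, consF_isColumn (hT 0) h1, ?_⟩
      conv_rhs => rw [← consF_tailF T]
      exact colLens_consF_congr rfl h2
    · refine ⟨consF v' (tailF T), by rw [readCols_succ]; rfl,
        consF_isColumn (isColumn_wordF (hT 0) hv) fun k => hT (k + 1), ?_⟩
      conv_rhs => rw [← consF_tailF T]
      exact colLens_consF_congr (wordF_length hv) rfl

/-- Inserting a letter into a sequence of columns is compatible with `φ_i`, `ε_i` and `f_i`. -/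
theorem ins_morphism (i : Index m n) (N : ℕ) : ∀ (x : Letter m n) (T : Filling m n),
    (∀ k, IsColumn (T k)) → (∀ k, N ≤ k → T k = []) →
    wordPhi i (readCols (N + 1) (ins x T)) = wordPhi i (readCols N T ++ [x]) ∧
    wordEps i (readCols (N + 1) (ins x T)) = wordEps i (readCols N T ++ [x]) ∧
    ∀ w', wordF i (readCols N T ++ [x]) = some w' → ∃ T' x', w' = readCols N T' ++ [x'] ∧
      (∀ k, IsColumn (T' k)) ∧ colLens T' = colLens T ∧
      wordF i (readCols (N + 1) (ins x T)) = some (readCols (N + 1) (ins x' T')) ∧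
      colLens (ins x' T') = colLens (ins x T) := by
  induction N with
  | zero =>
    intro x T hT hs
    have hT0 : T = fun _ => [] := funext fun k => hs k (Nat.zero_le _)
    subst hT0
    have key : ∀ z : Letter m n, readCols (0 + 1) (ins z fun _ => []) = [z] := fun z => by
      rw [readCols_succ, readCols_zero, ins_zero]; rfl
    rw [key]
    refine ⟨rfl, rfl, fun w' h => ?_⟩
    obtain ⟨x', rfl⟩ := List.length_eq_one_iff.1 (wordF_length h)
    refine ⟨fun _ => [], x', rfl, hT, rfl, by rw [key]; exact h, ?_⟩
    rw [colLens_ins (k := 0) (by simp [EndsAt, colIns]),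
      colLens_ins (k := 0) (by simp [EndsAt, colIns])]
  | succ N ih =>
    intro x T hT hs
    have hT' : ∀ k, IsColumn (tailF T k) := fun k => hT (k + 1)
    have hs' : ∀ k, N ≤ k → tailF T k = [] := fun k hk => hs (k + 1) (by omega)
    have hc := hT 0
    generalize hR : tailF T = R at hT' hs'
    generalize hc0 : T 0 = c at hc
    have hTe : T = consF c R := by rw [← hR, ← hc0, consF_tailF]
    subst hTe
    have hlen : ∀ R' : Filling m n, colLens R' = colLens R → readCols (N + 1) R' = readCols N R' := by
      intro R' h
      exact readCols_eq_of_supp (by omega) fun k hk => supp_of_colLens h (hs' k hk)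
    rw [readCols_succ N (consF c R), tailF_consF, consF_zero, List.append_assoc]
    rcases column_cases x c with h' | ⟨l, y, r, rfl, h1, h2⟩
    · rw [ins_append h', readCols_succ, tailF_consF, consF_zero, hlen R rfl]
      refine ⟨rfl, rfl, fun w' h => ?_⟩
      rcases wordF_append h with ⟨u', hu, rfl, -⟩ | ⟨v', hv, rfl, -⟩
      · obtain ⟨R', rfl, k1, k2⟩ := wordF_readCols hT' hu
        refine ⟨consF c R', x, ?_, consF_isColumn hc k1, colLens_consF_congr rfl k2, ?_, ?_⟩
        · rw [readCols_succ, tailF_consF, consF_zero, List.append_assoc]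
        · rw [ins_append h', readCols_succ, tailF_consF, consF_zero, hlen R' k2]; exact h
        · rw [ins_append h']; exact colLens_consF_congr rfl k2
      · have hcol := isColumn_wordF (isColumn_concat hc h') hv
        have hl := wordF_length hv
        rcases List.eq_nil_or_concat v' with rfl | ⟨c', x', rfl⟩
        · simp at hl
        rw [List.concat_eq_append] at *
        have hc' := List.pairwise_append.1 hcol
        have hx' : ∀ a ∈ c', Below a x' := fun a ha => hc'.2.2 a ha x' (by simp)
        refine ⟨consF c' R, x', ?_, consF_isColumn hc'.1 hT',
          colLens_consF_congr (by simpa using hl) rfl, ?_, ?_⟩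
        · rw [readCols_succ, tailF_consF, consF_zero, List.append_assoc]
        · rw [ins_append hx', readCols_succ, tailF_consF, consF_zero, hlen R rfl]; exact h
        · rw [ins_append hx']; exact colLens_consF_congr hl rfl
    · obtain ⟨i1, i2, i3⟩ := ih y R hT' hs'
      have p1 := phi_bump (i := i) hc h1 h2
      have p2 := eps_bump (i := i) hc h1 h2
      -- Two moves lead from the word with `x` appended to the reading word after insertion: the
      -- bump inside the first column, and the insertion of `y` into the remaining columns. `q1` and
      -- `q2` treat one move each.
      have q1 := phi_eps_append_congr (i := i) (u := readCols N R) rfl rfl p1 p2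
      have q2 := phi_eps_append_congr (i := i) (v := l ++ x :: r) i1 i2 rfl rfl
      have assoc : ∀ (u : List (Letter m n)) (z : Letter m n) v, u ++ [z] ++ v = u ++ z :: v := by
        simp
      rw [ins_bump h1 h2, readCols_succ (N + 1), tailF_consF, consF_zero]
      rw [assoc] at q2
      refine ⟨q2.1.trans q1.1, q2.2.trans q1.2, fun w' h => ?_⟩
      -- the two columns and the letters after applying the operator
      obtain ⟨R', l', r', x', y', hw', k1, k2, k3, k4, k5, k6, k7⟩ :
          ∃ R' l' r' x' y', w' = readCols N R' ++ (l' ++ y' :: r' ++ [x']) ∧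
          IsColumn (l' ++ y' :: r') ∧ (∀ a ∈ l', Below a x') ∧ ¬ Below y' x' ∧
          (l' ++ y' :: r').length = (l ++ y :: r).length ∧ (∀ k, IsColumn (R' k)) ∧
          colLens R' = colLens R ∧
          wordF i (readCols N R ++ [y] ++ (l ++ x :: r)) =
            some (readCols N R' ++ [y'] ++ (l' ++ x' :: r')) := by
        rcases wordF_append h with ⟨u', hu, rfl, hcong⟩ | ⟨v', hv, rfl, hcong⟩
        · obtain ⟨R', rfl, e1, e2⟩ := wordF_readCols hT' hu
          refine ⟨R', l, r, x, y, rfl, hc, h1, h2, rfl, e1, e2, ?_⟩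
          rw [assoc, assoc]
          exact hcong _ _ _ rfl rfl p1 p2 hu
        · obtain ⟨l', r', x', y', rfl, e1, e2, e3, e4, e5⟩ := wordF_bump hc h1 h2 hv
          refine ⟨R, l', r', x', y', rfl, e1, e2, e3, e4, hT', rfl, ?_⟩
          rw [assoc, assoc]
          exact hcong _ _ _ rfl rfl p1 p2 e5
      have hll : (l' ++ x' :: r').length = (l ++ x :: r).length := by
        simp only [List.length_append, List.length_cons] at k4 ⊢; omega
      refine ⟨consF (l' ++ y' :: r') R', x', ?_, consF_isColumn k1 k5,
        colLens_consF_congr k4 k6, ?_⟩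
      · rw [readCols_succ, tailF_consF, consF_zero, List.append_assoc, hw']
      · rw [ins_bump k2 k3, readCols_succ (N + 1), tailF_consF, consF_zero]
        -- In the intermediate word `f_i` acts either on the part to which the induction hypothesis
        -- applies, or on the first column. The columns found by the induction hypothesis are those
        -- of `R'`, because a reading word and the column lengths determine the filling.
        rcases wordF_append k7 with ⟨u', hu, heq, hcong⟩ | ⟨v', hv, heq, hcong⟩
        · obtain ⟨e1, e2⟩ := List.append_inj' heq hll
          obtain ⟨T'', x'', f1, f2, f3, f4, f5⟩ := i3 u' hu
          rw [← e1] at f1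
          obtain ⟨g1, g2⟩ := List.append_inj' f1 rfl
          obtain rfl : y' = x'' := by simpa using g2
          obtain rfl := readCols_injective (fun k hk => supp_of_colLens f3 (hs' k hk))
            (k6.trans f3.symm) g1
          rw [e2]
          exact ⟨hcong _ _ _ i1 i2 rfl rfl f4, colLens_consF_congr (by rw [← e2, hll]) f5⟩
        · obtain ⟨e1, e2⟩ := List.append_inj' heq (hll.trans (wordF_length hv).symm)
          obtain ⟨g1, g2⟩ := List.append_inj' e1 rfl
          obtain rfl : y' = y := by simpa using g2
          obtain rfl := readCols_injective hs' k6 g1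
          rw [e2]
          exact ⟨hcong _ _ _ i1 i2 rfl rfl hv, colLens_consF_congr (wordF_length hv) rfl⟩

/-- The reading word of the insertion tableau of `w`. -/
def tabWord (w : List (Letter m n)) : List (Letter m n) := readCols w.length (insTab w)

theorem tabWord_concat (w : List (Letter m n)) (x : Letter m n) :
    tabWord (w ++ [x]) = readCols (w.length + 1) (ins x (insTab w)) := by
  simp [tabWord]

theorem tabWord_phi_eps (i : Index m n) (w : List (Letter m n)) :
    wordPhi i (tabWord w) = wordPhi i w ∧ wordEps i (tabWord w) = wordEps i w := by
  induction w using List.reverseRecOn with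
  | nil => exact ⟨rfl, rfl⟩
  | append_singleton w x ih =>
    obtain ⟨h1, h2, -⟩ := ins_morphism i w.length x (insTab w) (isTab_insTab w).col (insTab_supp w)
    have := phi_eps_append_congr (v := [x]) ih.1 ih.2 rfl rfl
    rw [tabWord_concat, h1, h2]
    exact this

/-- By induction on the word: which of the two factors of `w ++ [x]` is acted on does not change
when `w` is replaced by its tableau, since `ε_i` and `φ_i` agree; then `ins_morphism` applies to the
last letter. -/
theorem tabWord_wordF {w : List (Letter m n)} : ∀ {w' : List (Letter m n)},
    wordF i w = some w' → wordF i (tabWord w) = some (tabWord w') ∧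
      colLens (insTab w') = colLens (insTab w) := by
  induction w using List.reverseRecOn with
  | nil => intro w' h; simp [wordF] at h
  | append_singleton w x ih =>
    intro w' h
    obtain ⟨h1, h2, h3⟩ := ins_morphism i w.length x (insTab w) (isTab_insTab w).col (insTab_supp w)
    have hp := tabWord_phi_eps i w
    obtain ⟨u, z, rfl, hu, hf⟩ : ∃ u z, w' = u ++ [z] ∧ u.length = w.length ∧
        colLens (insTab u) = colLens (insTab w) ∧
        wordF i (tabWord w ++ [x]) = some (tabWord u ++ [z]) := by
      rcases wordF_append h with ⟨u', hu, rfl, hcong⟩ | ⟨v', hv, rfl, hcong⟩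
      · obtain ⟨e1, e2⟩ := ih hu
        exact ⟨u', x, rfl, wordF_length hu, e2, hcong _ _ _ hp.1 hp.2 rfl rfl e1⟩
      · obtain ⟨z, rfl⟩ := List.length_eq_one_iff.1 (wordF_length hv)
        exact ⟨w, z, rfl, rfl, rfl, hcong _ _ _ hp.1 hp.2 rfl rfl hv⟩
    obtain ⟨T', x', e1, e2, e3, e4, e5⟩ := h3 _ hf.2
    obtain ⟨g1, g2⟩ := List.append_inj' e1 rfl
    obtain rfl : z = x' := by simpa using g2
    rw [tabWord, hu] at g1
    have hT : insTab u = T' := readCols_injective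
      (fun k hk => supp_of_colLens e3 (insTab_supp w k hk)) (hf.1.trans e3.symm) g1
    rw [← hT] at e4 e5
    rw [tabWord_concat, tabWord_concat, hu, insTab_concat, insTab_concat]
    exact ⟨e4, e5⟩

/-- A prefix is either left alone by `f_i` or acted on by `f_i`, and in both cases its shape stays.
The shapes of all prefixes make up the recording tableau. -/
theorem colLens_take {w w' : List (Letter m n)} (h : wordF i w = some w') (t : ℕ) :
    colLens (insTab (w'.take t)) = colLens (insTab (w.take t)) := by
  rw [← List.take_append_drop t w] at h
  rcases wordF_append h with ⟨u', hu, rfl, -⟩ | ⟨v', hv, rfl, -⟩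
  · have hl := wordF_length hu
    rcases le_total t w.length with ht | ht
    · rw [List.take_left' (by rw [hl]; simp [ht])]
      exact (tabWord_wordF hu).2
    · rw [List.drop_of_length_le ht, List.append_nil,
        List.take_of_length_le (by rw [hl]; simp)]
      exact (tabWord_wordF hu).2
  · rcases le_total t w.length with ht | ht
    · rw [List.take_left' (by simp [ht])]
    · rw [List.drop_of_length_le ht] at hv
      simp [wordF] at hv

end Morphism

/-- An operator on words which commutes with insertion and preserves the shapes. -/
structure IsPlactic {m n : ℕ} (x : List (Letter m n) → Option (List (Letter m n))) : Prop where
  length : ∀ w w', x w = some w' → w'.length = w.length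
  take : ∀ w w', x w = some w' → ∀ t, colLens (insTab (w'.take t)) = colLens (insTab (w.take t))
  some : ∀ w w', x w = some w' → x (tabWord w) = some (tabWord w')
  none : ∀ w, x w = none ↔ x (tabWord w) = none

theorem isPlactic_wordF {m n : ℕ} (i : Index m n) : IsPlactic (wordF i) where
  length _ _ h := wordF_length h
  take _ _ h := colLens_take h
  some _ _ h := (tabWord_wordF h).1
  none w := by rw [wordF_eq_none, wordF_eq_none, (tabWord_phi_eps i w).1]

theorem isPlactic_wordE {m n : ℕ} (i : Index m n) : IsPlactic (wordE i) where
  length _ _ h := (wordF_length (wordF_iff_wordE.2 h)).symm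
  take _ _ h t := (colLens_take (wordF_iff_wordE.2 h) t).symm
  some _ _ h := wordF_iff_wordE.1 (tabWord_wordF (wordF_iff_wordE.2 h)).1
  none w := by rw [wordE_eq_none, wordE_eq_none, (tabWord_phi_eps i w).2]

/-! ## Biwords -/

/-- The pair `b` may follow the pair `a` in the biword of a matrix in `M`. -/
def Prec {m n : ℕ} (a b : Letter m n × Letter m n) : Prop :=
  a.2 < b.2 ∨ a.2 = b.2 ∧ (Below a.1 b.1 ↔ IsOdd a.2)

section Biwords
variable {m n : ℕ}

/-- The biwords of the matrices in `M`. -/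
abbrev IsBiword (p : List (Letter m n × Letter m n)) : Prop := p.Pairwise Prec

theorem Prec.trans {a b c : Letter m n × Letter m n} (h : Prec a b) (h' : Prec b c) :
    Prec a c := by
  obtain ⟨a₁, a₂⟩ := a
  obtain ⟨b₁, b₂⟩ := b
  obtain ⟨c₁, c₂⟩ := c
  simp only [Prec] at *
  rcases h with h | ⟨rfl, h⟩ <;> rcases h' with h' | ⟨rfl, h'⟩
  · exact Or.inl (h.trans h')
  · exact Or.inl h
  · exact Or.inl h'
  · refine Or.inr ⟨rfl, ?_⟩
    by_cases ho : IsOdd a₂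
    · simp only [ho, iff_true] at *
      exact h.trans h'
    · simp only [ho, iff_false] at *
      exact not_below_trans h h'

theorem Prec.antisymm {a b : Letter m n × Letter m n} (h : Prec a b) (h' : Prec b a) : a = b := by
  obtain ⟨a₁, a₂⟩ := a
  obtain ⟨b₁, b₂⟩ := b
  simp only [Prec] at *
  rcases h with h | ⟨rfl, h⟩
  · rcases h' with h' | ⟨rfl, h'⟩
    · exact absurd h h'.asymm
    · exact absurd h (lt_irrefl _)
  · simp only [lt_irrefl, true_and, false_or] at h'
    by_cases ho : IsOdd a₂
    · simp only [ho, iff_true] at *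
      rw [le_antisymm h.le h'.le]
    · simp only [ho, iff_false] at *
      rw [le_antisymm (le_of_not_below h') (le_of_not_below h)]

/-- The bound on entries of mixed parity is thereby built into `Prec`: a pair may be repeated
exactly if its two letters have the same parity. -/
theorem prec_self {a : Letter m n × Letter m n} : Prec a a ↔ (IsOdd a.1 ↔ IsOdd a.2) := by
  simp [Prec, below_self]

theorem IsBiword.eq_of_perm {p q : List (Letter m n × Letter m n)} (hp : IsBiword p)
    (hq : IsBiword q) (h : p.Perm q) : p = q :=
  List.Perm.eq_of_pairwise (fun _ _ _ _ => Prec.antisymm) hp hq h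

theorem below_or_not_below_of_lt {b b' : Letter m n} (h : b < b') : Below b b' ∧ ¬ Below b' b :=
  ⟨Or.inl h, not_below_iff.2 (Or.inl h)⟩

theorem isBiword_biword {A : Mat m n} (hA : A ∈ superMatrices m n) : IsBiword (biword A) := by
  have hmem : ∀ (l : List (Letter m n)) (b' : Letter m n), ∀ x ∈ (l.flatMap fun b =>
      List.replicate (A b b') (b, b')), x.2 = b' := by
    intro l b' x hx
    obtain ⟨b, -, hb⟩ := List.mem_flatMap.1 hx
    rw [List.eq_of_mem_replicate hb]
  unfold biword
  refine List.pairwise_flatMap.2 ⟨fun b' _ => ?_, ?_⟩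
  · refine List.pairwise_flatMap.2 ⟨fun b _ => ?_, ?_⟩
    · rw [List.pairwise_replicate, prec_self]
      by_cases h : IsOdd b ↔ IsOdd b'
      · exact Or.inr h
      · exact Or.inl (hA b b' h)
    · split_ifs with ho
      · refine (List.pairwise_lt_finRange _).imp ?_
        intro b c hbc x hx y hy
        rw [List.eq_of_mem_replicate hx, List.eq_of_mem_replicate hy]
        exact Or.inr ⟨rfl, by simp [ho, (below_or_not_below_of_lt hbc).1]⟩
      · refine List.pairwise_reverse.2 ((List.pairwise_lt_finRange _).imp ?_)
        intro b c hbc x hx y hy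
        rw [List.eq_of_mem_replicate hx, List.eq_of_mem_replicate hy]
        exact Or.inr ⟨rfl, by simp [ho, (below_or_not_below_of_lt hbc).2]⟩
  · refine (List.pairwise_lt_finRange _).imp ?_
    intro b c hbc x hx y hy
    exact Or.inl (by rw [hmem _ _ x hx, hmem _ _ y hy]; exact hbc)

theorem count_biword (A : Mat m n) (b b' : Letter m n) : (biword A).count (b, b') = A b b' := by
  have key : ∀ c' : Letter m n, List.count (b, b')
      ((if IsOdd c' then List.finRange (m + n) else (List.finRange (m + n)).reverse).flatMap
        fun c => List.replicate (A c c') (c, c')) = if c' = b' then A b b' else 0 := by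
    intro c'
    have h1 : ∀ l : List (Letter m n), l.Perm (List.finRange (m + n)) → List.count (b, b')
        (l.flatMap fun c => List.replicate (A c c') (c, c')) = if c' = b' then A b b' else 0 := by
      intro l hl
      rw [List.count_flatMap, (hl.map _).sum_eq, ← Fin.sum_univ_def]
      simp only [Function.comp, List.count_replicate, beq_iff_eq, Prod.mk.injEq]
      by_cases hc : c' = b'
      · simp [hc]
      · simp [hc]
    by_cases ho : IsOdd c'
    · rw [if_pos ho]; exact h1 _ (List.Perm.refl _)
    · rw [if_neg ho]; exact h1 _ (List.reverse_perm _)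
  rw [biword, List.count_flatMap, ← Fin.sum_univ_def]
  simp only [Function.comp]
  simp only [key]
  simp

theorem matrixOf_biword (A : Mat m n) : matrixOf (biword A) = A := by
  ext b b'
  simp [matrixOf, count_biword]

theorem matrixOf_mem {p : List (Letter m n × Letter m n)} (hp : IsBiword p) :
    matrixOf p ∈ superMatrices m n := by
  intro b b' h
  by_contra hlt
  have hs : (List.replicate 2 (b, b')).Sublist p :=
    List.replicate_sublist_iff.2 (by simp only [matrixOf, Matrix.of_apply] at hlt; omega)
  have := hp.sublist hs
  rw [List.pairwise_replicate, prec_self] at this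
  exact h (this.resolve_left (by norm_num))

theorem biword_matrixOf {p : List (Letter m n × Letter m n)} (hp : IsBiword p) :
    biword (matrixOf p) = p := by
  refine IsBiword.eq_of_perm (isBiword_biword (matrixOf_mem hp)) hp (List.perm_iff_count.2 ?_)
  rintro ⟨b, b'⟩
  rw [count_biword]
  rfl

theorem transpose_mem {A : Mat m n} (hA : A ∈ superMatrices m n) :
    A.transpose ∈ superMatrices m n := fun b b' h => hA b' b fun h' => h h'.symm

theorem biword_transpose_perm (A : Mat m n) :
    (biword A.transpose).Perm ((biword A).map Prod.swap) := by
  refine List.perm_iff_count.2 ?_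
  rintro ⟨b, b'⟩
  rw [count_biword, show (b, b') = Prod.swap (b', b) from rfl,
    List.count_map_of_injective _ _ Prod.swap_injective, count_biword]
  rfl

theorem perm_swap_symm {p q : List (Letter m n × Letter m n)} (h : q.Perm (p.map Prod.swap)) :
    p.Perm (q.map Prod.swap) := by
  have := (h.map Prod.swap).symm
  simpa using this

theorem exists_isBiword_swap {p : List (Letter m n × Letter m n)} (hp : IsBiword p) :
    ∃ q, IsBiword q ∧ q.Perm (p.map Prod.swap) := by
  refine ⟨biword (matrixOf p).transpose, isBiword_biword (transpose_mem (matrixOf_mem hp)), ?_⟩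
  have := biword_transpose_perm (matrixOf p)
  rwa [biword_matrixOf hp] at this

/-! ### The symmetry of the Robinson-Schensted-Knuth correspondence -/

/-- The first row of a biword. -/
abbrev fsts (p : List (Letter m n × Letter m n)) : List (Letter m n) := p.map Prod.fst

/-- The second row of a biword increases weakly. A pair with the largest possible partner of `i` can
thus be taken as the last occurrence of `i`, and one with the smallest partner as the first. These
are the occurrences, for odd and for even `i`, that `insTab_largest` can remove. -/
theorem exists_split {p : List (Letter m n × Letter m n)} (hp : IsBiword p) {i y : Letter m n}
    (hmem : (i, y) ∈ p) (hodd : IsOdd i → ∀ y', (i, y') ∈ p → y' ≤ y)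
    (heven : ¬ IsOdd i → ∀ y', (i, y') ∈ p → y ≤ y') :
    ∃ p₁ p₂, p = p₁ ++ (i, y) :: p₂ ∧ (IsOdd i → i ∉ fsts p₂) ∧ (¬ IsOdd i → i ∉ fsts p₁) := by
  have hle : ∀ a b : Letter m n × Letter m n, Prec a b → a.2 ≤ b.2 := by
    rintro a b (h | ⟨h, -⟩)
    · exact h.le
    · exact h.le
  by_cases ho : IsOdd i
  · induction p using List.reverseRecOn with
    | nil => simp at hmem
    | append_singleton p a ih =>
      have hp' := List.pairwise_append.1 hp
      by_cases ha : a.1 = i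
      · refine ⟨p, [], ?_, by simp, fun h => absurd ho h⟩
        have h1 : a.2 ≤ y := hodd ho a.2 (by rw [← ha]; simp)
        have h2 : y ≤ a.2 := by
          rcases List.mem_append.1 hmem with h | h
          · exact hle _ _ (hp'.2.2 _ h a (by simp))
          · simp only [List.mem_singleton] at h
            rw [← h]
        rw [← ha, ← le_antisymm h1 h2]
      · obtain ⟨p₁, p₂, rfl, h1, h2⟩ := ih hp'.1 (by
            rcases List.mem_append.1 hmem with h | h
            · exact h
            · simp only [List.mem_singleton] at h
              exact absurd (by rw [← h]) ha) (fun h y' hy' => hodd h y' (by simp [hy']))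
            (fun h => absurd ho h)
        refine ⟨p₁, p₂ ++ [a], by simp, fun h => ?_, h2⟩
        simp only [List.map_append, List.map_cons, List.map_nil, List.mem_append,
          List.mem_singleton, not_or]
        exact ⟨h1 h, fun h => ha h.symm⟩
  · induction p with
    | nil => simp at hmem
    | cons a p ih =>
      have hp' := List.pairwise_cons.1 hp
      by_cases ha : a.1 = i
      · refine ⟨[], p, ?_, fun h => absurd h ho, by simp⟩
        have h1 : y ≤ a.2 := heven ho a.2 (by rw [← ha]; simp)
        have h2 : a.2 ≤ y := by
          rcases List.mem_cons.1 hmem with h | h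
          · rw [← h]
          · exact hle _ _ (hp'.1 _ h)
        rw [← ha, le_antisymm h1 h2]
        rfl
      · obtain ⟨p₁, p₂, rfl, h1, h2⟩ := ih hp'.2 (by
            rcases List.mem_cons.1 hmem with h | h
            · exact absurd (by rw [← h]) ha
            · exact h) (fun h => absurd h ho) (fun h y' hy' => heven h y' (by simp [hy']))
        refine ⟨a :: p₁, p₂, by simp, h1, fun h => ?_⟩
        simp only [List.map_cons, List.mem_cons, not_or]
        exact ⟨fun h => ha h.symm, h2 h⟩

/-- The occurrence in `p` of the last pair of its transpose. -/
theorem split_of_last {p q₀ : List (Letter m n × Letter m n)} {y i : Letter m n} (hp : IsBiword p)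
    (hq : IsBiword (q₀ ++ [(y, i)])) (hpq : (q₀ ++ [(y, i)]).Perm (p.map Prod.swap)) :
    (∀ a ∈ fsts p, a ≤ i) ∧ ∃ p₁ p₂, p = p₁ ++ (i, y) :: p₂ ∧ (IsOdd i → i ∉ fsts p₂) ∧
      (¬ IsOdd i → i ∉ fsts p₁) ∧ q₀.Perm ((p₁ ++ p₂).map Prod.swap) := by
  have hmem : ∀ a b, (a, b) ∈ p ↔ (b, a) ∈ q₀ ++ [(y, i)] := by
    intro a b
    rw [hpq.mem_iff]
    simp [Prod.swap]
  have hlast : ∀ a b, (a, b) ∈ p → (b, a) = (y, i) ∨ Prec (b, a) (y, i) := by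
    intro a b h
    rcases List.mem_append.1 ((hmem a b).1 h) with h | h
    · exact Or.inr ((List.pairwise_append.1 hq).2.2 _ h _ (by simp))
    · exact Or.inl (by simpa using h)
  refine ⟨?_, ?_⟩
  · intro a ha
    obtain ⟨⟨a', b⟩, h, rfl⟩ := List.mem_map.1 ha
    rcases hlast _ _ h with h | h
    · simp only [Prod.mk.injEq] at h
      exact h.2.le
    · rcases h with h | ⟨h, -⟩
      · exact h.le
      · exact h.le
  · obtain ⟨p₁, p₂, rfl, h1, h2⟩ := exists_split hp ((hmem i y).2 (by simp))
      (by
        intro ho y' hy'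
        rcases hlast _ _ hy' with h | h
        · simp only [Prod.mk.injEq] at h
          exact h.1.le
        · simp only [Prec, lt_irrefl, ho, iff_true, true_and, false_or] at h
          exact h.le)
      (by
        intro ho y' hy'
        rcases hlast _ _ hy' with h | h
        · simp only [Prod.mk.injEq] at h
          exact h.1.ge
        · simp only [Prec, lt_irrefl, ho, iff_false, true_and, false_or] at h
          exact le_of_not_below h)
    refine ⟨p₁, p₂, rfl, h1, h2, ?_⟩
    have e1 : (q₀ ++ [(y, i)]).Perm ((y, i) :: q₀) := List.perm_append_comm
    have e2 : ((p₁ ++ (i, y) :: p₂).map Prod.swap).Perm ((y, i) :: (p₁ ++ p₂).map Prod.swap) :=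
      List.perm_middle.map Prod.swap
    exact (List.perm_cons _).1 ((e1.symm.trans hpq).trans e2)

/-- The insertion tableau of the first row of a biword. -/
abbrev biTab (p : List (Letter m n × Letter m n)) : Filling m n := insTab (fsts p)

theorem isBiword_remove {p₁ p₂ : List (Letter m n × Letter m n)} {a : Letter m n × Letter m n}
    (h : IsBiword (p₁ ++ a :: p₂)) : IsBiword (p₁ ++ p₂) :=
  h.sublist (List.Sublist.append (List.Sublist.refl _) (List.sublist_cons_self _ _))

/-- The last pairs of a biword and of its transpose: either they correspond to each other, or
they are two distinct entries. -/
theorem last_cases {p q : List (Letter m n × Letter m n)} (hp : IsBiword p) (hq : IsBiword q)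
    (hpq : q.Perm (p.map Prod.swap)) (hne : p ≠ []) :
    (∃ p₀ q₀ x j, p = p₀ ++ [(x, j)] ∧ q = q₀ ++ [(j, x)] ∧ (∀ a ∈ fsts p₀, a ≤ x) ∧
      (∀ a ∈ fsts q₀, a ≤ j) ∧ (¬ IsOdd x → x ∉ fsts p₀) ∧ (¬ IsOdd j → j ∉ fsts q₀) ∧
      q₀.Perm (p₀.map Prod.swap)) ∨
    (∃ p₁ p₂ q₁ q₂ x j y i, p = p₁ ++ (i, y) :: p₂ ++ [(x, j)] ∧
      q = q₁ ++ (j, x) :: q₂ ++ [(y, i)] ∧ (∀ a ∈ fsts p, a ≤ i) ∧ (∀ a ∈ fsts q, a ≤ j) ∧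
      (IsOdd i → i ∉ fsts (p₂ ++ [(x, j)])) ∧ (¬ IsOdd i → i ∉ fsts p₁) ∧
      (IsOdd j → j ∉ fsts (q₂ ++ [(y, i)])) ∧ (¬ IsOdd j → j ∉ fsts q₁) ∧
      (q₁ ++ q₂ ++ [(y, i)]).Perm ((p₁ ++ (i, y) :: p₂).map Prod.swap) ∧
      (q₁ ++ (j, x) :: q₂).Perm ((p₁ ++ p₂ ++ [(x, j)]).map Prod.swap) ∧
      (q₁ ++ q₂).Perm ((p₁ ++ p₂).map Prod.swap)) := by
  rcases List.eq_nil_or_concat p with rfl | ⟨p₀, ⟨x, j⟩, rfl⟩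
  · exact absurd rfl hne
  rcases List.eq_nil_or_concat q with rfl | ⟨q₀, ⟨y, i⟩, rfl⟩
  · have := hpq.length_eq
    simp at this
  rw [List.concat_eq_append] at *
  rw [List.concat_eq_append] at *
  have hqp := perm_swap_symm hpq
  obtain ⟨hi, p₁, p₂, ep, h1, h2, h3⟩ := split_of_last hp hq hpq
  obtain ⟨hj, q₁, q₂, eq, k1, k2, k3⟩ := split_of_last hq hp hqp
  -- the two splittings degenerate simultaneously
  have degen : ∀ {p₀ p₁ q₀ q₁ q₂ : List (Letter m n × Letter m n)} {x y i j : Letter m n},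
      IsBiword (q₀ ++ [(y, i)]) → (q₀ ++ [(y, i)]).Perm ((p₀ ++ [(x, j)]).map Prod.swap) →
      p₀ ++ [(x, j)] = p₁ ++ [(i, y)] → (¬ IsOdd i → i ∉ fsts p₁) →
      q₀ ++ [(y, i)] = q₁ ++ (j, x) :: q₂ → (IsOdd j → j ∉ fsts q₂) → q₂ = [] := by
    intro p₀ p₁ q₀ q₁ q₂ x y i j hq hpq ep h2 eq k1
    obtain ⟨rfl, e⟩ := List.append_inj' ep rfl
    simp only [List.cons.injEq, Prod.mk.injEq, and_true] at e
    obtain ⟨rfl, rfl⟩ := e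
    rcases List.eq_nil_or_concat q₂ with h | ⟨q₃, a, rfl⟩
    · exact h
    exfalso
    rw [List.concat_eq_append] at *
    rw [← List.cons_append, ← List.append_assoc] at eq
    obtain ⟨e1, e2⟩ := List.append_inj' eq rfl
    simp only [List.cons.injEq, and_true] at e2
    subst e2
    subst e1
    -- If `q₂` were not empty, the pair `(j, x)` would occur twice in `q`, with `j` even, hence `x`
    -- even. A second copy of `(x, j)` in `p₀` then contradicts the choice of the first occurrence
    -- of an even letter.
    have hoj : ¬ IsOdd j := fun h => k1 h (by simp)
    have hpar := prec_self.1 ((List.pairwise_append.1 hq).2.2 (j, x) (by simp) (j, x) (by simp))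
    have hox : ¬ IsOdd x := fun h => hoj (hpar.2 h)
    have hm : (j, x) ∈ p₀.map Prod.swap := by
      have e1 : (q₁ ++ (j, x) :: q₃ ++ [(j, x)]).Perm ((j, x) :: (q₁ ++ (j, x) :: q₃)) :=
        List.perm_append_comm
      have e2 : ((p₀ ++ [(x, j)]).map Prod.swap).Perm ((j, x) :: p₀.map Prod.swap) := by
        rw [List.map_append]
        exact List.perm_append_comm
      have e3 := (List.perm_cons _).1 ((e1.symm.trans hpq).trans e2)
      exact e3.mem_iff.1 (by simp)
    obtain ⟨⟨x', j'⟩, hx', e⟩ := List.mem_map.1 hm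
    simp only [Prod.swap, Prod.mk.injEq] at e
    obtain ⟨rfl, rfl⟩ := e
    exact h2 hox (List.mem_map.2 ⟨_, hx', rfl⟩)
  by_cases hp2 : p₂ = []
  · left
    subst hp2
    have hq2 : q₂ = [] := degen hq hpq ep h2 eq k1
    subst hq2
    obtain ⟨rfl, e⟩ := List.append_inj' ep rfl
    obtain ⟨rfl, -⟩ := List.append_inj' eq rfl
    simp only [List.cons.injEq, Prod.mk.injEq, and_true] at e
    obtain ⟨rfl, rfl⟩ := e
    exact ⟨p₀, q₀, x, j, rfl, rfl, fun a ha => hi a (by simp [ha]),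
      fun a ha => hj a (by simp [ha]), h2, k2, by simpa using h3⟩
  · right
    have hq2 : q₂ ≠ [] := fun h => by
      subst h
      exact hp2 (degen hp hqp eq k2 ep h1)
    rcases List.eq_nil_or_concat p₂ with h | ⟨p₃, a, rfl⟩
    · exact absurd h hp2
    rcases List.eq_nil_or_concat q₂ with h | ⟨q₃, b, rfl⟩
    · exact absurd h hq2
    simp only [List.concat_eq_append] at *
    rw [← List.cons_append, ← List.append_assoc] at ep eq
    obtain ⟨rfl, e⟩ := List.append_inj' ep rfl
    simp only [List.cons.injEq, and_true] at e
    subst e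
    obtain ⟨rfl, e⟩ := List.append_inj' eq rfl
    simp only [List.cons.injEq, and_true] at e
    subst e
    refine ⟨p₁, p₃, q₁, q₃, x, j, y, i, rfl, rfl, hi, hj, h1, h2, k1, k2, ?_, ?_, ?_⟩
    · have := perm_swap_symm k3
      rwa [← List.append_assoc] at this
    · rwa [← List.append_assoc] at h3
    · have e1 : (q₁ ++ (j, x) :: q₃).Perm ((j, x) :: (q₁ ++ q₃)) := List.perm_middle
      have e2 : ((p₁ ++ (p₃ ++ [(x, j)])).map Prod.swap).Perm
          ((j, x) :: (p₁ ++ p₃).map Prod.swap) := by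
        rw [← List.append_assoc, List.map_append]
        exact List.perm_append_comm
      exact (List.perm_cons _).1 ((e1.symm.trans h3).trans e2)

/-- The shapes of the insertion tableaux of four words which differ by the largest letter and by
the last letter. -/
theorem insTab_growth {N x : Letter m n} {u v : List (Letter m n)} (hu : ∀ a ∈ u, a ≤ N)
    (hu' : ¬ IsOdd N → N ∉ u) (hv : ∀ a ∈ v ++ [x], a ≤ N) (hv' : IsOdd N → N ∉ v ++ [x]) :
    ∃ k t, colLens (insTab (u ++ N :: v)) = colLens (insTab (u ++ v)) + Pi.single k 1 ∧
      colLens (insTab (u ++ v ++ [x])) = colLens (insTab (u ++ v)) + Pi.single t 1 ∧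
      colLens (insTab (u ++ N :: v ++ [x])) = colLens (insTab (u ++ v)) + Pi.single t 1 +
        Pi.single (if t = k then k + 1 else k) 1 := by
  obtain ⟨k, h1, h2⟩ := insTab_largest hu hu' v (fun a ha => hv a (by simp [ha]))
    fun h h' => hv' h (by simp [h'])
  obtain ⟨t, -, ht⟩ := insTab_endsAt (u ++ v) x
  refine ⟨k, t, by rw [h2, colLens_addAt], by rw [insTab_concat, colLens_ins ht], ?_⟩
  rw [insTab_concat, h2, (ins_addAt h1 (hv x (by simp)) (fun ho h => hv' ho (by simp [h])) ht).1,
    colLens_addAt, colLens_ins ht]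

theorem insTab_concat_largest {N : Letter m n} {u : List (Letter m n)} (hu : ∀ a ∈ u, a ≤ N)
    (hu' : ¬ IsOdd N → N ∉ u) :
    colLens (insTab (u ++ [N])) = colLens (insTab u) + Pi.single 0 1 := by
  have h : IsLargest N 0 (insTab u) :=
    ⟨fun j a ha => hu a (mem_insTab ha), by simp, fun he j _ hj => hu' he (mem_insTab hj)⟩
  rw [insTab_concat, (ins_largest h).2, colLens_addAt]

/-- A biword and its transpose have insertion tableaux of the same shape. -/
theorem colLens_biTab_swap {p q : List (Letter m n × Letter m n)} (hp : IsBiword p)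
    (hq : IsBiword q) (hpq : q.Perm (p.map Prod.swap)) :
    colLens (biTab q) = colLens (biTab p) := by
  induction hl : p.length using Nat.strong_induction_on generalizing p q with
  | _ l ih =>
    subst hl
    by_cases hne : p = []
    · subst hne
      simp only [List.map_nil, List.perm_nil] at hpq
      rw [hpq]
    rcases last_cases hp hq hpq hne with ⟨p₀, q₀, x, j, rfl, rfl, h1, h2, h3, h4, h5⟩ |
      ⟨p₁, p₂, q₁, q₂, x, j, y, i, rfl, rfl, h1, h2, h3, h4, h5, h6, h7, h8, h9⟩
    · simp only [biTab, fsts, List.map_append, List.map_cons, List.map_nil]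
      rw [insTab_concat_largest h1 h3, insTab_concat_largest h2 h4]
      rw [ih p₀.length (by simp) (List.pairwise_append.1 hp).1 (List.pairwise_append.1 hq).1 h5 rfl]
    · have hpA := (List.pairwise_append.1 hp).1
      have hqB := (List.pairwise_append.1 hq).1
      have hpB : IsBiword (p₁ ++ p₂ ++ [(x, j)]) := by
        rw [List.append_assoc, List.cons_append] at hp
        rw [List.append_assoc]
        exact isBiword_remove hp
      have hqA : IsBiword (q₁ ++ q₂ ++ [(y, i)]) := by
        rw [List.append_assoc, List.cons_append] at hq
        rw [List.append_assoc]
        exact isBiword_remove hq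
      have i1 := ih _ (by simp) hpA hqA h7 rfl
      have i2 := ih _ (by simp) hpB hqB h8 rfl
      have i3 := ih _ (by simp) (isBiword_remove hpA) (isBiword_remove hqB) h9 rfl
      obtain ⟨k, t, e1, e2, e3⟩ := insTab_growth (N := i) (x := x) (u := fsts p₁) (v := fsts p₂)
        (fun a ha => h1 a (by simp [ha])) h4
        (fun a ha => h1 a (by
          simp only [List.map_append, List.map_cons, List.map_nil, List.mem_append,
            List.mem_cons, List.not_mem_nil, or_false] at ha ⊢
          tauto))
        (fun ho => by simpa using h3 ho)
      obtain ⟨k', t', f1, f2, f3⟩ := insTab_growth (N := j) (x := y) (u := fsts q₁) (v := fsts q₂)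
        (fun a ha => h2 a (by simp [ha])) h6
        (fun a ha => h2 a (by
          simp only [List.map_append, List.map_cons, List.map_nil, List.mem_append,
            List.mem_cons, List.not_mem_nil, or_false] at ha ⊢
          tauto))
        (fun ho => by simpa using h5 ho)
      simp only [biTab, fsts, List.map_append, List.map_cons, List.map_nil, List.append_assoc,
        List.cons_append] at i1 i2 i3 e1 e2 e3 f1 f2 f3 ⊢
      rw [i3] at f1 f2 f3
      -- Removing the last pair of one biword is removing the largest letter of the first row of the
      -- other, so the transposition exchanges the two added cells.
      have ht' : t' = k := by
        have := f2.symm.trans (i1.trans e1)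
        exact single_one_inj (add_left_cancel this)
      have hk' : k' = t := by
        have := f1.symm.trans (i2.trans e2)
        exact single_one_inj (add_left_cancel this)
      rw [f3, e3, ht', hk']
      -- The local rule is symmetric in `t` and `k`.
      by_cases htk : t = k
      · subst htk; simp
      · rw [if_neg htk, if_neg fun h => htk h.symm, add_right_comm]

end Biwords

/-! ### The correspondence is bijective -/

section Correspondence
variable {m n : ℕ}

theorem mem_addAt {k l : ℕ} {N a : Letter m n} {T : Filling m n} :
    a ∈ addAt k N T l ↔ a ∈ T l ∨ (l = k ∧ a = N) := by
  by_cases h : l = k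
  · subst h; simp [addAt]
  · simp [addAt, h]

theorem IsLargest.mem_le {N a : Letter m n} {k l : ℕ} {T : Filling m n} (h : IsLargest N k T)
    (ha : a ∈ addAt k N T l) : a ≤ N := by
  rcases mem_addAt.1 ha with ha | ⟨-, rfl⟩
  · exact h.le _ _ ha
  · exact le_rfl

/-- The letter is the maximum of the filling, and its column is the leftmost one containing the
maximum if that is odd, the rightmost one if it is even. -/
theorem addAt_injective {N N' : Letter m n} {k k' : ℕ} {T T' : Filling m n} (h : IsLargest N k T)
    (h' : IsLargest N' k' T') (heq : addAt k N T = addAt k' N' T') : N = N' ∧ k = k' ∧ T = T' := by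
  have hN : N = N' := by
    refine le_antisymm (h'.mem_le (l := k) ?_) (h.mem_le (l := k') ?_)
    · rw [← heq]; exact mem_addAt.2 (Or.inr ⟨rfl, rfl⟩)
    · rw [heq]; exact mem_addAt.2 (Or.inr ⟨rfl, rfl⟩)
  subst hN
  have key : ∀ {k k' : ℕ} {T T' : Filling m n}, IsLargest N k T → IsLargest N k' T' →
      addAt k N T = addAt k' N T' → ¬ k < k' := by
    intro k k' T T' h h' heq hlt
    by_cases ho : IsOdd N
    · have : N ∈ addAt k' N T' k := by
        rw [← heq]; exact mem_addAt.2 (Or.inr ⟨rfl, rfl⟩)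
      rcases mem_addAt.1 this with h1 | ⟨h1, -⟩
      · exact h'.odd ho k hlt h1
      · omega
    · have : N ∈ addAt k N T k' := by
        rw [heq]; exact mem_addAt.2 (Or.inr ⟨rfl, rfl⟩)
      rcases mem_addAt.1 this with h1 | ⟨h1, -⟩
      · exact h.even ho k' hlt.le h1
      · omega
  have hk : k = k' := le_antisymm (not_lt.1 (key h' h heq.symm)) (not_lt.1 (key h h' heq))
  subst hk
  refine ⟨rfl, rfl, funext fun l => ?_⟩
  have := congrFun heq l
  by_cases hl : l = k
  · subst hl
    simpa [addAt] using this
  · simpa [addAt, hl] using this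

/-- Recursion for the insertion tableau of the transpose: it is the recording tableau. -/
theorem biTab_swap_concat {p q p₀ q₀ : List (Letter m n × Letter m n)} {x j : Letter m n}
    (hp : IsBiword p) (hq : IsBiword q) (hpq : q.Perm (p.map Prod.swap))
    (hq₀ : IsBiword q₀) (hpq₀ : q₀.Perm (p₀.map Prod.swap)) (e : p = p₀ ++ [(x, j)]) :
    ∃ k, EndsAt k x (biTab p₀) ∧ IsLargest j k (biTab q₀) ∧ biTab q = addAt k j (biTab q₀) := by
  subst e
  obtain ⟨hj, q₁, q₂, rfl, h1, h2, h3⟩ := split_of_last hq hp (perm_swap_symm hpq)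
  have hq12 := isBiword_remove hq
  obtain rfl : q₀ = q₁ ++ q₂ := hq₀.eq_of_perm hq12 (hpq₀.trans (perm_swap_symm h3).symm)
  obtain ⟨k, k1, k2⟩ := insTab_largest (N := j) (u := fsts q₁) (fun a ha => hj a (by simp [ha])) h2
    (fsts q₂) (fun a ha => hj a (by
      simp only [List.map_append, List.map_cons, List.mem_append, List.mem_cons]; tauto)) h1
  have e1 : biTab (q₁ ++ (j, x) :: q₂) = addAt k j (biTab (q₁ ++ q₂)) := by
    simpa [biTab, fsts] using k2
  have e2 : IsLargest j k (biTab (q₁ ++ q₂)) := by simpa [biTab, fsts] using k1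
  refine ⟨k, ?_, e2, e1⟩
  obtain ⟨t, -, ht⟩ := insTab_endsAt (fsts p₀) x
  -- The column `k` of the new largest entry and the terminal column `t` of the insertion are both
  -- the difference of the same two shapes.
  have s1 := colLens_biTab_swap hp hq hpq
  have s2 := colLens_biTab_swap (List.pairwise_append.1 hp).1 hq₀ hpq₀
  have e3 : biTab (p₀ ++ [(x, j)]) = ins x (biTab p₀) := by simp [biTab, fsts]
  rw [e1, e3, colLens_addAt, s2, colLens_ins ht] at s1
  rwa [single_one_inj (add_left_cancel s1)]

theorem eq_nil_of_insTab {w : List (Letter m n)} (h : colLens (insTab w) = 0) : w = [] := by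
  rcases List.eq_nil_or_concat w with h' | ⟨w, x, rfl⟩
  · exact h'
  · obtain ⟨t, -, ht⟩ := insTab_endsAt w x
    rw [List.concat_eq_append, insTab_concat, colLens_ins ht] at h
    have := congrFun h t
    simp at this

/-- A biword is determined by its insertion tableau and that of its transpose. -/
theorem biTab_injective {p : List (Letter m n × Letter m n)} :
    ∀ {p' q q' : List (Letter m n × Letter m n)}, IsBiword p → IsBiword p' → IsBiword q →
    IsBiword q' → q.Perm (p.map Prod.swap) → q'.Perm (p'.map Prod.swap) → biTab p = biTab p' →
    biTab q = biTab q' → p = p' := by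
  induction p using List.reverseRecOn with
  | nil =>
    intro p' q q' _ _ _ _ _ _ h1 _
    have := eq_nil_of_insTab (w := fsts p') (by rw [← biTab, ← h1]; rfl)
    simpa using this.symm
  | append_singleton p a ih =>
    intro p' q q' hp hp' hq hq' hpq hpq' h1 h2
    rcases List.eq_nil_or_concat p' with rfl | ⟨p', b, rfl⟩
    · have := eq_nil_of_insTab (w := fsts (p ++ [a])) (by rw [← biTab, h1]; rfl)
      simp at this
    rw [List.concat_eq_append] at *
    obtain ⟨x, j⟩ := a
    obtain ⟨x', j'⟩ := b
    obtain ⟨q₀, hq₀, hpq₀⟩ := exists_isBiword_swap (List.pairwise_append.1 hp).1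
    obtain ⟨q₀', hq₀', hpq₀'⟩ := exists_isBiword_swap (List.pairwise_append.1 hp').1
    obtain ⟨k, k1, k2, k3⟩ := biTab_swap_concat hp hq hpq hq₀ hpq₀ rfl
    obtain ⟨k', k1', k2', k3'⟩ := biTab_swap_concat hp' hq' hpq' hq₀' hpq₀' rfl
    -- The recording tableau reveals the last letter of the second row and the column where the last
    -- insertion ended; the insertion can then be undone.
    obtain ⟨rfl, rfl, e⟩ := addAt_injective k2 k2' (by rw [← k3, h2, k3'])
    simp only [biTab, fsts, List.map_append, List.map_cons, List.map_nil, insTab_concat] at h1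
    obtain ⟨rfl, e'⟩ := ins_injective (isTab_insTab _).col (isTab_insTab _).col k1 k1' h1
    rw [ih (List.pairwise_append.1 hp).1 (List.pairwise_append.1 hp').1 hq₀ hq₀' hpq₀ hpq₀' e' e]

/-- The recording tableau is determined by the second row and the shapes. -/
theorem biTab_swap_eq {p : List (Letter m n × Letter m n)} :
    ∀ {p' q q' : List (Letter m n × Letter m n)}, IsBiword p → IsBiword p' → IsBiword q →
    IsBiword q' → q.Perm (p.map Prod.swap) → q'.Perm (p'.map Prod.swap) →
    p.map Prod.snd = p'.map Prod.snd →
    (∀ t, colLens (insTab ((fsts p).take t)) = colLens (insTab ((fsts p').take t))) →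
    biTab q = biTab q' := by
  induction p using List.reverseRecOn with
  | nil =>
    intro p' q q' _ _ _ _ hpq hpq' h1 _
    obtain rfl : p' = [] := by simpa using h1.symm
    simp only [List.map_nil, List.perm_nil] at hpq hpq'
    rw [hpq, hpq']
  | append_singleton p a ih =>
    intro p' q q' hp hp' hq hq' hpq hpq' h1 h2
    rcases List.eq_nil_or_concat p' with rfl | ⟨p', b, rfl⟩
    · simp at h1
    rw [List.concat_eq_append] at *
    obtain ⟨x, j⟩ := a
    obtain ⟨x', j'⟩ := b
    rw [List.map_append, List.map_append] at h1
    obtain ⟨hsnd, h3⟩ := List.append_inj' h1 rfl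
    simp only [List.map_cons, List.map_nil, List.cons.injEq, and_true] at h3
    subst h3
    replace h1 := hsnd
    have hl : p.length = p'.length := by simpa using congrArg List.length h1
    obtain ⟨q₀, hq₀, hpq₀⟩ := exists_isBiword_swap (List.pairwise_append.1 hp).1
    obtain ⟨q₀', hq₀', hpq₀'⟩ := exists_isBiword_swap (List.pairwise_append.1 hp').1
    have htake : ∀ t, colLens (insTab ((fsts p).take t)) = colLens (insTab ((fsts p').take t)) := by
      intro t
      have := h2 (min t p.length)
      simp only [fsts, List.map_append] at this
      rw [List.take_append_of_le_length (by simp), List.take_append_of_le_length (by simp [hl])]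
        at this
      rcases le_total t p.length with h | h
      · rwa [min_eq_left h] at this
      · rw [min_eq_right h] at this
        rw [List.take_of_length_le (by simp), List.take_of_length_le (by simp [hl])] at this
        rwa [List.take_of_length_le (by simpa using h),
          List.take_of_length_le (by simpa [← hl] using h)]
    have e := ih (List.pairwise_append.1 hp).1 (List.pairwise_append.1 hp').1 hq₀ hq₀' hpq₀ hpq₀'
      h1 htake
    obtain ⟨k, k1, k2, k3⟩ := biTab_swap_concat hp hq hpq hq₀ hpq₀ rfl
    obtain ⟨k', k1', k2', k3'⟩ := biTab_swap_concat hp' hq' hpq' hq₀' hpq₀' rfl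
    have e2 := htake p.length
    rw [List.take_of_length_le (by simp), List.take_of_length_le (by simp [hl])] at e2
    have e3 := h2 (p.length + 1)
    rw [List.take_of_length_le (by simp), List.take_of_length_le (by simp [hl])] at e3
    simp only [fsts, List.map_append, List.map_cons, List.map_nil, insTab_concat] at e3
    rw [colLens_ins k1, colLens_ins k1', ← e2] at e3
    rw [k3, k3', e, single_one_inj (add_left_cancel e3)]

/-! ### Surjectivity of the correspondence -/

theorem Adjacent.of_append_right {c d e : List (Letter m n)} (h : Adjacent c (d ++ e)) :
    Adjacent c d := fun s b hb => h s b (by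
  rw [List.getElem?_append_left (List.getElem?_eq_some_iff.1 hb).1]
  exact hb)

/-- The largest entry of a tableau can be removed. -/
theorem IsTab.exists_addAt {Q : Filling m n} (hQ : IsTab Q) {M : ℕ} (hM : ∀ k, M ≤ k → Q k = [])
    (hne : ∃ k, Q k ≠ []) : ∃ N k S, IsTab S ∧ IsLargest N k S ∧ Q = addAt k N S := by
  classical
  obtain ⟨N, hN, hmax⟩ : ∃ N, (∃ k, N ∈ Q k) ∧ ∀ a, (∃ k, a ∈ Q k) → a ≤ N := by
    have hs : (Finset.univ.filter fun a : Letter m n => ∃ k, a ∈ Q k).Nonempty := by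
      obtain ⟨k, hk⟩ := hne
      obtain ⟨a, ha⟩ := List.exists_mem_of_ne_nil _ hk
      exact ⟨a, by simpa using ⟨k, ha⟩⟩
    obtain ⟨N, h1, h2⟩ := Finset.exists_max_image _ id hs
    exact ⟨N, by simpa using h1, fun a ha => h2 a (by simpa using ha)⟩
  -- Odd letters repeat down a column and even ones along a row, so the removable copy of the
  -- maximum is in the leftmost column for odd `N` and in the rightmost one for even `N`.
  obtain ⟨k, hk, h1, h2⟩ : ∃ k, N ∈ Q k ∧ (IsOdd N → ∀ l < k, N ∉ Q l) ∧
      (¬ IsOdd N → ∀ l, k < l → N ∉ Q l) := by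
    by_cases ho : IsOdd N
    · exact ⟨Nat.find hN, Nat.find_spec hN, fun _ l hl => Nat.find_min hN hl, fun h => absurd ho h⟩
    · have hs : ((Finset.range M).filter fun k => N ∈ Q k).Nonempty := by
        obtain ⟨k, hk⟩ := hN
        refine ⟨k, Finset.mem_filter.2 ⟨Finset.mem_range.2 ?_, hk⟩⟩
        by_contra h
        rw [hM k (not_lt.1 h)] at hk
        simp at hk
      obtain ⟨k, h1, h2⟩ := Finset.exists_max_image _ id hs
      refine ⟨k, (Finset.mem_filter.1 h1).2, fun h => absurd h ho, fun _ l hl hN => ?_⟩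
      have : l < M := by
        by_contra h
        rw [hM l (not_lt.1 h)] at hN
        simp at hN
      exact absurd (h2 l (Finset.mem_filter.2 ⟨Finset.mem_range.2 this, hN⟩)) (not_le.2 hl)
  rcases List.eq_nil_or_concat (Q k) with h | ⟨c, z, hc⟩
  · rw [h] at hk; simp at hk
  rw [List.concat_eq_append] at hc
  have hcol := hQ.col k
  rw [hc] at hk hcol
  obtain ⟨hcol, -, hcz⟩ := List.pairwise_append.1 hcol
  have hz : z = N := by
    rcases List.mem_append.1 hk with h | h
    · exact le_antisymm (hmax z ⟨k, by simp [hc]⟩) (hcz N h z (by simp)).le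
    · exact (List.mem_singleton.1 h).symm
  subst hz
  have hS : ∀ l a, a ∈ Function.update Q k c l → a ∈ Q l := by
    intro l a ha
    by_cases hl : l = k
    · subst hl
      rw [Function.update_self] at ha
      simp [hc, ha]
    · rwa [Function.update_of_ne hl] at ha
  refine ⟨z, k, Function.update Q k c, ⟨fun l => ?_, fun l => ?_⟩, ⟨fun l a ha => ?_, ?_, ?_⟩, ?_⟩
  · by_cases hl : l = k
    · subst hl
      rwa [Function.update_self]
    · rw [Function.update_of_ne hl]; exact hQ.col l
  · have ha := hQ.adj l
    by_cases hl : l = k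
    · subst hl
      rw [Function.update_self, Function.update_of_ne (by omega)]
      rw [hc] at ha
      intro s b hb
      obtain ⟨a, e, hab⟩ := ha s b hb
      by_cases hs : s < c.length
      · rw [List.getElem?_append_left hs] at e
        exact ⟨a, e, hab⟩
      · exfalso
        rw [List.getElem?_append_right (not_lt.1 hs)] at e
        obtain rfl : a = z := by
          have := List.mem_of_getElem? e
          simpa using this
        have hbm := List.mem_of_getElem? hb
        rcases not_below_iff.1 hab with h | ⟨rfl, h⟩
        · exact absurd (hmax b ⟨_, hbm⟩) (not_le.2 h)
        · exact h2 h _ (by omega) hbm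
    · rw [Function.update_of_ne hl]
      by_cases hl' : l + 1 = k
      · subst hl'
        rw [Function.update_self]
        rw [hc] at ha
        exact ha.of_append_right
      · rwa [Function.update_of_ne hl']
  · exact hmax a ⟨l, hS l a ha⟩
  · exact fun ho l hl h => h1 ho l hl (hS l _ h)
  · intro ho l hl h
    rcases hl.lt_or_eq with hl | rfl
    · exact h2 ho l hl (hS l _ h)
    · rw [Function.update_self] at h
      exact ho (below_self.1 (hcz z h z (by simp)))
  · funext l
    by_cases hl : l = k
    · subst hl
      simp [addAt, hc]
    · simp [addAt, hl]

theorem isBiword_concat {p : List (Letter m n × Letter m n)} {a b : Letter m n × Letter m n}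
    (hp : IsBiword (p ++ [a])) (h : Prec a b) : IsBiword (p ++ [a] ++ [b]) := by
  refine List.pairwise_append.2 ⟨hp, by simp, fun c hc d hd => ?_⟩
  rw [List.mem_singleton.1 hd]
  rcases List.mem_append.1 hc with hc | hc
  · exact ((List.pairwise_append.1 hp).2.2 c hc a (by simp)).trans h
  · rwa [List.mem_singleton.1 hc]

/-- Any two tableaux of the same shape come from a biword. -/
theorem exists_biTab_eq {M : ℕ} (s : ℕ) : ∀ {T Q : Filling m n}, IsTab T → IsTab Q →
    colLens Q = colLens T → (∀ k, M ≤ k → Q k = []) → ∑ k ∈ Finset.range M, colLens Q k = s →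
    ∃ p q, IsBiword p ∧ IsBiword q ∧ q.Perm (p.map Prod.swap) ∧ biTab p = T ∧ biTab q = Q := by
  induction s with
  | zero =>
    intro T Q hT hQ hc hM hs
    have hQ0 : ∀ k, Q k = [] := by
      intro k
      by_cases hk : k < M
      · exact List.eq_nil_of_length_eq_zero
          (Finset.sum_eq_zero_iff.1 hs k (Finset.mem_range.2 hk))
      · exact hM k (not_lt.1 hk)
    refine ⟨[], [], List.Pairwise.nil, List.Pairwise.nil, by simp, ?_, ?_⟩
    · funext k
      exact (supp_of_colLens hc.symm (hQ0 k)).symm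
    · funext k
      exact (hQ0 k).symm
  | succ s ih =>
    intro T Q hT hQ hc hM hs
    have hne : ∃ k, Q k ≠ [] := by
      by_contra h
      push Not at h
      simp [colLens, h] at hs
    obtain ⟨j, k, S, hS, hL, rfl⟩ := hQ.exists_addAt hM hne
    rw [colLens_addAt] at hc hs
    -- The cell taken off `Q` leaves a tableau, so it is a corner of the common shape, and reverse
    -- insertion can start from it in `T`.
    have hcor : (T (k + 1)).length < (T k).length := by
      have h1 := congrFun hc k
      have h2 := congrFun hc (k + 1)
      have h3 := (hS.adj k).length_le
      simp only [colLens, Pi.add_apply, Pi.single_eq_same, Pi.single_apply] at h1 h2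
      rw [if_neg (by omega)] at h2
      omega
    obtain ⟨T₀, x, hT₀, hx, rfl⟩ := exists_ins_eq hT hcor
    rw [colLens_ins hx] at hc
    have hc₀ := add_right_cancel hc
    have hkM : k < M := by
      by_contra h
      have := hM k (not_lt.1 h)
      simp [addAt] at this
    obtain ⟨p₀, q₀, hp₀, hq₀, hpq₀, rfl, rfl⟩ := ih hT₀ hS hc₀
      (fun l hl => by
        have := hM l hl
        rwa [addAt, Function.update_of_ne (by omega)] at this)
      (by
        have h1 : ∑ l ∈ Finset.range M, (Pi.single k 1 : ℕ → ℕ) l = 1 := by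
          simp [Pi.single_apply, hkM]
        simp only [Pi.add_apply, Finset.sum_add_distrib, h1] at hs
        omega)
    have hp : IsBiword (p₀ ++ [(x, j)]) := by
      rcases List.eq_nil_or_concat p₀ with rfl | ⟨p₁, ⟨x₀, j₀⟩, rfl⟩
      · simp [IsBiword]
      rw [List.concat_eq_append] at *
      refine isBiword_concat hp₀ ?_
      obtain ⟨q₁, hq₁, hpq₁⟩ := exists_isBiword_swap (List.pairwise_append.1 hp₀).1
      obtain ⟨k₀, k1, k2, k3⟩ := biTab_swap_concat hp₀ hq₀ hpq₀ hq₁ hpq₁ rfl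
      have hmem : j₀ ∈ biTab q₀ k₀ := by
        rw [k3]; exact mem_addAt.2 (Or.inr ⟨rfl, rfl⟩)
      rcases (hL.le _ _ hmem).lt_or_eq with h | rfl
      · exact Or.inl h
      -- For equal letters in the second row the biword condition compares the first letters by
      -- `Below`, that is, the columns of two successive cells. Since `IsLargest` says that equal
      -- odd letters are added weakly to the left and equal even ones strictly to the right, the
      -- condition holds.
      · refine Or.inr ⟨rfl, ?_⟩
        have e : biTab (p₁ ++ [(x₀, j₀)]) = ins x₀ (biTab p₁) := by simp [biTab, fsts]
        rw [e] at hx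
        rw [below_iff_endsAt_le (isTab_insTab _).col k1 hx]
        by_cases ho : IsOdd j₀
        · simp only [ho, iff_true]
          by_contra h
          exact hL.odd ho k₀ (not_le.1 h) hmem
        · simp only [ho, iff_false]
          intro h
          exact hL.even ho k₀ h hmem
    obtain ⟨q, hq, hpq⟩ := exists_isBiword_swap hp
    refine ⟨p₀ ++ [(x, j)], q, hp, hq, hpq, by simp [biTab, fsts], ?_⟩
    obtain ⟨k', k1, k2, k3⟩ := biTab_swap_concat hp hq hpq hq₀ hpq₀ rfl
    rw [k3, endsAt_unique k1 hx]

/-- Every tableau comes from a symmetric matrix. -/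
theorem exists_symmetric_biTab_eq {M : ℕ} {T : Filling m n} (hT : IsTab T)
    (hM : ∀ k, M ≤ k → T k = []) : ∃ p, IsBiword p ∧ p.Perm (p.map Prod.swap) ∧ biTab p = T := by
  obtain ⟨p, q, hp, hq, hpq, h1, h2⟩ := exists_biTab_eq _ hT hT rfl hM rfl
  obtain rfl := biTab_injective hp hq hq hp hpq (perm_swap_symm hpq) (h1.trans h2.symm)
    (h2.trans h1.symm)
  exact ⟨p, hp, hpq, h1⟩

/-! ### The alternating sum of the column lengths -/

/-- The alternating sum of the first `N` values. -/
def altSum (N : ℕ) (h : ℕ → ℕ) : ℤ := ∑ k ∈ Finset.range N, (-1) ^ k * (h k : ℤ)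

theorem altSum_add_single {N : ℕ} {k : ℕ} (hk : k < N) (h : ℕ → ℕ) :
    altSum N (h + Pi.single k 1) = altSum N h + (-1) ^ k := by
  simp only [altSum, Pi.add_apply, Nat.cast_add, mul_add, Finset.sum_add_distrib]
  congr 1
  simp only [Pi.single_apply, Nat.cast_ite, Nat.cast_one, Nat.cast_zero, mul_ite, mul_one, mul_zero,
    Finset.sum_ite_eq', Finset.mem_range, hk, if_true]

theorem diagOdd_eq_sum (A : Mat m n) :
    diagOdd A = ∑ b, if IsOdd b then A b b else A b b % 2 := by
  rw [diagOdd, Finset.card_filter, Finset.sum_filter, ← Finset.sum_add_distrib]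
  refine Finset.sum_congr rfl fun b _ => ?_
  by_cases h : IsOdd b
  · simp [h]
  · simp only [h, not_false_eq_true, true_and, if_false, add_zero]
    split_ifs <;> omega

/-- For even `x` the hypothesis makes the diagonal entry rise from `0` to `1`; for odd `x` any rise
by one counts. -/
theorem diagOdd_concat {p : List (Letter m n × Letter m n)} {x : Letter m n}
    (h : ¬ IsOdd x → x ∉ fsts p) :
    diagOdd (matrixOf (p ++ [(x, x)])) = diagOdd (matrixOf p) + 1 := by
  rw [diagOdd_eq_sum, diagOdd_eq_sum, ← Finset.add_sum_erase _ _ (Finset.mem_univ x),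
    ← Finset.add_sum_erase (a := x) _ (fun b => if IsOdd b then matrixOf p b b else
      matrixOf p b b % 2) (Finset.mem_univ x), add_right_comm]
  congr 1
  · by_cases ho : IsOdd x
    · simp [ho, matrixOf]
    · have : p.count (x, x) = 0 := List.count_eq_zero.2 fun hm => h ho (List.mem_map.2 ⟨_, hm, rfl⟩)
      simp [ho, matrixOf, this]
  · refine Finset.sum_congr rfl fun b hb => ?_
    have hb : x ≠ b := (Finset.ne_of_mem_erase hb).symm
    simp [matrixOf, List.count_cons, hb]

/-- Two mirror images off the diagonal do not matter. If `x = j`, the letter is even and its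
diagonal entry changes by `2`, which keeps its parity. -/
theorem diagOdd_remove {p₁ p₂ : List (Letter m n × Letter m n)} {x j : Letter m n}
    (h : IsOdd j → x ≠ j) : diagOdd (matrixOf (p₁ ++ (j, x) :: p₂ ++ [(x, j)])) =
      diagOdd (matrixOf (p₁ ++ p₂)) := by
  rw [diagOdd_eq_sum, diagOdd_eq_sum]
  refine Finset.sum_congr rfl fun b _ => ?_
  simp only [matrixOf, Matrix.of_apply, List.count_append, List.count_cons, List.count_nil,
    beq_iff_eq, Prod.mk.injEq]
  by_cases hb : x = b ∧ j = b
  · obtain ⟨rfl, rfl⟩ := hb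
    have ho : ¬ IsOdd j := fun ho => h ho rfl
    simp only [ho, and_self, if_true, if_false]
    omega
  · have h1 : ¬ (j = b ∧ x = b) := fun h => hb h.symm
    simp [hb, h1]

/-- Induction on the biword, removing the last pair together with its mirror image. A pair that is
its own mirror image contributes a cell in column `0`; otherwise the two cells lie in adjacent
columns and cancel. -/
theorem altSum_colLens_biTab {p : List (Letter m n × Letter m n)} (hp : IsBiword p)
    (hs : p.Perm (p.map Prod.swap)) : ∀ N, p.length ≤ N →
    altSum N (colLens (biTab p)) = diagOdd (matrixOf p) := by
  induction hl : p.length using Nat.strong_induction_on generalizing p with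
  | _ l ih =>
    subst hl
    intro N hN
    by_cases hne : p = []
    · subst hne
      simp [diagOdd_eq_sum, altSum, matrixOf, colLens, biTab]
    rcases last_cases hp hp hs hne with ⟨p₀, q₀, x, j, e1, e2, h1, h2, h3, h4, h5⟩ |
      ⟨p₁, p₂, q₁, q₂, x, j, y, i, e1, e2, h1, h2, h3, h4, h5, h6, h7, h8, h9⟩
    · obtain ⟨f1, f2⟩ := List.append_inj' (e1.symm.trans e2) rfl
      simp only [List.cons.injEq, Prod.mk.injEq, and_true] at f2
      subst f1
      obtain ⟨rfl, -⟩ := f2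
      subst e1
      simp only [List.length_append, List.length_singleton] at hN
      have := ih p₀.length (by simp) (List.pairwise_append.1 hp).1 h5 rfl N (by omega)
      rw [diagOdd_concat h3]
      simp only [biTab, fsts, List.map_append, List.map_cons, List.map_nil] at this ⊢
      rw [insTab_concat_largest h1 h3, altSum_add_single (by omega), this]
      push_cast
      simp
    · obtain ⟨f1, f2⟩ := List.append_inj' (e1.symm.trans e2) rfl
      simp only [List.cons.injEq, Prod.mk.injEq, and_true] at f2
      obtain ⟨rfl, rfl⟩ := f2
      subst e1
      have hq := hp
      rw [e2] at hq
      have hpB : IsBiword (p₁ ++ p₂ ++ [(x, j)]) := by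
        rw [List.append_assoc, List.cons_append] at hp
        rw [List.append_assoc]
        exact isBiword_remove hp
      have i2 := colLens_biTab_swap hpB (List.pairwise_append.1 hq).1 h8
      rw [← f1] at i2
      have hqp : (p₁ ++ p₂).Perm (q₁ ++ q₂) := by
        have a1 : (p₁ ++ (j, x) :: p₂).Perm ((j, x) :: (p₁ ++ p₂)) := List.perm_middle
        have a2 : (q₁ ++ (j, x) :: q₂).Perm ((j, x) :: (q₁ ++ q₂)) := List.perm_middle
        rw [f1] at a1
        exact (List.perm_cons _).1 (a1.symm.trans a2)
      simp only [List.length_append, List.length_cons, List.length_nil] at hN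
      have := ih (p₁ ++ p₂).length (by simp) (isBiword_remove (List.pairwise_append.1 hp).1)
        (hqp.trans h9) rfl N (by simp; omega)
      rw [diagOdd_remove fun ho hx => h3 ho (by simp [hx])]
      obtain ⟨k, t, g1, g2, g3⟩ := insTab_growth (N := j) (x := x) (u := fsts p₁) (v := fsts p₂)
        (fun a ha => h1 a (by simp [ha])) h4
        (fun a ha => h1 a (by
          simp only [List.map_append, List.map_cons, List.map_nil, List.mem_append,
            List.mem_cons, List.not_mem_nil, or_false] at ha ⊢
          tauto))
        (fun ho => by simpa using h3 ho)
      have hb := insTab_supp (fsts p₁ ++ fsts p₂ ++ [x])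
      simp only [biTab, fsts, List.map_append, List.map_cons, List.map_nil] at i2 g1 g2 g3 this hb ⊢
      rw [g1, g2] at i2
      -- The biword is its own transpose, so the two cells exchanged by the transposition are in the
      -- same column, and the exceptional case of the local rule applies.
      obtain rfl := single_one_inj (add_left_cancel i2)
      have hkN : k + 1 < N := by
        have h0 := congrFun g2 k
        by_contra hk
        rw [colLens, hb k (by simp; omega)] at h0
        simp at h0
      rw [g3, if_pos rfl, altSum_add_single hkN, altSum_add_single (by omega), this, pow_succ]
      ring

end Correspondence

/-! ## The actions on matrices -/

section Matrices
variable {m n : ℕ}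

/-! ### Shapes and reading words -/

theorem readCols_ins_perm (N : ℕ) : ∀ (x : Letter m n) (T : Filling m n),
    (∀ k, N ≤ k → T k = []) → (readCols (N + 1) (ins x T)).Perm (readCols N T ++ [x]) := by
  induction N with
  | zero =>
    intro x T hs
    obtain rfl : T = fun _ => [] := funext fun k => hs k (Nat.zero_le _)
    rw [readCols_succ, readCols_zero, ins_zero]
    exact List.Perm.refl _
  | succ N ih =>
    intro x T hs
    rw [← consF_tailF T]
    have hs' : ∀ k, N ≤ k → tailF T k = [] := fun k hk => hs (k + 1) (by omega)
    generalize tailF T = R at hs'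
    rw [readCols_succ N (consF (T 0) R), tailF_consF, consF_zero, List.append_assoc]
    rcases column_cases x (T 0) with h' | ⟨l, y, r, e, h1, h2⟩
    · rw [ins_append h', readCols_succ, tailF_consF, consF_zero,
        readCols_eq_of_supp (Nat.le_succ N) hs']
    · rw [e, ins_bump h1 h2, readCols_succ, tailF_consF, consF_zero]
      refine ((ih y R hs').append_right _).trans ?_
      rw [List.append_assoc]
      refine List.Perm.append_left _ (List.perm_iff_count.2 fun a => ?_)
      simp only [List.count_append, List.count_cons, List.count_nil]
      omega

theorem tabWord_perm (w : List (Letter m n)) : (tabWord w).Perm w := by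
  induction w using List.reverseRecOn with
  | nil => exact List.Perm.refl _
  | append_singleton w x ih =>
    rw [tabWord_concat]
    exact (readCols_ins_perm _ x _ (insTab_supp w)).trans (ih.append_right _)

theorem length_readCols (N : ℕ) (T : Filling m n) :
    (readCols N T).length = ∑ k ∈ Finset.range N, colLens T k := by
  induction N with
  | zero => rfl
  | succ N ih =>
    rw [readCols_succ', List.length_append, ih, Finset.sum_range_succ, add_comm]
    rfl

theorem length_eq_of_colLens {w w' : List (Letter m n)}
    (h : colLens (insTab w) = colLens (insTab w')) : w.length = w'.length := by
  have key : ∀ (w : List (Letter m n)) N, w.length ≤ N →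
      ∑ k ∈ Finset.range N, colLens (insTab w) k = w.length := by
    intro w N hN
    rw [← length_readCols, readCols_eq_of_supp hN (insTab_supp w)]
    exact (tabWord_perm w).length_eq
  rw [← key w _ (le_max_left _ w'.length), h, key w' _ (le_max_right _ _)]

theorem tabWord_eq_of_insTab {w w' : List (Letter m n)} (h : insTab w = insTab w') :
    tabWord w = tabWord w' := by
  rw [tabWord, tabWord, length_eq_of_colLens (congrArg colLens h), h]

theorem insTab_eq_of_tabWord {w w' : List (Letter m n)}
    (hc : colLens (insTab w) = colLens (insTab w')) (h : tabWord w = tabWord w') :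
    insTab w = insTab w' := by
  rw [tabWord, tabWord, length_eq_of_colLens hc] at h
  exact readCols_injective (insTab_supp w') hc h

/-- Successive shapes reveal the terminal columns of the last two insertions, and
`below_iff_endsAt_le` turns their comparison into the relation between the letters. -/
theorem below_iff_of_shapes {u u' : List (Letter m n)} {a b a' b' : Letter m n}
    (h0 : colLens (insTab u) = colLens (insTab u'))
    (h1 : colLens (insTab (u ++ [a])) = colLens (insTab (u' ++ [a'])))
    (h2 : colLens (insTab (u ++ [a] ++ [b])) = colLens (insTab (u' ++ [a'] ++ [b']))) :
    Below a b ↔ Below a' b' := by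
  obtain ⟨k, -, hk⟩ := insTab_endsAt u a
  obtain ⟨k', -, hk'⟩ := insTab_endsAt u' a'
  obtain ⟨t, -, ht⟩ := insTab_endsAt (u ++ [a]) b
  obtain ⟨t', -, ht'⟩ := insTab_endsAt (u' ++ [a']) b'
  rw [insTab_concat, insTab_concat (u' ++ [a']), colLens_ins ht, colLens_ins ht', h1] at h2
  rw [insTab_concat, insTab_concat, colLens_ins hk, colLens_ins hk', h0] at h1
  rw [insTab_concat] at ht ht'
  rw [below_iff_endsAt_le (isTab_insTab u).col hk ht,
    below_iff_endsAt_le (isTab_insTab u').col hk' ht', single_one_inj (add_left_cancel h1),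
    single_one_inj (add_left_cancel h2)]

/-- The biword property depends only on the second row and the shapes. -/
theorem IsBiword.of_shapes {p : List (Letter m n × Letter m n)} :
    ∀ {p' : List (Letter m n × Letter m n)}, IsBiword p → p'.map Prod.snd = p.map Prod.snd →
    (∀ t, colLens (insTab ((fsts p').take t)) = colLens (insTab ((fsts p).take t))) →
    IsBiword p' := by
  induction p using List.reverseRecOn with
  | nil =>
    intro p' _ h _
    obtain rfl : p' = [] := by simpa using h
    exact List.Pairwise.nil
  | append_singleton p b ih =>
    intro p' hp h1 h2
    rcases List.eq_nil_or_concat p' with rfl | ⟨p', b', rfl⟩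
    · exact List.Pairwise.nil
    rw [List.concat_eq_append] at *
    have hl : p'.length = p.length := by simpa using congrArg List.length h1
    rw [List.map_append, List.map_append] at h1
    obtain ⟨h1', h3⟩ := List.append_inj' h1 rfl
    have hp₀ := (List.pairwise_append.1 hp).1
    have htake : ∀ t, colLens (insTab ((fsts p').take t)) = colLens (insTab ((fsts p).take t)) := by
      intro t
      have := h2 (min t p.length)
      simp only [fsts, List.map_append] at this
      rw [List.take_append_of_le_length (by simp [hl]), List.take_append_of_le_length (by simp)]
        at this
      rw [List.take_eq_take_min, List.take_eq_take_min (l := fsts p)]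
      simpa [hl] using this
    have hp' := ih hp₀ h1' htake
    rcases List.eq_nil_or_concat p' with rfl | ⟨p₁', a', rfl⟩
    · simp [IsBiword]
    rcases List.eq_nil_or_concat p with rfl | ⟨p₁, a, rfl⟩
    · simp at hl
    rw [List.concat_eq_append] at *
    rw [List.concat_eq_append] at *
    have hl' : p₁'.length = p₁.length := by simpa using hl
    refine isBiword_concat hp' ?_
    have hab : Prec a b := (List.pairwise_append.1 hp).2.2 a (by simp) b (by simp)
    have e0 := h2 p₁.length
    have e1 := h2 (p₁.length + 1)
    have e2 := h2 (p₁.length + 2)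
    simp only [fsts, List.map_append, List.map_cons, List.map_nil, List.append_assoc] at e0 e1 e2
    rw [List.take_left' (by simp [hl']), List.take_left' (by simp)] at e0
    rw [← List.append_assoc, List.take_left' (by simp [hl']), ← List.append_assoc,
      List.take_left' (by simp)] at e1
    rw [List.take_of_length_le (by simp [hl']), List.take_of_length_le (by simp),
      ← List.append_assoc, ← List.append_assoc] at e2
    have hbel := below_iff_of_shapes e0 e1 e2
    simp only [List.map_append, List.map_cons, List.map_nil] at h1' h3
    have f1 := (List.append_inj' h1' rfl).2
    simp only [List.cons.injEq, and_true] at f1 h3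
    unfold Prec
    rw [f1, h3, hbel]
    exact hab

/-- The insertion tableau of a matrix. -/
def matTab (A : Mat m n) : Filling m n := insTab (rowWord A)

/-- The reading word of the insertion tableau of a matrix. -/
def matWord (A : Mat m n) : List (Letter m n) := tabWord (rowWord A)

theorem matTab_injective {A B : Mat m n} (hA : A ∈ superMatrices m n)
    (hB : B ∈ superMatrices m n) (h : matTab A = matTab B)
    (h' : matTab A.transpose = matTab B.transpose) : A = B := by
  rw [← matrixOf_biword A, ← matrixOf_biword B]
  congr 1
  exact biTab_injective (isBiword_biword hA) (isBiword_biword hB)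
    (isBiword_biword (transpose_mem hA)) (isBiword_biword (transpose_mem hB))
    (biword_transpose_perm A) (biword_transpose_perm B) h h'

/-! ### The row action, the column action and the diagonal action -/

variable {x : List (Letter m n) → Option (List (Letter m n))}

/-- The second row and all shapes of prefixes are kept. The first conclusion follows because these
data decide whether a list is a biword, the last one because they determine the recording tableau.
-/
theorem rowAct_eq_some (hx : IsPlactic x) {A A' : Mat m n} (hA : A ∈ superMatrices m n)
    (h : rowAct x A = some A') : A' ∈ superMatrices m n ∧ x (rowWord A) = some (rowWord A') ∧
      matTab A'.transpose = matTab A.transpose := by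
  obtain ⟨w, hw, rfl⟩ := Option.map_eq_some_iff.1 h
  have hb := isBiword_biword hA
  have hlen : w.length = ((biword A).map Prod.snd).length := by
    rw [hx.length _ _ hw]
    simp [rowWord]
  have h1 : (w.zip ((biword A).map Prod.snd)).map Prod.fst = w := List.map_fst_zip hlen.le
  have h2 : (w.zip ((biword A).map Prod.snd)).map Prod.snd = (biword A).map Prod.snd :=
    List.map_snd_zip hlen.ge
  have hsh : ∀ t, colLens (insTab ((fsts (w.zip ((biword A).map Prod.snd))).take t)) =
      colLens (insTab ((fsts (biword A)).take t)) := by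
    intro t
    rw [fsts, h1]
    exact hx.take _ _ hw t
  have hb' := hb.of_shapes h2 hsh
  have hM := matrixOf_mem hb'
  have hbi := biword_matrixOf hb'
  refine ⟨hM, ?_, ?_⟩
  · rw [hw]
    simp only [rowWord, hbi, h1]
  · refine biTab_swap_eq hb' hb (isBiword_biword (transpose_mem hM))
      (isBiword_biword (transpose_mem hA)) ?_ (biword_transpose_perm A) h2 hsh
    have := biword_transpose_perm (matrixOf (w.zip ((biword A).map Prod.snd)))
    rwa [hbi] at this

theorem rowAct_eq_none {A : Mat m n} : rowAct x A = none ↔ x (rowWord A) = none :=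
  Option.map_eq_none_iff

theorem matrixOf_swap (p : List (Letter m n × Letter m n)) :
    matrixOf (p.map Prod.swap) = (matrixOf p).transpose := by
  ext b b'
  simp only [matrixOf, Matrix.of_apply, Matrix.transpose_apply]
  rw [show (b, b') = Prod.swap (b', b) from rfl,
    List.count_map_of_injective _ _ Prod.swap_injective]

theorem colAct_eq (A : Mat m n) : colAct x A = (rowAct x A.transpose).map Matrix.transpose := by
  unfold colAct rowAct
  rw [Option.map_map]
  congr 1
  funext w
  simp only [Function.comp]
  rw [← matrixOf_swap, List.zip_swap]

/-- The diagonal action is the action of the operator on insertion tableaux. -/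
theorem diagAct_eq_some (hx : IsPlactic x) {A C : Mat m n} (hA : A ∈ symMatrices m n)
    (h : diagAct x A = some C) : C ∈ symMatrices m n ∧ x (matWord A) = some (matWord C) ∧
      colLens (matTab C) = colLens (matTab A) := by
  obtain ⟨hM, hs⟩ := hA
  obtain ⟨B, hB, hC⟩ := Option.bind_eq_some_iff.1 h
  rw [colAct_eq, ← hs] at hB
  obtain ⟨B', hB', rfl⟩ := Option.map_eq_some_iff.1 hB
  -- Writing P and Q for the insertion and the recording tableau: `A` has P = Q; `B'` has the
  -- tableau `x` P and the old Q; its transpose has them exchanged; and `C` has `x` P in both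
  -- places, hence is symmetric.
  obtain ⟨b1, b2, b3⟩ := rowAct_eq_some hx hM hB'
  obtain ⟨c1, c2, c3⟩ := rowAct_eq_some hx (transpose_mem b1) hC
  rw [Matrix.transpose_transpose] at c3
  rw [← hs] at b3
  have e1 := hx.some _ _ b2
  have e2 := hx.some _ _ c2
  rw [tabWord_eq_of_insTab (w := rowWord B'.transpose) (w' := rowWord A) b3, e1] at e2
  have s1 := hx.take _ _ b2 (rowWord A).length
  rw [List.take_of_length_le (hx.length _ _ b2).le, List.take_of_length_le le_rfl] at s1
  have s2 := hx.take _ _ c2 (rowWord B'.transpose).length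
  rw [List.take_of_length_le (hx.length _ _ c2).le, List.take_of_length_le le_rfl] at s2
  have s3 : colLens (matTab B'.transpose) = colLens (matTab A) := congrArg colLens b3
  have s4 : colLens (insTab (rowWord B')) = colLens (insTab (rowWord C)) :=
    s1.trans (s2.trans s3).symm
  have e3 : matTab B' = matTab C := insTab_eq_of_tabWord s4 (Option.some.inj e2)
  refine ⟨⟨c1, matTab_injective c1 (transpose_mem c1) (e3.symm.trans c3.symm) ?_⟩, ?_, s2.trans s3⟩
  · rw [Matrix.transpose_transpose, c3, e3]
  · rw [matWord, e1, Option.some.inj e2]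
    rfl

/-- The second of the two actions meets the same insertion tableau as the first, so it cannot vanish
when the first does not. -/
theorem diagAct_eq_none (hx : IsPlactic x) {A : Mat m n} (hA : A ∈ symMatrices m n) :
    diagAct x A = none ↔ x (matWord A) = none := by
  obtain ⟨hM, hs⟩ := hA
  rw [matWord, ← hx.none]
  constructor
  · intro h
    by_contra hne
    obtain ⟨B, hB⟩ := Option.ne_none_iff_exists'.1 (mt rowAct_eq_none.1 hne)
    have hc : colAct x A = some B.transpose := by
      rw [colAct_eq, ← hs, hB]; rfl
    rw [diagAct, hc, Option.bind_some, rowAct_eq_none, hx.none] at h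
    obtain ⟨b1, b2, b3⟩ := rowAct_eq_some hx hM hB
    rw [← hs] at b3
    rw [tabWord_eq_of_insTab (w := rowWord B.transpose) (w' := rowWord A) b3, ← hx.none] at h
    exact hne h
  · intro h
    rw [diagAct, colAct_eq, ← hs, rowAct_eq_none.2 h]
    rfl

theorem matWord_injective {A B : Mat m n} (hA : A ∈ symMatrices m n) (hB : B ∈ symMatrices m n)
    (hc : colLens (matTab A) = colLens (matTab B)) (h : matWord A = matWord B) : A = B := by
  have e : matTab A = matTab B := insTab_eq_of_tabWord hc h
  exact matTab_injective hA.1 hB.1 e (by rw [← hA.2, ← hB.2, e])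

theorem diagAct_eq_some_iff (hx : IsPlactic x) {A C : Mat m n} (hA : A ∈ symMatrices m n)
    (hC : C ∈ symMatrices m n) : diagAct x A = some C ↔
      x (matWord A) = some (matWord C) ∧ colLens (matTab C) = colLens (matTab A) := by
  refine ⟨fun h => (diagAct_eq_some hx hA h).2, fun ⟨h1, h2⟩ => ?_⟩
  have hne : diagAct x A ≠ none := fun h => by
    rw [diagAct_eq_none hx hA, h1] at h
    simp at h
  obtain ⟨C', hC'⟩ := Option.ne_none_iff_exists'.1 hne
  obtain ⟨k1, k2, k3⟩ := diagAct_eq_some hx hA hC'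
  rw [hC', matWord_injective k1 hC (k3.trans h2.symm) (Option.some.inj (k2.symm.trans h1))]

theorem wordWt_matWord (A : Mat m n) : wordWt (matWord A) = wordWt (rowWord A) :=
  wordWt_perm (tabWord_perm _)

/-! ### The crystal structure -/

theorem iterate_bind_none {X : Type*} (x : X → Option X) (k : ℕ) :
    (fun y : Option X => y.bind x)^[k] none = none := by
  induction k with
  | zero => rfl
  | succ k ih => rw [Function.iterate_succ_apply]; exact ih

/-- A function that drops by one at each step and vanishes exactly where the operator does counts
the possible steps: the set of admissible exponents is the interval up to `d A`. The set `S` is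
needed because the diagonal action is controlled on symmetric matrices only. -/
theorem stringLength_eq {X : Type*} {x : X → Option X} {S : Set X} {d : X → ℕ}
    (h0 : ∀ A ∈ S, x A = none ↔ d A = 0) (h1 : ∀ A ∈ S, ∀ B, x A = some B → B ∈ S ∧ d A = d B + 1)
    {A : X} (hA : A ∈ S) : stringLength x A = d A := by
  have key : ∀ k, ∀ A ∈ S, (fun y : Option X => y.bind x)^[k] (some A) ≠ none ↔ k ≤ d A := by
    intro k
    induction k with
    | zero => intro A _; simp
    | succ k ih =>
      intro A hA
      rw [Function.iterate_succ_apply, Option.bind_some]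
      rcases hB : x A with _ | B
      · rw [iterate_bind_none, (h0 A hA).1 hB]
        simp
      · obtain ⟨h2, h3⟩ := h1 A hA B hB
        rw [ih B h2, h3]
        omega
  have : {k : ℕ | (fun y : Option X => y.bind x)^[k] (some A) ≠ none} = Set.Iic (d A) :=
    Set.ext fun k => key k A hA
  rw [stringLength, this, csSup_Iic]

theorem stringLength_diagAct_wordF (i : Index m n) {A : Mat m n} (hA : A ∈ symMatrices m n) :
    stringLength (diagAct (wordF i)) A = wordPhi i (matWord A) := by
  refine stringLength_eq (d := fun A => wordPhi i (matWord A)) (fun A hA => ?_)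
    (fun A hA B hB => ?_) hA
  · rw [diagAct_eq_none (isPlactic_wordF i) hA, wordF_eq_none]
  · obtain ⟨h1, h2, -⟩ := diagAct_eq_some (isPlactic_wordF i) hA hB
    refine ⟨h1, ?_⟩
    have := ((isCrystal_wordCrystal m n).of_f i _ _ h2).2.1
    simp only [wordCrystal] at this
    omega

theorem stringLength_diagAct_wordE (i : Index m n) {A : Mat m n} (hA : A ∈ symMatrices m n) :
    stringLength (diagAct (wordE i)) A = wordEps i (matWord A) := by
  refine stringLength_eq (d := fun A => wordEps i (matWord A)) (fun A hA => ?_)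
    (fun A hA B hB => ?_) hA
  · rw [diagAct_eq_none (isPlactic_wordE i) hA, wordE_eq_none]
  · obtain ⟨h1, h2, -⟩ := diagAct_eq_some (isPlactic_wordE i) hA hB
    refine ⟨h1, ?_⟩
    have := ((isCrystal_wordCrystal m n).of_e i _ _ h2).1
    simp only [wordCrystal] at this
    omega

theorem restrictOption_eq_some {B : Type*} {S : Set B} {o : Option B} {b : S} :
    restrictOption S o = some b ↔ o = some b.val := by
  unfold restrictOption
  rcases o with _ | a
  · simp
  · by_cases h : a ∈ S
    · simp [h, Subtype.ext_iff]
    · simp only [Option.bind_some, h, dif_neg, not_false_eq_true, reduceCtorEq, Option.some.injEq,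
        false_iff]
      rintro rfl
      exact h b.2

/-- Stability plays no role here: the axioms on arrows concern only arrows with both ends in `S`,
and the others are pointwise. -/
theorem IsCrystal.restrict {B : Type*} {C : CrystalData m n B} (hC : IsCrystal C) (S : Set B) :
    IsCrystal (C.restrict S) where
  phi_sub_eps i b := hC.phi_sub_eps i b
  coroot_nonneg i b := hC.coroot_nonneg i b
  phi_add_eps i b := hC.phi_add_eps i b
  of_e i b b' h := hC.of_e i b b' (restrictOption_eq_some.1 h)
  of_f i b b' h := hC.of_f i b b' (restrictOption_eq_some.1 h)
  f_iff_e i b b' := by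
    change restrictOption S _ = _ ↔ restrictOption S _ = _
    rw [restrictOption_eq_some, restrictOption_eq_some]
    exact hC.f_iff_e i b b'

theorem isStable_symMatrices : IsStable (diagData m n) (symMatrices m n) := by
  rintro i A hA B (h | h)
  · exact (diagAct_eq_some (isPlactic_wordE i) hA h).1
  · exact (diagAct_eq_some (isPlactic_wordF i) hA h).1

/-- The arrows between matrices are those of the word crystal between reading words of equal shape.
With the analogous facts for `wt`, `ε_i` and `φ_i`, all axioms are inherited from words. -/
theorem symCrystal_e_eq_some (i : Index m n) {A B : symMatrices m n} :
    (symCrystal m n).e i A = some B ↔ wordE i (matWord A.val) = some (matWord B.val) ∧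
      colLens (matTab B.val) = colLens (matTab A.val) :=
  restrictOption_eq_some.trans (diagAct_eq_some_iff (isPlactic_wordE i) A.2 B.2)

theorem symCrystal_f_eq_some (i : Index m n) {A B : symMatrices m n} :
    (symCrystal m n).f i A = some B ↔ wordF i (matWord A.val) = some (matWord B.val) ∧
      colLens (matTab B.val) = colLens (matTab A.val) :=
  restrictOption_eq_some.trans (diagAct_eq_some_iff (isPlactic_wordF i) A.2 B.2)

theorem symCrystal_wt (A : symMatrices m n) :
    (symCrystal m n).wt A = (wordCrystal m n).wt (matWord A.val) := (wordWt_matWord A.val).symm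

theorem symCrystal_eps (i : Index m n) (A : symMatrices m n) :
    (symCrystal m n).eps i A = (wordCrystal m n).eps i (matWord A.val) :=
  stringLength_diagAct_wordE i A.2

theorem symCrystal_phi (i : Index m n) (A : symMatrices m n) :
    (symCrystal m n).phi i A = (wordCrystal m n).phi i (matWord A.val) :=
  stringLength_diagAct_wordF i A.2

theorem isCrystal_symCrystal : IsCrystal (symCrystal m n) := by
  have hW := isCrystal_wordCrystal m n
  refine ⟨fun i b h => ?_, fun i b h => ?_, fun i b h => ?_, fun i b b' h => ?_,
    fun i b b' h => ?_, fun i b b' => ?_⟩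
  · rw [symCrystal_wt, symCrystal_eps, symCrystal_phi]
    exact hW.phi_sub_eps i _ h
  · rw [symCrystal_wt]
    exact hW.coroot_nonneg i _ h
  · rw [symCrystal_wt, symCrystal_eps, symCrystal_phi]
    exact hW.phi_add_eps i _ h
  · rw [symCrystal_wt, symCrystal_wt, symCrystal_eps, symCrystal_eps, symCrystal_phi,
      symCrystal_phi]
    exact hW.of_e i _ _ ((symCrystal_e_eq_some i).1 h).1
  · rw [symCrystal_wt, symCrystal_wt, symCrystal_eps, symCrystal_eps, symCrystal_phi,
      symCrystal_phi]
    exact hW.of_f i _ _ ((symCrystal_f_eq_some i).1 h).1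
  · rw [symCrystal_e_eq_some, symCrystal_f_eq_some, wordF_iff_wordE, eq_comm (a := colLens _)]

theorem altSum_colLens_matTab {A : Mat m n} (hA : A ∈ symMatrices m n) {N : ℕ}
    (hN : (rowWord A).length ≤ N) : altSum N (colLens (matTab A)) = diagOdd A := by
  have hs : (biword A).Perm ((biword A).map Prod.swap) := by
    have := biword_transpose_perm A
    rwa [← hA.2] at this
  have := altSum_colLens_biTab (isBiword_biword hA.1) hs N (by simpa [rowWord] using hN)
  rwa [matrixOf_biword] at this

theorem diagOdd_eq_of_colLens {A B : Mat m n} (hA : A ∈ symMatrices m n)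
    (hB : B ∈ symMatrices m n) (h : colLens (matTab A) = colLens (matTab B)) :
    diagOdd A = diagOdd B := by
  have h1 := altSum_colLens_matTab hA le_rfl
  have h2 := altSum_colLens_matTab hB (length_eq_of_colLens h).ge
  rw [h] at h1
  exact_mod_cast h1.symm.trans h2

theorem isStable_symLevel (k : ℕ) : IsStable (symCrystal m n) (symLevel m n k) := by
  rintro i A hA B (h | h)
  · exact (diagOdd_eq_of_colLens B.2 A.2 ((symCrystal_e_eq_some i).1 h).2).trans hA
  · exact (diagOdd_eq_of_colLens B.2 A.2 ((symCrystal_f_eq_some i).1 h).2).trans hA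

end Matrices

/-! ## Hook tableaux as fillings -/

section Shapes
variable {m n : ℕ}

theorem IsTab.colLens_antitone {T : Filling m n} (hT : IsTab T) : Antitone (colLens T) :=
  antitone_nat_of_succ_le fun k => (hT.adj k).length_le

/-- Entries decrease weakly to the left, in the sense of the row condition. -/
theorem IsTab.not_below_of_lt {T : Filling m n} (hT : IsTab T) {r c c' : ℕ} (hc : c < c')
    (h : r < (T c).length) (h' : r < (T c').length) : ¬ Below (T c')[r] (T c)[r] := by
  induction c', hc using Nat.le_induction with
  | base =>
    obtain ⟨a, ha, hab⟩ := hT.adj c r _ (List.getElem?_eq_getElem h')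
    obtain ⟨_, rfl⟩ := List.getElem?_eq_some_iff.1 ha
    exact hab
  | succ c' hc' ih =>
    obtain ⟨a, ha, hab⟩ := hT.adj c' r _ (List.getElem?_eq_getElem h')
    obtain ⟨h'', rfl⟩ := List.getElem?_eq_some_iff.1 ha
    exact not_below_trans hab (ih h'')

theorem IsTab.below_of_lt {T : Filling m n} (hT : IsTab T) {r r' c : ℕ} (hr : r < r')
    (h : r < (T c).length) (h' : r' < (T c).length) : Below (T c)[r] (T c)[r'] :=
  List.pairwise_iff_getElem.1 (hT.col c) r r' h h' hr

/-- The hook tableau of a filling. -/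
def hookTableau {T : Filling m n} (hT : IsTab T) {μ : YoungDiagram} (hμ : colLens T = μ.colLen) :
    HookTableau m n μ :=
  have hlt : ∀ {r c}, (r, c) ∈ μ → r < (T c).length := fun h =>
    (YoungDiagram.mem_iff_lt_colLen.1 h).trans_eq (congrFun hμ _).symm
  { entry := fun r c h => (T c)[r]'(hlt h)
    row_weak := fun _ _ _ h h' hc => le_of_not_below (hT.not_below_of_lt hc (hlt h) (hlt h'))
    col_weak := fun _ _ _ h h' hr => (hT.below_of_lt hr (hlt h) (hlt h')).le
    row_strict := fun _ _ _ h h' hc _ ho => by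
      rcases not_below_iff.1 (hT.not_below_of_lt hc (hlt h) (hlt h')) with h1 | ⟨-, h1⟩
      · exact h1
      · exact absurd ho h1
    col_strict := fun _ _ _ h h' hr ho _ => by
      rcases hT.below_of_lt hr (hlt h) (hlt h') with h1 | ⟨-, h1⟩
      · exact h1
      · exact absurd h1 ho }

/-- In `HookTableau.word` the list of column indices in `Fin N` is coerced to a list of natural
numbers through the list monad; this rewrites the coerced list as a range. -/
theorem coe_finRange_reverse (N : ℕ) :
    (do let c ← (List.finRange N).reverse; pure (c : ℕ)) = (List.range N).reverse := by
  rw [← List.map_coe_finRange_eq_range, ← List.map_reverse, bind_pure_comp, List.map_eq_map]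

theorem word_hookTableau {T : Filling m n} (hT : IsTab T) {μ : YoungDiagram}
    (hμ : colLens T = μ.colLen) : (hookTableau hT hμ).word = readCols (μ.rowLen 0) T := by
  rw [readCols, HookTableau.word, coe_finRange_reverse]
  congr 1
  funext c
  refine List.ext_getElem ?_ fun r h h' => ?_
  · rw [List.length_ofFn, ← congrFun hμ]; rfl
  · rw [List.getElem_ofFn]; rfl

/-- The filling of a hook tableau. -/
def HookTableau.filling {μ : YoungDiagram} (H : HookTableau m n μ) : Filling m n := fun c =>
  List.ofFn fun r : Fin (μ.colLen c) => H.entry r c (YoungDiagram.mem_iff_lt_colLen.2 r.isLt)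

theorem HookTableau.colLens_filling {μ : YoungDiagram} (H : HookTableau m n μ) :
    colLens H.filling = μ.colLen := by
  funext c
  simp [colLens, filling]

theorem HookTableau.isTab_filling {μ : YoungDiagram} (H : HookTableau m n μ) :
    IsTab H.filling := by
  refine ⟨fun c => ?_, fun c s b hb => ?_⟩
  · refine List.pairwise_iff_getElem.2 fun r r' h h' hr => ?_
    simp only [filling, List.getElem_ofFn]
    simp only [filling, List.length_ofFn] at h h'
    have h1 : (r, c) ∈ μ := YoungDiagram.mem_iff_lt_colLen.2 h
    have h2 : (r', c) ∈ μ := YoungDiagram.mem_iff_lt_colLen.2 h'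
    rcases (H.col_weak r r' c h1 h2 hr).lt_or_eq with hlt | heq
    · exact Or.inl hlt
    · refine Or.inr ⟨heq, ?_⟩
      by_contra ho
      exact (H.col_strict r r' c h1 h2 hr ho (by rw [← heq]; exact ho)).ne heq
  · obtain ⟨hs, rfl⟩ := List.getElem?_eq_some_iff.1 hb
    simp only [filling, List.length_ofFn] at hs
    have h2 : (s, c + 1) ∈ μ := YoungDiagram.mem_iff_lt_colLen.2 hs
    have h1 : (s, c) ∈ μ := μ.up_left_mem le_rfl (Nat.le_succ c) h2
    have hs' : s < (H.filling c).length := by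
      simpa [filling] using YoungDiagram.mem_iff_lt_colLen.1 h1
    refine ⟨(H.filling c)[s], List.getElem?_eq_getElem hs', not_below_iff.2 ?_⟩
    simp only [filling, List.getElem_ofFn]
    rcases (H.row_weak s c (c + 1) h1 h2 (Nat.lt_succ_self c)).lt_or_eq with hlt | heq
    · exact Or.inl hlt
    · refine Or.inr ⟨heq.symm, fun ho => ?_⟩
      exact (H.row_strict s c (c + 1) h1 h2 (Nat.lt_succ_self c) (by rw [heq]; exact ho) ho).ne heq

theorem mem_tableauWords {μ : YoungDiagram} {w : List (Letter m n)} :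
    w ∈ tableauWords m n μ ↔
      ∃ T, IsTab T ∧ colLens T = μ.colLen ∧ w = readCols (μ.rowLen 0) T := by
  constructor
  · rintro ⟨H, rfl⟩
    exact ⟨H.filling, H.isTab_filling, H.colLens_filling,
      congrArg (List.flatMap H.filling) (coe_finRange_reverse _)⟩
  · rintro ⟨T, hT, hμ, rfl⟩
    exact ⟨hookTableau hT hμ, word_hookTableau hT hμ⟩

theorem colLen_eq_zero {μ : YoungDiagram} {c : ℕ} (h : μ.rowLen 0 ≤ c) : μ.colLen c = 0 := by
  by_contra hne
  have : (0, c) ∈ μ := YoungDiagram.mem_iff_lt_colLen.2 (Nat.pos_of_ne_zero hne)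
  exact absurd (YoungDiagram.mem_iff_lt_rowLen.1 this) (not_lt.2 h)

theorem supp_of_colLens_eq {μ : YoungDiagram} {T : Filling m n} (hμ : colLens T = μ.colLen) {c : ℕ}
    (h : μ.rowLen 0 ≤ c) : T c = [] :=
  List.eq_nil_of_length_eq_zero ((congrFun hμ c).trans (colLen_eq_zero h))

theorem youngDiagram_ext {μ ν : YoungDiagram} (h : μ.colLen = ν.colLen) : μ = ν := by
  ext ⟨r, c⟩
  simp only [YoungDiagram.mem_cells]
  rw [YoungDiagram.mem_iff_lt_colLen, YoungDiagram.mem_iff_lt_colLen, h]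

/-- The Young diagram with given column lengths. -/
def diagramOf (L : ℕ → ℕ) (M : ℕ) (hL : Antitone L) : YoungDiagram where
  cells := (Finset.range (L 0) ×ˢ Finset.range M).filter fun c => c.1 < L c.2
  isLowerSet := by
    rintro ⟨r, c⟩ ⟨r', c'⟩ ⟨h1, h2⟩ h
    simp only [Finset.coe_filter, Finset.mem_product, Finset.mem_range, Set.mem_ofPred_eq] at *
    have := hL h2
    omega

theorem colLen_diagramOf {L : ℕ → ℕ} {M : ℕ} (hL : Antitone L) (hM : ∀ k, M ≤ k → L k = 0) :
    (diagramOf L M hL).colLen = L := by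
  funext c
  refine eq_of_forall_lt_iff fun r => ?_
  rw [← YoungDiagram.mem_iff_lt_colLen, ← YoungDiagram.mem_cells]
  simp only [diagramOf, Finset.mem_filter, Finset.mem_product, Finset.mem_range]
  refine ⟨fun h => h.2, fun h => ⟨⟨h.trans_le (hL (Nat.zero_le c)), ?_⟩, h⟩⟩
  by_contra hc
  rw [hM c (not_lt.1 hc)] at h
  omega

/-- The shape of a tableau is a hook partition. -/
theorem IsTab.isHook {T : Filling m n} (hT : IsTab T) {μ : YoungDiagram}
    (hμ : colLens T = μ.colLen) : IsHook m n μ := by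
  by_contra hlt
  have hmem : (m, n) ∈ μ := YoungDiagram.mem_iff_lt_rowLen.2 (not_le.1 hlt)
  have hlen : ∀ c ≤ n, m < (T c).length := by
    intro c hc
    exact (YoungDiagram.mem_iff_lt_colLen.1 (μ.up_left_mem le_rfl hc hmem)).trans_eq
      (congrFun hμ c).symm
  -- Suppose the cell in row `m` and column `n` is present. Even entries increase strictly down the
  -- first column and there are `m` even letters, so row `m` starts with an odd letter. Odd entries
  -- increase strictly along that row, so its entry in column `n` would be beyond the last letter.
  have h0 : ∀ r (hr : r ≤ m), r ≤ ((T 0)[r]'(hr.trans_lt (hlen 0 (Nat.zero_le n)))).val := by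
    intro r
    induction r with
    | zero => intro _; exact Nat.zero_le _
    | succ r ih =>
      intro hr
      have h1 := ih (by omega)
      have hl := hlen 0 (Nat.zero_le n)
      rcases hT.below_of_lt (r := r) (r' := r + 1) (by omega) (by omega) (hr.trans_lt hl) with h | ⟨h, h'⟩
      · have := Fin.lt_def.1 h
        omega
      · rw [← h]
        exact hr.trans h'
  have h1 : ∀ c (hc : c ≤ n), m + c ≤ ((T c)[m]'(hlen c hc)).val := by
    intro c
    induction c with
    | zero => intro _; exact h0 m le_rfl
    | succ c ih =>
      intro hc
      have h2 := ih (by omega)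
      rcases not_below_iff.1 (hT.not_below_of_lt (c := c) (c' := c + 1) (by omega)
        (hlen c (by omega)) (hlen _ hc)) with h | ⟨h, h'⟩
      · have := Fin.lt_def.1 h
        omega
      · rw [h] at h'
        exact absurd (show m ≤ _ by omega) h'
  have := h1 n le_rfl
  have := ((T n)[m]'(hlen n le_rfl)).isLt
  omega

theorem sum_neg_one_pow (N : ℕ) : ∑ k ∈ Finset.range N, (-1 : ℤ) ^ k = (N % 2 : ℕ) := by
  induction N with
  | zero => rfl
  | succ N ih =>
    rw [Finset.sum_range_succ, ih]
    rcases Nat.even_or_odd N with h | h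
    · rw [h.neg_one_pow]
      have := Nat.even_iff.1 h
      omega
    · rw [h.neg_one_pow]
      have := Nat.odd_iff.1 h
      omega

/-- Give the cells of column `c` the sign `(-1)^c` and sum by rows: a row contributes the parity of
its length. -/
theorem altSum_colLen {μ : YoungDiagram} {N : ℕ} (hN : μ.rowLen 0 ≤ N) :
    altSum N μ.colLen = oddParts μ := by
  have h1 : ∀ c, (μ.colLen c : ℤ) =
      ∑ r ∈ Finset.range (μ.colLen 0), if c < μ.rowLen r then 1 else 0 := by
    intro c
    rw [Finset.sum_boole]
    congr 1
    have : (Finset.range (μ.colLen 0)).filter (fun r => c < μ.rowLen r) =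
        Finset.range (μ.colLen c) := by
      ext r
      rw [Finset.mem_filter, Finset.mem_range, Finset.mem_range, ← YoungDiagram.mem_iff_lt_rowLen,
        YoungDiagram.mem_iff_lt_colLen]
      exact ⟨fun h => h.2, fun h => ⟨h.trans_le (μ.colLen_anti 0 c (Nat.zero_le c)), h⟩⟩
    rw [this, Finset.card_range]
  have h2 : ∀ r, ∑ c ∈ Finset.range N, (-1 : ℤ) ^ c * (if c < μ.rowLen r then 1 else 0) =
      (μ.rowLen r % 2 : ℕ) := by
    intro r
    rw [← sum_neg_one_pow]
    simp only [mul_ite, mul_one, mul_zero]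
    rw [← Finset.sum_filter]
    congr 1
    ext c
    have := μ.rowLen_anti 0 r (Nat.zero_le r)
    simp only [Finset.mem_filter, Finset.mem_range]
    omega
  have h3 : oddParts μ = ∑ r ∈ Finset.range (μ.colLen 0), μ.rowLen r % 2 := by
    rw [oddParts, YoungDiagram.rowLens]
    generalize μ.colLen 0 = K
    induction K with
    | zero => rfl
    | succ K ih =>
      rw [List.range_succ, List.map_append, List.countP_append, ih, Finset.sum_range_succ]
      congr 1
      rcases Nat.mod_two_eq_zero_or_one (μ.rowLen K) with h | h <;> simp [h]
  simp only [altSum, h1, Finset.mul_sum]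
  rw [Finset.sum_comm]
  simp only [h2]
  rw [h3]
  push_cast
  rfl

end Shapes

/-! ## The isomorphism -/

section Isomorphism
variable {m n k : ℕ}

/-- The shape of a matrix. -/
def shape (A : Mat m n) : YoungDiagram :=
  diagramOf (colLens (matTab A)) (rowWord A).length (isTab_insTab _).colLens_antitone

theorem colLen_shape (A : Mat m n) : (shape A).colLen = colLens (matTab A) :=
  colLen_diagramOf _ fun c hc => by simp [colLens, matTab, insTab_supp _ c hc]

theorem rowLen_shape_le (A : Mat m n) : (shape A).rowLen 0 ≤ (rowWord A).length := by
  by_contra h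
  have h1 : (0, (rowWord A).length) ∈ shape A := YoungDiagram.mem_iff_lt_rowLen.2 (not_le.1 h)
  rw [YoungDiagram.mem_iff_lt_colLen, colLen_shape] at h1
  simp [colLens, matTab, insTab_supp] at h1

theorem matWord_eq_readCols (A : Mat m n) :
    matWord A = readCols ((shape A).rowLen 0) (matTab A) :=
  readCols_eq_of_supp (rowLen_shape_le A) fun _ hc =>
    supp_of_colLens_eq (colLen_shape A).symm hc

theorem matWord_mem (A : Mat m n) : matWord A ∈ tableauWords m n (shape A) :=
  mem_tableauWords.2 ⟨matTab A, isTab_insTab _, (colLen_shape A).symm, matWord_eq_readCols A⟩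

theorem oddParts_shape {A : Mat m n} (hA : A ∈ symMatrices m n) :
    oddParts (shape A) = diagOdd A := by
  have h1 := altSum_colLen (rowLen_shape_le A)
  rw [colLen_shape, altSum_colLens_matTab hA le_rfl] at h1
  exact_mod_cast h1.symm

/-- The map sending a symmetric matrix to its tableau. -/
def toTableau (A : symLevel m n k) :
    Σ μ : {μ : YoungDiagram // IsHook m n μ ∧ oddParts μ = k}, tableauWords m n μ.val :=
  ⟨⟨shape A.val.val, (isTab_insTab _).isHook (colLen_shape _).symm,
    (oddParts_shape A.val.2).trans A.2⟩, ⟨matWord A.val.val, matWord_mem _⟩⟩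

theorem tableau_ext {s t : Σ μ : {μ : YoungDiagram // IsHook m n μ ∧ oddParts μ = k},
    tableauWords m n μ.val} (h : s.1.val = t.1.val) (h' : s.2.val = t.2.val) : s = t := by
  obtain ⟨⟨μ, hμ⟩, ⟨w, hw⟩⟩ := s
  obtain ⟨⟨ν, hν⟩, ⟨w', hw'⟩⟩ := t
  dsimp only at h h'
  subst h h'
  rfl

/-- Injectivity holds because shape and reading word give P(A), and P(A) = P(Aᵗ) gives A. For
surjectivity, a tableau used as insertion and recording tableau comes from a symmetric matrix, whose
level is the number of odd parts of the shape. -/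
theorem toTableau_bijective : Function.Bijective (toTableau (m := m) (n := n) (k := k)) := by
  constructor
  · intro A B h
    have h1 : shape A.val.val = shape B.val.val := congrArg (fun s => s.1.val) h
    have h2 : matWord A.val.val = matWord B.val.val := congrArg (fun s => s.2.val) h
    refine Subtype.ext (Subtype.ext (matWord_injective A.val.2 B.val.2 ?_ h2))
    rw [← colLen_shape, ← colLen_shape, h1]
  · rintro ⟨⟨μ, hμ, hk⟩, ⟨w, hw⟩⟩
    obtain ⟨T, hT, hc, rfl⟩ := mem_tableauWords.1 hw
    obtain ⟨p, hp, hs, rfl⟩ := exists_symmetric_biTab_eq hT fun _ h => supp_of_colLens_eq hc h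
    have hsym : matrixOf p ∈ symMatrices m n := by
      refine ⟨matrixOf_mem hp, ?_⟩
      rw [← matrixOf_swap]
      ext b b'
      exact hs.count_eq _
    have hm : matTab (matrixOf p) = biTab p := by rw [matTab, rowWord, biword_matrixOf hp]
    have hsh : shape (matrixOf p) = μ := youngDiagram_ext (by rw [colLen_shape, hm, hc])
    refine ⟨⟨⟨matrixOf p, hsym⟩, ?_⟩, tableau_ext hsh ?_⟩
    · change diagOdd _ = k
      rw [← oddParts_shape hsym, hsh, hk]
    · change matWord (matrixOf p) = _
      rw [matWord_eq_readCols, hsh, hm]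

theorem shape_eq_of_colLens {A B : Mat m n} (h : colLens (matTab A) = colLens (matTab B)) :
    shape A = shape B := youngDiagram_ext (by rw [colLen_shape, colLen_shape, h])

/-- The map to tableaux commutes with the operators. -/
theorem toTableau_operator {x : List (Letter m n) → Option (List (Letter m n))} (hx : IsPlactic x)
    (hst : ∀ A ∈ symMatrices m n, ∀ B (hB : B ∈ symMatrices m n), diagAct x A = some B →
      diagOdd A = k → diagOdd B = k) (A : symLevel m n k) :
    (restrictOption (tableauWords m n (shape A.val.val)) (x (matWord A.val.val))).map
        (fun w => (⟨(toTableau A).1, w⟩ :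
          Σ μ : {μ : YoungDiagram // IsHook m n μ ∧ oddParts μ = k}, tableauWords m n μ.val)) =
      (restrictOption (symLevel m n k)
        (restrictOption (symMatrices m n) (diagAct x A.val.val))).map toTableau := by
  rcases h : diagAct x A.val.val with _ | B
  · rw [(diagAct_eq_none hx A.val.2).1 h]
    rfl
  · obtain ⟨hB, h1, h2⟩ := diagAct_eq_some hx A.val.2 h
    have hs := shape_eq_of_colLens h2
    have e1 : restrictOption (symLevel m n k) (restrictOption (symMatrices m n) (some B)) =
        some ⟨⟨B, hB⟩, hst _ A.val.2 B hB h A.2⟩ :=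
      restrictOption_eq_some.2 (restrictOption_eq_some.2 rfl)
    have e2 : restrictOption (tableauWords m n (shape A.val.val)) (x (matWord A.val.val)) =
        some ⟨matWord B, by rw [← hs]; exact matWord_mem B⟩ := restrictOption_eq_some.2 h1
    rw [e1]
    -- The shapes of `A` and `B` are equal but not by definition, so the two elements of the
    -- disjoint union are compared through `tableau_ext`.
    exact (congrArg (Option.map _) e2).trans (congrArg some (tableau_ext hs.symm rfl))

/-- The isomorphism of crystals. -/
noncomputable def symLevelIso (m n k : ℕ) : CrystalIso ((symCrystal m n).restrict (symLevel m n k))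
    (directSum fun μ : {μ : YoungDiagram // IsHook m n μ ∧ oddParts μ = k} =>
      tableauCrystal m n μ.val) where
  toEquiv := Equiv.ofBijective toTableau toTableau_bijective
  wt_eq A := (symCrystal_wt A.val).symm
  eps_eq i A := (symCrystal_eps i A.val).symm
  phi_eq i A := (symCrystal_phi i A.val).symm
  e_eq i A := toTableau_operator (isPlactic_wordE i) (fun _ hA _ hB h hk =>
    (diagOdd_eq_of_colLens hB hA (diagAct_eq_some (isPlactic_wordE i) hA h).2.2).trans hk) A
  f_eq i A := toTableau_operator (isPlactic_wordF i) (fun _ hA _ hB h hk =>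
    (diagOdd_eq_of_colLens hB hA (diagAct_eq_some (isPlactic_wordF i) hA h).2.2).trans hk) A

end Isomorphism

end SuperCrystal

theorem proposition3p10 (m n : ℕ) (hmn : 0 < m + n) (k : ℕ) :
    SuperCrystal.IsSubcrystal (SuperCrystal.diagData m n) (SuperCrystal.symMatrices m n) ∧
    SuperCrystal.IsSubcrystal (SuperCrystal.symCrystal m n) (SuperCrystal.symLevel m n k) ∧
    Nonempty (SuperCrystal.CrystalIso
      ((SuperCrystal.symCrystal m n).restrict (SuperCrystal.symLevel m n k))
      (SuperCrystal.directSum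
        fun μ : {μ : YoungDiagram // SuperCrystal.IsHook m n μ ∧ SuperCrystal.oddParts μ = k} =>
          SuperCrystal.tableauCrystal m n μ.val)) :=
  ⟨⟨SuperCrystal.isStable_symMatrices, SuperCrystal.isCrystal_symCrystal⟩,
    ⟨SuperCrystal.isStable_symLevel k, SuperCrystal.isCrystal_symCrystal.restrict _⟩,
    ⟨SuperCrystal.symLevelIso m n k⟩⟩
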